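/- Let $n\ge 1$, $\beta>0$ and $R>0$. For a compact set $K\subset\mathbb R^n$ and a bounded open set $\Omega\subset\mathbb R^n$ with $K\subset\overline\Omega$, put $$I_\beta(K;\Omega)=\inf\Big\{\int_\Omega|\nabla\varphi|^2\,dx+\beta\int_{\partial^*\Omega}\varphi^2\,d\mathcal H^{n-1} : \varphi\in H^1(\mathbb R^n),\ \varphi\ge 1 \text{ in } K\Big\},$$ where $\partial^*\Omega$ is the reduced boundary of $\Omega$ and the pointwise values of $\varphi$ are those of its precise representative (so that "$\varphi\ge1$ in $K$" holds up to a set of zero $H^1$-capacity). For a bounded connected open set $D\subset\mathbb R^n$ and $\delta>0$ put $I_{\beta,\delta}(D)=I_\beta(\overline D;D+\delta B)$, where $B$ is the unit ball centred at the origin and $D+\delta B$ is the Minkowski sum. Let $B_R$ be the open ball of radius $R$ centred at the origin. (a) If $\beta\ge\frac{n-1}{R}$, then $\delta\mapsto I_{\beta,\delta}(B_R)$ is strictly decreasing on $(0,\infty)$. (b) If $\beta<\frac{n-1}{R}$, then $\delta\mapsto I_{\beta,\delta}(B_R)$ is strictly increasing on $\big(0,\frac{n-1}{\beta}-R\big]$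 and strictly decreasing on $\big[\frac{n-1}{\beta}-R,\infty\big)$. -/

import Mathlib

open MeasureTheory Metric Set Filter Topology
open scoped ENNReal ContDiff Pointwise

namespace HeatDispersion

noncomputable section

/-- `ℝⁿ` with its Euclidean structure. -/
abbrev Eucl (n : ℕ) : Type := EuclideanSpace ℝ (Fin n)

/-! ### The Sobolev space `H¹(ℝⁿ)` -/

/-- `φ ∈ H¹(ℝⁿ)`, and the vector field `G ∈ L²` is the weak gradient of `φ`. -/
structure IsH1WithGradient {n : ℕ} (φ : Eucl n → ℝ) (G : Eucl n → Eucl n) : Prop where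
  memLp : MemLp φ 2 volume
  memLp_grad : MemLp G 2 volume
  integral_by_parts : ∀ ψ : Eucl n → ℝ, ContDiff ℝ ∞ ψ → HasCompactSupport ψ → ∀ v : Eucl n,
    ∫ x, φ x * fderiv ℝ ψ x v = - ∫ x, inner ℝ (G x) v * ψ x

open Classical in
/-- The precise representative of `φ`: the limit of the averages of `φ` over balls shrinking to
the point (and `0` where there is no limit). For `φ ∈ H¹(ℝⁿ)` the limit exists outside a set of
zero capacity, in particular `ℋⁿ⁻¹`-almost everywhere, and it gives the pointwise values and the
traces of `φ`. -/
def preciseRep {n : ℕ} (φ : Eucl n → ℝ) (x : Eucl n) : ℝ :=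
  if h : ∃ l : ℝ, Tendsto (fun r : ℝ => ⨍ y in ball x r, φ y) (𝓝[>] 0) (𝓝 l) then h.choose else 0

/-- The Sobolev (`H¹`) capacity of a set `A ⊆ ℝⁿ`. -/
def capacity {n : ℕ} (A : Set (Eucl n)) : ℝ≥0∞ :=
  sInf {c : ℝ≥0∞ | ∃ (φ : Eucl n → ℝ) (G : Eucl n → Eucl n) (U : Set (Eucl n)),
    IsH1WithGradient φ G ∧ IsOpen U ∧ A ⊆ U ∧ (∀ᵐ x, x ∈ U → 1 ≤ φ x) ∧
    c = (∫⁻ x, ‖φ x‖ₑ ^ 2) + ∫⁻ x, ‖G x‖ₑ ^ 2}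

/-- `φ ≥ 1` in `K` for a Sobolev function `φ`: the precise representative of `φ` is at least `1`
at all points of `K` up to a set of zero capacity. -/
def GeOneOn {n : ℕ} (φ : Eucl n → ℝ) (K : Set (Eucl n)) : Prop :=
  capacity {x ∈ K | preciseRep φ x < 1} = 0

/-! ### The reduced boundary -/

/-- The divergence of a vector field on `ℝⁿ`. -/
def divergence {n : ℕ} (T : Eucl n → Eucl n) (x : Eucl n) : ℝ :=
  ∑ i : Fin n, (fderiv ℝ T x (EuclideanSpace.single i 1)) i

/-- `E` has locally finite perimeter, with perimeter measure `μ` (that is, `|Dχ_E|`) and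
measure-theoretic outer unit normal `ν` (so that `Dχ_E = -ν μ`): the Gauss–Green formula holds
for all compactly supported `C¹` vector fields. The measure `μ` is determined by `E`, and `ν` is
determined `μ`-almost everywhere. -/
structure IsGaussGreen {n : ℕ} (E : Set (Eucl n)) (μ : Measure (Eucl n))
    (ν : Eucl n → Eucl n) : Prop where
  locallyFinite : IsLocallyFiniteMeasure μ
  measurable_normal : Measurable ν
  norm_normal : ∀ᵐ x ∂μ, ‖ν x‖ = 1
  gauss_green : ∀ T : Eucl n → Eucl n, ContDiff ℝ 1 T → HasCompactSupport T →
    ∫ x in E, divergence T x = ∫ x, inner ℝ (T x) (ν x) ∂μ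

/-- De Giorgi's reduced boundary `∂*E` of a set `E` of locally finite perimeter: the points `x` of
the support of the perimeter measure at which the averages of the normal over `B(x, r)` with
respect to the perimeter measure converge, as `r → 0`, to a unit vector. -/
def reducedBoundary {n : ℕ} (E : Set (Eucl n)) : Set (Eucl n) :=
  {x | ∃ (μ : Measure (Eucl n)) (ν : Eucl n → Eucl n), IsGaussGreen E μ ν ∧
    (∀ r : ℝ, 0 < r → 0 < μ (ball x r)) ∧
    ∃ ν₀ : Eucl n, ‖ν₀‖ = 1 ∧
      Tendsto (fun r : ℝ => ⨍ y in ball x r, ν y ∂μ) (𝓝[>] 0) (𝓝 ν₀)}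

/-! ### The heat dispersion -/

/-- The energy `∫_Ω |∇φ|² dx + β ∫_{∂*Ω} φ² dℋⁿ⁻¹` of a Sobolev function `φ` with weak gradient
`G`. Here `μHE[n - 1]` is the Hausdorff measure `ℋⁿ⁻¹` in its usual normalization. -/
def energy {n : ℕ} (β : ℝ) (Ω : Set (Eucl n)) (φ : Eucl n → ℝ) (G : Eucl n → Eucl n) : ℝ≥0∞ :=
  (∫⁻ x in Ω, ‖G x‖ₑ ^ 2) +
    ENNReal.ofReal β * ∫⁻ x in reducedBoundary Ω, ‖preciseRep φ x‖ₑ ^ 2 ∂μHE[n - 1]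

/-- The heat dispersion `I_β(K; Ω)`. -/
def dispersion {n : ℕ} (β : ℝ) (K Ω : Set (Eucl n)) : ℝ≥0∞ :=
  sInf {e : ℝ≥0∞ | ∃ (φ : Eucl n → ℝ) (G : Eucl n → Eucl n),
    IsH1WithGradient φ G ∧ GeOneOn φ K ∧ e = energy β Ω φ G}

/-- The heat dispersion `I_{β,δ}(D)` of `D` insulated by a layer of constant thickness `δ`:
`I_β(closure D; D + δ B)` with `B` the unit ball. -/
def layerDispersion {n : ℕ} (β δ : ℝ) (D : Set (Eucl n)) : ℝ≥0∞ :=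
  dispersion β (closure D) (D + δ • ball (0 : Eucl n) 1)

end

end HeatDispersion

/-! The dispersion of a ball is computed exactly. With `ρ = R + δ` and `c` the area of the unit
sphere, it equals `c / Λ(ρ)`, where `Λ(ρ) = ∫_R^ρ s^(1-n) ds + 1 / (β ρ^(n-1))` is `resistance`:
conduction through the layer in series with exchange at its surface. Since `Λ'(ρ) = ρ^(-n) (ρ -
(n-1)/β)`, the resistance decreases strictly up to `ρ = (n-1)/β` and increases strictly afterwards.
Both parts are read off from this sign.

The upper bound (`dispersion_ball_le`) comes from the radial function that is harmonic in the layer,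
with slope `κ r^(1-n)`, `κ = 1/Λ(ρ)`, and satisfies the Robin condition on the outer sphere.

The lower bound (`le_energy_ball`) is a calibration. With `F = x/|x|^n` on a shell `s < |x| < ρ` and
`t = κ / (β ρ^(n-1))`, the inequalities `|G|² ≥ -2κ G·F - κ²|F|²` and `φ² ≥ 2tφ - t²` are equalities
for the radial solution and bound the energy below by expressions linear in `φ`. Gauss–Green on the
shell (`integral_sphere_preciseRep_sub`) cancels the terms on the outer sphere and leaves the trace
on `|x| = s`, which is at least `1` for almost every `s < R`; then `s → R`.

The analytic work is to give these steps meaning for a general Sobolev function, whose boundary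
values are limits of ball averages. Averages of `φ` have increments given by averages of `G` along
every segment, and the mean of `|G|` at scale `t`, integrated over a sphere, is `O(t^(-1/2))`. This
is integrable at `0`, so the averages converge in `L¹` of every sphere centred at the origin
(`tendsto_integral_sphere`). Two geometric facts identify the surface term: the reduced boundary of
a ball is its sphere (`reducedBoundary_ball`), and the normalized Hausdorff measure on the sphere is
the surface measure of polar coordinates (`euclideanHausdorffMeasure_restrict_sphere`). -/

namespace HeatDispersion

/-! ### Polar coordinates -/

/-- The surface measure of the unit sphere of `ℝⁿ`. -/
noncomputable abbrev sphereArea (n : ℕ) : Measure (sphere (0 : Eucl n) 1) :=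
  (volume : Measure (Eucl n)).toSphere

/-- The measure `rⁿ⁻¹ dr` on the positive half-line. -/
noncomputable def radialMeasure (n : ℕ) : Measure ℝ :=
  (volume.restrict (Ioi 0)).withDensity fun r => ENNReal.ofReal (r ^ (n - 1))

instance (n : ℕ) : SFinite (radialMeasure n) := by
  unfold radialMeasure; infer_instance

lemma map_volumeIoiPow (n : ℕ) :
    (Measure.volumeIoiPow (n - 1)).map Subtype.val = radialMeasure n := by
  ext s hs
  rw [Measure.map_apply measurable_subtype_coe hs, Measure.volumeIoiPow,
    withDensity_apply _ (measurable_subtype_coe hs),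
    setLIntegral_subtype measurableSet_Ioi _ fun a : ℝ => ENNReal.ofReal (a ^ (n - 1)),
    radialMeasure, withDensity_apply _ hs, Subtype.image_preimage_coe,
    Measure.restrict_restrict hs, inter_comm]

/-- The polar homeomorphism lives on the punctured space, and the origin is null because `n ≠ 0`.
Radii are taken in `ℝ`, with a measure carried by `Ioi 0`, so that later integrals need no subtypes.
-/
theorem measurePreserving_polar (n : ℕ) [NeZero n] :
    MeasurePreserving (fun p : sphere (0 : Eucl n) 1 × ℝ => p.2 • (p.1 : Eucl n))
      ((sphereArea n).prod (radialMeasure n)) volume := by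
  have h1 := ((volume : Measure (Eucl n)).measurePreserving_homeomorphUnitSphereProd).symm
    (homeomorphUnitSphereProd (Eucl n)).toMeasurableEquiv
  rw [finrank_euclideanSpace_fin] at h1
  have h2 : MeasurePreserving (Subtype.val : ({0}ᶜ : Set (Eucl n)) → Eucl n)
      ((volume : Measure (Eucl n)).comap (↑)) volume := by
    refine ⟨measurable_subtype_coe, ?_⟩
    rw [map_comap_subtype_coe (measurableSet_singleton _).compl, restrict_compl_singleton]
  have h3 : MeasurePreserving (Prod.map id Subtype.val :
      sphere (0 : Eucl n) 1 × Ioi (0 : ℝ) → sphere (0 : Eucl n) 1 × ℝ)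
      ((sphereArea n).prod (Measure.volumeIoiPow (n - 1)))
      ((sphereArea n).prod (radialMeasure n)) :=
    (MeasurePreserving.id _).prod ⟨measurable_subtype_coe, map_volumeIoiPow n⟩
  have hm : Measurable (fun p : sphere (0 : Eucl n) 1 × ℝ => p.2 • (p.1 : Eucl n)) := by
    fun_prop
  refine ⟨hm, ?_⟩
  rw [← h3.map_eq, Measure.map_map hm h3.measurable, ← (h2.comp h1).map_eq]
  rfl

lemma lintegral_polar {n : ℕ} [NeZero n] {f : Eucl n → ℝ≥0∞} (hf : Measurable f) :
    ∫⁻ x, f x = ∫⁻ r in Ioi (0 : ℝ), ENNReal.ofReal (r ^ (n - 1)) *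
      ∫⁻ θ, f (r • (θ : Eucl n)) ∂sphereArea n := by
  have hf' : Measurable fun p : sphere (0 : Eucl n) 1 × ℝ => f (p.2 • (p.1 : Eucl n)) := by
    fun_prop
  rw [← (measurePreserving_polar n).lintegral_comp hf, lintegral_prod_symm _ hf'.aemeasurable,
    radialMeasure, lintegral_withDensity_eq_lintegral_mul _ (by fun_prop)
    hf'.lintegral_prod_left']
  rfl

lemma integrable_polar_iff {n : ℕ} [NeZero n] {f : Eucl n → ℝ} (hf : AEStronglyMeasurable f) :
    Integrable (fun p : sphere (0 : Eucl n) 1 × ℝ => f (p.2 • (p.1 : Eucl n)))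
      ((sphereArea n).prod (radialMeasure n)) ↔ Integrable f :=
  (measurePreserving_polar n).integrable_comp hf

lemma integral_radialMeasure {n : ℕ} (g : ℝ → ℝ) :
    ∫ r, g r ∂radialMeasure n = ∫ r in Ioi (0 : ℝ), r ^ (n - 1) * g r := by
  rw [radialMeasure, integral_withDensity_eq_integral_toReal_smul (by fun_prop) (by simp)]
  refine setIntegral_congr_fun measurableSet_Ioi fun r hr => ?_
  simp [ENNReal.toReal_ofReal (pow_nonneg (le_of_lt hr) _)]

/-- Both orders of integration are needed: the angle outside for increments along rays, the radius
outside for fluxes through spheres and radial functions. -/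
lemma integral_polar {n : ℕ} [NeZero n] {f : Eucl n → ℝ} (hf : Integrable f) :
    ∫ x, f x = ∫ θ, (∫ r in Ioi (0 : ℝ), r ^ (n - 1) * f (r • (θ : Eucl n))) ∂sphereArea n := by
  have h := (integrable_polar_iff hf.1).2 hf
  have hae : AEStronglyMeasurable f (Measure.map
      (fun p : sphere (0 : Eucl n) 1 × ℝ => p.2 • (p.1 : Eucl n))
      ((sphereArea n).prod (radialMeasure n))) := by
    rw [(measurePreserving_polar n).map_eq]; exact hf.1
  conv_lhs => rw [← (measurePreserving_polar n).map_eq]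
  rw [integral_map (measurePreserving_polar n).measurable.aemeasurable hae, integral_prod _ h]
  simp_rw [integral_radialMeasure]

lemma integral_polar_symm {n : ℕ} [NeZero n] {f : Eucl n → ℝ} (hf : Integrable f) :
    ∫ x, f x = ∫ r in Ioi (0 : ℝ), r ^ (n - 1) * ∫ θ, f (r • (θ : Eucl n)) ∂sphereArea n := by
  have h := (integrable_polar_iff hf.1).2 hf
  have hae : AEStronglyMeasurable f (Measure.map
      (fun p : sphere (0 : Eucl n) 1 × ℝ => p.2 • (p.1 : Eucl n))
      ((sphereArea n).prod (radialMeasure n))) := by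
    rw [(measurePreserving_polar n).map_eq]; exact hf.1
  conv_lhs => rw [← (measurePreserving_polar n).map_eq]
  rw [integral_map (measurePreserving_polar n).measurable.aemeasurable hae,
    integral_prod_symm _ h, integral_radialMeasure]

/-- The surface measure of the sphere of radius `ρ` centred at the origin, as a measure on `ℝⁿ`. -/
noncomputable def sphereSurface (n : ℕ) (ρ : ℝ) : Measure (Eucl n) :=
  ENNReal.ofReal (ρ ^ (n - 1)) •
    (sphereArea n).map fun θ : sphere (0 : Eucl n) 1 => ρ • (θ : Eucl n)

instance (n : ℕ) (ρ : ℝ) : IsFiniteMeasure (sphereSurface n ρ) := by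
  unfold sphereSurface
  have : IsFiniteMeasure ((sphereArea n).map fun θ : sphere (0 : Eucl n) 1 =>
      ρ • (θ : Eucl n)) := inferInstance
  exact Measure.smul_finite _ ENNReal.ofReal_ne_top

/-! ### The surface measure and the Hausdorff measure -/

lemma euclideanHausdorffMeasure_image_le {X Y : Type*} [EMetricSpace X] [MeasurableSpace X]
    [BorelSpace X] [EMetricSpace Y] [MeasurableSpace Y] [BorelSpace Y] {K : NNReal} {f : X → Y}
    {s : Set X} (h : LipschitzOnWith K f s) (d : ℕ) :
    μHE[d] (f '' s) ≤ (K : ℝ≥0∞) ^ d * μHE[d] s := by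
  simp_rw [Measure.euclideanHausdorffMeasure_def, Measure.smul_apply, ENNReal.smul_def, smul_eq_mul]
  have := h.hausdorffMeasure_image_le (d := d) (by positivity)
  rw [ENNReal.rpow_natCast] at this
  refine (mul_le_mul_right this _).trans_eq ?_
  ring

lemma le_euclideanHausdorffMeasure_image {X Y : Type*} [MetricSpace X] [MeasurableSpace X]
    [BorelSpace X] [MetricSpace Y] [MeasurableSpace Y] [BorelSpace Y] {K : NNReal} {f : X → Y}
    {s : Set X} (h : ∀ x ∈ s, ∀ y ∈ s, dist x y ≤ K * dist (f x) (f y)) (d : ℕ) :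
    μHE[d] s ≤ (K : ℝ≥0∞) ^ d * μHE[d] (f '' s) := by
  rcases s.eq_empty_or_nonempty with rfl | ⟨x₀, -⟩
  · simp
  have : Nonempty X := ⟨x₀⟩
  have hinj : InjOn f s := fun x hx y hy hxy => by
    have := h x hx y hy
    rw [hxy, dist_self, mul_zero] at this
    exact dist_le_zero.1 this
  have hleft := hinj.leftInvOn_invFunOn
  have hlip : LipschitzOnWith K (Function.invFunOn f s) (f '' s) := by
    refine LipschitzOnWith.of_dist_le_mul ?_
    rintro _ ⟨x, hx, rfl⟩ _ ⟨y, hy, rfl⟩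
    rw [hleft hx, hleft hy]
    exact h x hx y hy
  have himg : Function.invFunOn f s '' (f '' s) = s := hleft.image_image
  simpa only [himg] using euclideanHausdorffMeasure_image_le hlip d

/-- The part between the radii `a` and `b` of the cone over a set `A` of unit vectors. -/
def coneShell {n : ℕ} (a b : ℝ) (A : Set (Eucl n)) : Set (Eucl n) :=
  {x | ‖x‖ ∈ Ioo a b ∧ ‖x‖⁻¹ • x ∈ A}

lemma volume_coneShell {n : ℕ} [NeZero n] {a b : ℝ} (ha : 0 ≤ a)
    {A : Set (sphere (0 : Eucl n) 1)} (hA : MeasurableSet A) :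
    volume (coneShell a b ((↑) '' A : Set (Eucl n))) =
      (∫⁻ r in Ioo a b, ENNReal.ofReal (r ^ (n - 1))) * sphereArea n A := by
  have hA' : MeasurableSet ((↑) '' A : Set (Eucl n)) :=
    (MeasurableEmbedding.subtype_coe isClosed_sphere.measurableSet).measurableSet_image.2 hA
  have hC : MeasurableSet (coneShell a b ((↑) '' A : Set (Eucl n))) := by
    refine (measurable_norm measurableSet_Ioo).inter ?_
    exact (measurable_norm.inv.smul measurable_id) hA'
  rw [← lintegral_indicator_one hC, lintegral_polar (measurable_one.indicator hC),
    ← lintegral_mul_const _ (by fun_prop), ← lintegral_indicator measurableSet_Ioi,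
    ← lintegral_indicator measurableSet_Ioo]
  refine lintegral_congr fun r => ?_
  by_cases hr : 0 < r
  · rw [indicator_of_mem (mem_Ioi.2 hr)]
    by_cases hr' : r ∈ Ioo a b
    · rw [indicator_of_mem hr', ← lintegral_indicator_one hA]
      congr 1
      refine lintegral_congr fun θ => ?_
      have hθ : ‖(θ : Eucl n)‖ = 1 := by simp
      have : (r • (θ : Eucl n)) ∈ coneShell a b ((↑) '' A : Set (Eucl n)) ↔ θ ∈ A := by
        simp [coneShell, norm_smul, hθ, abs_of_pos hr, hr'.1, hr'.2, smul_smul, hr.ne']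
      by_cases hθA : θ ∈ A
      · rw [indicator_of_mem hθA, indicator_of_mem (this.2 hθA)]; rfl
      · rw [indicator_of_notMem hθA, indicator_of_notMem (this.not.2 hθA)]
    · rw [indicator_of_notMem hr']
      have : ∀ θ : sphere (0 : Eucl n) 1,
          indicator (coneShell a b ((↑) '' A : Set (Eucl n))) (1 : Eucl n → ℝ≥0∞)
            (r • (θ : Eucl n)) = 0 := fun θ => by
        have hθ : ‖(θ : Eucl n)‖ = 1 := by simp
        refine indicator_of_notMem (fun h => hr' ?_) _
        simpa [norm_smul, hθ, abs_of_pos hr] using h.1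
      simp [this]
  · rw [indicator_of_notMem (by simpa using hr), indicator_of_notMem]
    intro h
    exact hr (ha.trans_lt h.1)

/-- The law of cosines, with radial and angular parts separated; it makes distances in a thin shell
comparable with distances in `capChart`. -/
lemma norm_smul_sub_smul_sq {n : ℕ} {a b : Eucl n} (ha : ‖a‖ = 1) (hb : ‖b‖ = 1) (s t : ℝ) :
    ‖s • a - t • b‖ ^ 2 = (s - t) ^ 2 + s * t * ‖a - b‖ ^ 2 := by
  rw [@norm_sub_sq_real, @norm_sub_sq_real, norm_smul, norm_smul, inner_smul_left, inner_smul_right,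
    ha, hb]
  simp only [Real.norm_eq_abs, mul_one, sq_abs, conj_trivial]
  ring

/-- The orthogonal projection onto a hyperplane is nearly isometric on a small spherical cap. -/
lemma norm_sub_sq_le_norm_proj {n : ℕ} {x a b : Eucl n} {η : ℝ}
    (hx : ‖x‖ = 1) (ha : ‖a‖ = 1) (hb : ‖b‖ = 1) (hxa : ‖a - x‖ ≤ η) (hxb : ‖b - x‖ ≤ η) :
    (1 - η ^ 2) * ‖a - b‖ ^ 2 ≤ ‖(ℝ ∙ x)ᗮ.orthogonalProjectionOnto (a - b)‖ ^ 2 := by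
  have h1 := (ℝ ∙ x).norm_sq_eq_add_norm_sq_projection (a - b)
  have h2 : ‖(ℝ ∙ x).orthogonalProjectionOnto (a - b)‖ ≤ η * ‖a - b‖ := by
    rw [Submodule.coe_norm, Submodule.coe_orthogonalProjectionOnto_apply,
      Submodule.starProjection_unit_singleton ℝ hx, norm_smul, hx, mul_one, Real.norm_eq_abs]
    -- The chord of two unit vectors is orthogonal to their midpoint, so in the product with `x`
    -- only the difference between `x` and the midpoint counts, and that is at most `η`.
    have h3 : inner ℝ (a - b) (a + b) = 0 := by
      rw [inner_sub_left, inner_add_right, inner_add_right, real_inner_self_eq_norm_sq,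
        real_inner_self_eq_norm_sq, ha, hb, real_inner_comm b a]
      ring
    have h4 : inner ℝ x (a - b) = inner ℝ (x - (1 / 2 : ℝ) • (a + b)) (a - b) := by
      rw [inner_sub_left, inner_smul_left, real_inner_comm (a - b) (a + b), h3]; simp
    rw [h4]
    refine (abs_real_inner_le_norm _ _).trans ?_
    gcongr
    have h5 : x - (1 / 2 : ℝ) • (a + b) = -((1 / 2 : ℝ) • ((a - x) + (b - x))) := by
      module
    rw [h5, norm_neg, norm_smul]
    have := norm_add_le (a - x) (b - x)
    norm_num
    linarith
  have h6 : ‖(ℝ ∙ x).orthogonalProjectionOnto (a - b)‖ ^ 2 ≤ (η * ‖a - b‖) ^ 2 := by gcongr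
  nlinarith

lemma le_setLIntegral_pow {η : ℝ} (hη1 : η < 1) (d : ℕ) :
    ENNReal.ofReal ((1 - η) ^ d) * ENNReal.ofReal η ≤
      ∫⁻ r in Ioo (1 - η) 1, ENNReal.ofReal (r ^ d) := by
  have h : ENNReal.ofReal η = volume (Ioo (1 - η) 1) := by rw [Real.volume_Ioo]; ring_nf
  rw [h, ← setLIntegral_const]
  refine setLIntegral_mono (by fun_prop) fun r hr => ENNReal.ofReal_le_ofReal ?_
  exact pow_le_pow_left₀ (by linarith) hr.1.le _

lemma setLIntegral_pow_le {η : ℝ} (hη1 : η < 1) (d : ℕ) :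
    ∫⁻ r in Ioo (1 - η) 1, ENNReal.ofReal (r ^ d) ≤ ENNReal.ofReal η := by
  have h : ENNReal.ofReal η = volume (Ioo (1 - η) 1) := by rw [Real.volume_Ioo]; ring_nf
  rw [h, ← one_mul (volume _), ← setLIntegral_const]
  refine setLIntegral_mono (by fun_prop) fun r hr => ?_
  rw [← ENNReal.ofReal_one]
  exact ENNReal.ofReal_le_ofReal (pow_le_one₀ (by linarith [hr.1]) hr.2.le)

/-- Cylindrical coordinates over the hyperplane orthogonal to `x`: the projection of the direction
and the modulus. -/
noncomputable def capChart {n : ℕ} (x y : Eucl n) : WithLp 2 ((ℝ ∙ x)ᗮ × ℝ) :=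
  WithLp.toLp 2 ((ℝ ∙ x)ᗮ.orthogonalProjectionOnto (‖y‖⁻¹ • y), ‖y‖)

lemma dist_capChart_sq {n : ℕ} (x y z : Eucl n) :
    dist (capChart x y) (capChart x z) ^ 2 =
      ‖(ℝ ∙ x)ᗮ.orthogonalProjectionOnto (‖y‖⁻¹ • y - ‖z‖⁻¹ • z)‖ ^ 2 + (‖y‖ - ‖z‖) ^ 2 := by
  rw [dist_eq_norm, WithLp.prod_norm_sq_eq_of_L2]
  simp [capChart, sq_abs]

lemma coneShell_sub_sq {n : ℕ} {a b : ℝ} (ha : 0 ≤ a) {A : Set (Eucl n)} {y z : Eucl n}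
    (hy : y ∈ coneShell a b A) (hz : z ∈ coneShell a b A) :
    ‖‖y‖⁻¹ • y‖ = 1 ∧ ‖‖z‖⁻¹ • z‖ = 1 ∧
    dist y z ^ 2 = (‖y‖ - ‖z‖) ^ 2 + ‖y‖ * ‖z‖ * ‖‖y‖⁻¹ • y - ‖z‖⁻¹ • z‖ ^ 2 := by
  have hy0 : 0 < ‖y‖ := ha.trans_lt hy.1.1
  have hz0 : 0 < ‖z‖ := ha.trans_lt hz.1.1
  have h1 : ‖‖y‖⁻¹ • y‖ = 1 := by rw [norm_smul, norm_inv, norm_norm, inv_mul_cancel₀ hy0.ne']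
  have h2 : ‖‖z‖⁻¹ • z‖ = 1 := by rw [norm_smul, norm_inv, norm_norm, inv_mul_cancel₀ hz0.ne']
  refine ⟨h1, h2, ?_⟩
  rw [← norm_smul_sub_smul_sq h1 h2, smul_smul, smul_smul, mul_inv_cancel₀ hy0.ne',
    mul_inv_cancel₀ hz0.ne', one_smul, one_smul, dist_eq_norm]

/-- The image is a cylinder, whose volume is the measure of the base times the height. This is how
`n`-dimensional volume gives access to `(n-1)`-dimensional Hausdorff measure. -/
lemma capChart_image {n : ℕ} {x : Eucl n} {a b : ℝ} (ha : 0 ≤ a) {A : Set (Eucl n)}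
    (hA : ∀ y ∈ A, ‖y‖ = 1) :
    capChart x '' coneShell a b A =
      WithLp.ofLp ⁻¹' (((ℝ ∙ x)ᗮ.orthogonalProjectionOnto '' A) ×ˢ Ioo a b) := by
  ext p
  constructor
  · rintro ⟨y, hy, rfl⟩
    exact ⟨⟨_, hy.2, rfl⟩, hy.1⟩
  · rintro ⟨⟨y, hy, hyp⟩, hp⟩
    have hp0 : 0 < p.snd := ha.trans_lt hp.1
    have hn : ‖p.snd • y‖ = p.snd := by
      rw [norm_smul, hA y hy, Real.norm_eq_abs, abs_of_pos hp0, mul_one]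
    have hs : p.snd⁻¹ • p.snd • y = y := by rw [smul_smul, inv_mul_cancel₀ hp0.ne', one_smul]
    refine ⟨p.snd • y, ⟨by rw [hn]; exact hp, by rw [hn, hs]; exact hy⟩, ?_⟩
    rw [capChart, hn, hs, hyp]
    rfl

/-- On small spherical caps the Hausdorff measure and the surface measure are nearly the same. -/
lemma hausdorff_sphereArea_cap {n : ℕ} [NeZero n] {x : Eucl n} (hx : ‖x‖ = 1) {η : ℝ} (hη : 0 < η)
    (hη1 : η < 1) {A : Set (sphere (0 : Eucl n) 1)} (hA : MeasurableSet A)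
    (hAx : ∀ y ∈ A, dist (y : Eucl n) x ≤ η) :
    sphereArea n A ≤ ENNReal.ofReal ((1 - η)⁻¹ ^ (n - 1 + n)) *
        μHE[n - 1] ((↑) '' A : Set (Eucl n)) ∧
      μHE[n - 1] ((↑) '' A : Set (Eucl n)) ≤ ENNReal.ofReal ((1 - η)⁻¹ ^ (n - 1 + n)) *
        sphereArea n A := by
  set A' : Set (Eucl n) := (↑) '' A with hA'
  set W := (ℝ ∙ x)ᗮ with hW
  set C := coneShell (1 - η) 1 A' with hC
  set M : NNReal := ⟨(1 - η)⁻¹, by rw [inv_nonneg]; linarith⟩ with hM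
  have hMcoe : (M : ℝ) = (1 - η)⁻¹ := rfl
  have hMo : (M : ℝ≥0∞) = ENNReal.ofReal ((1 - η)⁻¹) := by
    rw [← hMcoe, ENNReal.ofReal_coe_nnreal]
  have h1η : 0 < 1 - η := by linarith
  have hA1 : ∀ y ∈ A', ‖y‖ = 1 := by rintro _ ⟨y, -, rfl⟩; simp
  have hAx' : ∀ y ∈ A', ‖y - x‖ ≤ η := by
    rintro _ ⟨y, hy, rfl⟩; rw [← dist_eq_norm]; exact hAx y hy
  have hfin : Module.finrank ℝ W = n - 1 := by
    have h1 := (ℝ ∙ x).finrank_add_finrank_orthogonal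
    rw [finrank_span_singleton (by rw [← norm_ne_zero_iff, hx]; simp),
      finrank_euclideanSpace_fin] at h1
    change 1 + Module.finrank ℝ W = n at h1
    omega
  have hfinP : Module.finrank ℝ (WithLp 2 (W × ℝ)) = n := by
    rw [(WithLp.linearEquiv 2 ℝ (W × ℝ)).finrank_eq, Module.finrank_prod, hfin,
      Module.finrank_self]
    have := NeZero.pos n
    omega
  have hproj : ∀ v : Eucl n, ‖W.orthogonalProjectionOnto v‖ ≤ ‖v‖ :=
    W.norm_orthogonalProjectionOnto_apply_le
  have hanti : ∀ a ∈ A', ∀ b ∈ A', ((1 - η) * ‖a - b‖) ^ 2 ≤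
      ‖W.orthogonalProjectionOnto (a - b)‖ ^ 2 := fun a ha b hb => by
    refine le_trans ?_ (norm_sub_sq_le_norm_proj hx (hA1 a ha) (hA1 b hb) (hAx' a ha)
      (hAx' b hb))
    rw [mul_pow]
    gcongr
    nlinarith
  -- the projection
  have i1 : μHE[n - 1] (W.orthogonalProjectionOnto '' A') ≤ μHE[n - 1] A' := by
    have hl : LipschitzOnWith 1 W.orthogonalProjectionOnto A' := by
      refine (LipschitzWith.of_dist_le_mul fun u v => ?_).lipschitzOnWith
      rw [dist_eq_norm, ← map_sub, NNReal.coe_one, one_mul, dist_eq_norm]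
      exact hproj _
    simpa using euclideanHausdorffMeasure_image_le hl (n - 1)
  have i2 : μHE[n - 1] A' ≤ (M : ℝ≥0∞) ^ (n - 1) *
      μHE[n - 1] (W.orthogonalProjectionOnto '' A') := by
    refine le_euclideanHausdorffMeasure_image (fun a ha b hb => ?_) _
    rw [dist_eq_norm, dist_eq_norm, ← map_sub, hMcoe, inv_mul_eq_div, le_div_iff₀ h1η, mul_comm]
    exact (pow_le_pow_iff_left₀ (by positivity) (norm_nonneg _) two_ne_zero).1 (hanti a ha b hb)
  -- the shell
  have hvolP : volume (capChart x '' C) =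
      μHE[n - 1] (W.orthogonalProjectionOnto '' A') * ENNReal.ofReal η := by
    have hme : MeasurePreserving (MeasurableEquiv.toLp 2 (W × ℝ)).symm volume volume :=
      WithLp.volume_preserving_symm_measurableEquiv_toLp_prod W ℝ
    have : capChart x '' C = (MeasurableEquiv.toLp 2 (W × ℝ)).symm ⁻¹'
        ((W.orthogonalProjectionOnto '' A') ×ˢ Ioo (1 - η) 1) := capChart_image h1η.le hA1
    rw [this, hme.measure_preimage_equiv, Measure.volume_eq_prod, Measure.prod_prod,
      Real.volume_Ioo, ← hfin, InnerProductSpace.euclideanHausdorffMeasure_eq_volume]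
    ring_nf
  have hHP : (volume : Measure (WithLp 2 (W × ℝ))) = μHE[n] := by
    rw [← InnerProductSpace.euclideanHausdorffMeasure_eq_volume, hfinP]
  have hHV : (volume : Measure (Eucl n)) = μHE[n] :=
    (EuclideanSpace.euclideanHausdorffMeasure_eq_volume n).symm
  have hpos : ∀ y ∈ C, 1 - η ≤ ‖y‖ ∧ ‖y‖ ≤ 1 := fun y hy => ⟨hy.1.1.le, hy.1.2.le⟩
  have i3 : volume (capChart x '' C) ≤ (M : ℝ≥0∞) ^ n * volume C := by
    rw [hHP, hHV]
    refine euclideanHausdorffMeasure_image_le (LipschitzOnWith.of_dist_le_mul fun y hy z hz => ?_) n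
    rw [hMcoe, inv_mul_eq_div, le_div_iff₀ h1η, mul_comm]
    refine (pow_le_pow_iff_left₀ (by positivity) dist_nonneg two_ne_zero).1 ?_
    obtain ⟨h1, h2, h3⟩ := coneShell_sub_sq h1η.le hy hz
    rw [mul_pow, dist_capChart_sq, h3]
    have h4 := pow_le_pow_left₀ (norm_nonneg _) (hproj (‖y‖⁻¹ • y - ‖z‖⁻¹ • z)) 2
    have h5 : (1 - η) ^ 2 ≤ ‖y‖ * ‖z‖ := by
      rw [sq]; exact mul_le_mul (hpos y hy).1 (hpos z hz).1 h1η.le (norm_nonneg _)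
    have h6 : (1 - η) ^ 2 ≤ 1 := by nlinarith
    calc _ ≤ (1 - η) ^ 2 * ‖‖y‖⁻¹ • y - ‖z‖⁻¹ • z‖ ^ 2 + (1 - η) ^ 2 * (‖y‖ - ‖z‖) ^ 2 := by
          rw [mul_add]; gcongr
      _ ≤ ‖y‖ * ‖z‖ * ‖‖y‖⁻¹ • y - ‖z‖⁻¹ • z‖ ^ 2 + 1 * (‖y‖ - ‖z‖) ^ 2 := by gcongr
      _ = _ := by ring
  have i4 : volume C ≤ (M : ℝ≥0∞) ^ n * volume (capChart x '' C) := by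
    rw [hHP, hHV]
    refine le_euclideanHausdorffMeasure_image (fun y hy z hz => ?_) n
    rw [hMcoe, inv_mul_eq_div, le_div_iff₀ h1η, mul_comm]
    refine (pow_le_pow_iff_left₀ (by positivity) dist_nonneg two_ne_zero).1 ?_
    obtain ⟨h1, h2, h3⟩ := coneShell_sub_sq h1η.le hy hz
    rw [mul_pow, dist_capChart_sq, h3]
    have h4 := hanti _ hy.2 _ hz.2
    rw [mul_pow] at h4
    have h5 : ‖y‖ * ‖z‖ ≤ 1 := mul_le_one₀ (hpos y hy).2 (norm_nonneg _) (hpos z hz).2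
    have h6 : (1 - η) ^ 2 ≤ 1 := by nlinarith
    calc (1 - η) ^ 2 * ((‖y‖ - ‖z‖) ^ 2 + ‖y‖ * ‖z‖ * ‖‖y‖⁻¹ • y - ‖z‖⁻¹ • z‖ ^ 2)
        ≤ 1 * (‖y‖ - ‖z‖) ^ 2 + (1 - η) ^ 2 * (1 * ‖‖y‖⁻¹ • y - ‖z‖⁻¹ • z‖ ^ 2) := by
          rw [mul_add]; gcongr
      _ ≤ _ := by linarith
  have hvolC := volume_coneShell (n := n) (a := 1 - η) (b := 1) h1η.le hA
  rw [← hA', ← hC] at hvolC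
  have hη0 : ENNReal.ofReal η ≠ 0 := by simpa using hη
  have hηt : ENNReal.ofReal η ≠ ⊤ := ENNReal.ofReal_ne_top
  have hMinv : (M : ℝ≥0∞) ^ (n - 1) * ENNReal.ofReal ((1 - η) ^ (n - 1)) = 1 := by
    rw [hMo, ← ENNReal.ofReal_pow (by positivity), ← ENNReal.ofReal_mul (by positivity), ← mul_pow,
      inv_mul_cancel₀ h1η.ne', one_pow, ENNReal.ofReal_one]
  rw [ENNReal.ofReal_pow (by positivity), ← hMo, pow_add]
  constructor
  -- Both inequalities are proved after multiplication by the thickness `η`, passing between cap,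
  -- shell, cylinder and projected base. The chart costs `M ^ n`; the other factor `M ^ (n - 1)`
  -- pays for the radial weight here, and for inverting the projection in the second inequality.
  · rw [← ENNReal.mul_le_mul_iff_left hη0 hηt]
    calc sphereArea n A * ENNReal.ofReal η
        = (M : ℝ≥0∞) ^ (n - 1) * ((ENNReal.ofReal ((1 - η) ^ (n - 1)) * ENNReal.ofReal η) *
            sphereArea n A) := by
          have : ∀ a b c d : ℝ≥0∞, a * (b * c * d) = a * b * (d * c) := fun a b c d => by ring
          rw [this, hMinv, one_mul]
      _ ≤ (M : ℝ≥0∞) ^ (n - 1) * volume C := by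
          rw [hvolC]; gcongr; exact le_setLIntegral_pow hη1 _
      _ ≤ (M : ℝ≥0∞) ^ (n - 1) * ((M : ℝ≥0∞) ^ n * (μHE[n - 1] A' * ENNReal.ofReal η)) := by
          gcongr
          refine i4.trans ?_
          rw [hvolP]; gcongr
      _ = _ := by ring
  · rw [← ENNReal.mul_le_mul_iff_left hη0 hηt]
    calc μHE[n - 1] A' * ENNReal.ofReal η
        ≤ (M : ℝ≥0∞) ^ (n - 1) * volume (capChart x '' C) := by
          rw [hvolP, ← mul_assoc]; gcongr
      _ ≤ (M : ℝ≥0∞) ^ (n - 1) * ((M : ℝ≥0∞) ^ n * volume C) := by gcongr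
      _ ≤ (M : ℝ≥0∞) ^ (n - 1) * ((M : ℝ≥0∞) ^ n * (ENNReal.ofReal η * sphereArea n A)) := by
          rw [hvolC]; gcongr; exact setLIntegral_pow_le hη1 _
      _ = _ := by ring

/-- Balls of radius `η` about a dense sequence cover the space; made disjoint, they cut every
measurable set into countably many small pieces. -/
lemma measure_le_of_small {X : Type*} [PseudoMetricSpace X] [SecondCountableTopology X]
    [MeasurableSpace X] [BorelSpace X] {μ ν : Measure X} {η : ℝ} (hη : 0 < η)
    (h : ∀ (x : X) (A : Set X), MeasurableSet A → A ⊆ ball x η → μ A ≤ ν A) : μ ≤ ν := by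
  rcases isEmpty_or_nonempty X with hX | hX
  · simp [Measure.eq_zero_of_isEmpty]
  set B : ℕ → Set X := fun k => ball (TopologicalSpace.denseSeq X k) η
  have hB : ⋃ k, disjointed B k = univ := by
    rw [iUnion_disjointed]
    refine eq_univ_of_forall fun x => ?_
    obtain ⟨k, hk⟩ := (TopologicalSpace.denseRange_denseSeq X).exists_dist_lt x hη
    exact mem_iUnion.2 ⟨k, hk⟩
  have hm : ∀ k, MeasurableSet (disjointed B k) :=
    MeasurableSet.disjointed fun k => measurableSet_ball
  refine Measure.le_iff.2 fun A hA => ?_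
  have hsum : ∀ ξ : Measure X, ξ A = ∑' k, ξ (A ∩ disjointed B k) := fun ξ => by
    rw [← measure_iUnion (fun i j hij => ((disjoint_disjointed B) hij).mono inter_subset_right
      inter_subset_right) fun k => hA.inter (hm k), ← inter_iUnion, hB, inter_univ]
  rw [hsum μ, hsum ν]
  exact ENNReal.tsum_le_tsum fun k => h (TopologicalSpace.denseSeq X k) _ (hA.inter (hm k))
    (inter_subset_right.trans (disjointed_subset B k))

/-- The cap estimate, globalized by `measure_le_of_small`, bounds each measure by `(1 -
η)^(-(2n-1))` times the other. The factor tends to `1` as `η → 0`. -/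
theorem comap_euclideanHausdorffMeasure_unitSphere (n : ℕ) [NeZero n] :
    (μHE[n - 1] : Measure (Eucl n)).comap (Subtype.val : sphere (0 : Eucl n) 1 → Eucl n) =
      sphereArea n := by
  set ν := (μHE[n - 1] : Measure (Eucl n)).comap (Subtype.val : sphere (0 : Eucl n) 1 → Eucl n)
  have hν : ∀ A : Set (sphere (0 : Eucl n) 1), ν A = μHE[n - 1] ((↑) '' A : Set (Eucl n)) :=
    fun A => comap_subtype_coe_apply isClosed_sphere.measurableSet _ A
  have key : ∀ η : ℝ, 0 < η → η < 1 →
      sphereArea n ≤ ENNReal.ofReal ((1 - η)⁻¹ ^ (n - 1 + n)) • ν ∧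
      ν ≤ ENNReal.ofReal ((1 - η)⁻¹ ^ (n - 1 + n)) • sphereArea n := fun η hη hη1 => by
    have h : ∀ (x : sphere (0 : Eucl n) 1) (A : Set (sphere (0 : Eucl n) 1)), MeasurableSet A →
        A ⊆ ball x η → _ := fun x A hA hAx =>
      hausdorff_sphereArea_cap (x := (x : Eucl n)) (by simp) hη hη1 hA fun y hy => (hAx hy).le
    exact ⟨measure_le_of_small hη fun x A hA hAx => by
        simpa [hν] using (h x A hA hAx).1,
      measure_le_of_small hη fun x A hA hAx => by simpa [hν] using (h x A hA hAx).2⟩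
  have hlim : Tendsto (fun η : ℝ => ENNReal.ofReal ((1 - η)⁻¹ ^ (n - 1 + n))) (𝓝[>] 0) (𝓝 1) := by
    have : ContinuousAt (fun η : ℝ => ENNReal.ofReal ((1 - η)⁻¹ ^ (n - 1 + n))) 0 := by
      refine ENNReal.continuous_ofReal.continuousAt.comp ?_
      exact ((continuousAt_const.sub continuousAt_id).inv₀ (by simp)).pow _
    simpa using this.tendsto.mono_left nhdsWithin_le_nhds
  have hev : ∀ᶠ η : ℝ in 𝓝[>] 0, 0 < η ∧ η < 1 := Ioo_mem_nhdsGT one_pos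
  have hmul : ∀ (ξ : Measure (sphere (0 : Eucl n) 1)) (A : Set _),
      Tendsto (fun η : ℝ => ENNReal.ofReal ((1 - η)⁻¹ ^ (n - 1 + n)) * ξ A) (𝓝[>] 0)
        (𝓝 (ξ A)) := fun ξ A => by
    simpa using ENNReal.Tendsto.mul_const hlim (b := ξ A) (Or.inl one_ne_zero)
  refine le_antisymm (Measure.le_iff.2 fun A _ => ?_) (Measure.le_iff.2 fun A _ => ?_)
  · exact ge_of_tendsto (hmul _ A) (hev.mono fun η hη => (key η hη.1 hη.2).2 A)
  · exact ge_of_tendsto (hmul _ A) (hev.mono fun η hη => (key η hη.1 hη.2).1 A)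

theorem euclideanHausdorffMeasure_restrict_sphere (n : ℕ) [NeZero n] {ρ : ℝ} (hρ : 0 < ρ) :
    (μHE[n - 1] : Measure (Eucl n)).restrict (sphere 0 ρ) = sphereSurface n ρ := by
  have hmeas : Measurable fun θ : sphere (0 : Eucl n) 1 => ρ • (θ : Eucl n) := by fun_prop
  ext A hA
  rw [Measure.restrict_apply hA, sphereSurface, Measure.smul_apply, Measure.map_apply hmeas hA,
    ← comap_euclideanHausdorffMeasure_unitSphere,
    comap_subtype_coe_apply isClosed_sphere.measurableSet, smul_eq_mul]
  have : A ∩ sphere 0 ρ = ρ • ((↑) '' ((fun θ : sphere (0 : Eucl n) 1 => ρ • (θ : Eucl n)) ⁻¹' A) :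
      Set (Eucl n)) := by
    ext y
    simp only [mem_inter_iff, mem_sphere_iff_norm, sub_zero, mem_smul_set, mem_image, mem_preimage,
      Subtype.exists, exists_and_right, exists_eq_right, exists_prop]
    constructor
    · rintro ⟨hy, hyρ⟩
      have : ρ • ρ⁻¹ • y = y := by rw [smul_smul, mul_inv_cancel₀ hρ.ne', one_smul]
      refine ⟨ρ⁻¹ • y, ⟨?_, by rwa [this]⟩, this⟩
      rw [norm_smul, norm_inv, Real.norm_eq_abs, abs_of_pos hρ, hyρ, inv_mul_cancel₀ hρ.ne']
    · rintro ⟨z, ⟨hz, hzA⟩, rfl⟩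
      exact ⟨hzA, by rw [norm_smul, hz, Real.norm_eq_abs, abs_of_pos hρ, mul_one]⟩
  rw [this, Measure.euclideanHausdorffMeasure_smul₀ _ hρ.ne', ENNReal.smul_def, smul_eq_mul,
    ENNReal.ofReal_pow hρ.le, ENNReal.coe_pow]
  congr 2
  exact Real.enorm_eq_ofReal hρ.le

/-! ### Radial Lipschitz functions -/

lemma intervalIntegrable_of_bounded {q : ℝ → ℝ} (hq : Measurable q) {M : ℝ} (hM : ∀ r, |q r| ≤ M)
    (a b : ℝ) : IntervalIntegrable q volume a b :=
  (intervalIntegrable_const (c := M)).mono_fun hq.aestronglyMeasurable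
    (.of_forall fun r => by simpa using (hM r).trans (le_abs_self M))

/-- The radial function with radial derivative `-q` which vanishes on the sphere of radius `b`. -/
noncomputable def radialPrimitive {n : ℕ} (q : ℝ → ℝ) (b : ℝ) (x : Eucl n) : ℝ :=
  ∫ τ in ‖x‖..b, q τ

lemma lipschitzWith_radialPrimitive {n : ℕ} {q : ℝ → ℝ} (hq : Measurable q) {M : NNReal}
    (hM : ∀ r, |q r| ≤ M) (b : ℝ) : LipschitzWith M (radialPrimitive (n := n) q b) := by
  refine LipschitzWith.of_dist_le_mul fun x y => ?_
  rw [dist_eq_norm, radialPrimitive, radialPrimitive,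
    ← intervalIntegral.integral_add_adjacent_intervals
      (intervalIntegrable_of_bounded hq hM ‖x‖ ‖y‖) (intervalIntegrable_of_bounded hq hM ‖y‖ b),
    add_sub_cancel_right]
  refine (intervalIntegral.norm_integral_le_of_norm_le_const fun r _ => hM r).trans ?_
  gcongr
  rw [dist_comm, dist_eq_norm]
  exact abs_norm_sub_norm_le y x

lemma hasFDerivAt_radialPrimitive {n : ℕ} {q : ℝ → ℝ} (hq : Measurable q) {M : ℝ}
    (hM : ∀ r, |q r| ≤ M) (b : ℝ) {x : Eucl n} (hx : x ≠ 0) (hc : ContinuousAt q ‖x‖) :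
    HasFDerivAt (radialPrimitive q b) (-(q ‖x‖ * ‖x‖⁻¹) • innerSL ℝ x) x := by
  have h1 : HasDerivAt (fun r => ∫ τ in r..b, q τ) (-q ‖x‖) ‖x‖ :=
    intervalIntegral.integral_hasDerivAt_left (intervalIntegrable_of_bounded hq hM _ _)
      (hq.stronglyMeasurable.stronglyMeasurableAtFilter) hc
  have h2 : HasFDerivAt (fun y : Eucl n => ‖y‖) (‖x‖⁻¹ • innerSL ℝ x) x := by
    have h3 := ((hasStrictFDerivAt_norm_sq x).hasFDerivAt.sqrt (by simpa using hx))
    simp only [Real.sqrt_sq (norm_nonneg _)] at h3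
    convert! h3 using 1
    ext v
    simp
    field_simp
  convert! h1.comp_hasFDerivAt x h2 using 1
  rw [smul_smul, neg_mul]

lemma ae_norm_notMem {n : ℕ} [NeZero n] {S : Set ℝ} (hS : S.Countable) :
    ∀ᵐ x : Eucl n, x ≠ 0 ∧ ‖x‖ ∉ S := by
  have h1 : ∀ r : ℝ, ∀ᵐ x : Eucl n, ‖x‖ ≠ r := fun r => by
    have := Measure.addHaar_sphere (volume : Measure (Eucl n)) 0 r
    rw [measure_eq_zero_iff_ae_notMem] at this
    simpa using this
  have h2 : ∀ᵐ x : Eucl n, ∀ r ∈ S, ‖x‖ ≠ r := (ae_ball_iff hS).2 fun r _ => h1 r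
  filter_upwards [h1 0, h2] with x hx hx'
  exact ⟨by simpa using hx, fun h => hx' _ h rfl⟩

/-- Integration by parts holds for Lipschitz functions, and the derivative is the expected one off
the origin and countably many spheres, which form a null set. Slopes with jumps are thus allowed;
they occur both in the cutoff of the ball and in the competitor. -/
theorem integral_radialPrimitive_mul_fderiv {n : ℕ} [NeZero n] {q : ℝ → ℝ} (hq : Measurable q)
    {M : NNReal} (hM : ∀ r, |q r| ≤ M) {S : Set ℝ} (hS : S.Countable)
    (hc : ∀ r ∉ S, ContinuousAt q r) (b : ℝ) {ψ : Eucl n → ℝ} (hψ : ContDiff ℝ 1 ψ)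
    (hψc : HasCompactSupport ψ) (v : Eucl n) :
    ∫ x, radialPrimitive q b x * fderiv ℝ ψ x v =
      ∫ x, q ‖x‖ * (‖x‖⁻¹ * inner ℝ x v) * ψ x := by
  obtain ⟨D, hD⟩ := hψ.lipschitzWith_of_hasCompactSupport hψc (by simp)
  have h := (lipschitzWith_radialPrimitive (n := n) hq hM b).integral_lineDeriv_mul_eq
    (μ := volume) hD hψc v
  have h1 : ∀ x, lineDeriv ℝ ψ x (-v) * radialPrimitive q b x =
      -(radialPrimitive q b x * fderiv ℝ ψ x v) := fun x => by
    rw [((hψ.differentiable (by simp)) x).lineDeriv_eq_fderiv, map_neg]; ring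
  have h2 : (fun x => lineDeriv ℝ (radialPrimitive q b) x v * ψ x) =ᵐ[volume]
      fun x => -(q ‖x‖ * (‖x‖⁻¹ * inner ℝ x v) * ψ x) := by
    filter_upwards [ae_norm_notMem (n := n) hS] with x hx
    rw [((hasFDerivAt_radialPrimitive hq hM b hx.1 (hc _ hx.2)).hasLineDerivAt v).lineDeriv]
    simp only [smul_apply, innerSL_apply_apply, smul_eq_mul]
    ring
  rw [integral_congr_ae h2, integral_neg] at h
  simp_rw [h1, integral_neg] at h
  exact (neg_injective h).symm

/-! ### The reduced boundary of a ball -/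

lemma continuous_sphere_integral {n : ℕ} {T : Eucl n → Eucl n} (hT : Continuous T)
    (hTc : HasCompactSupport T) :
    Continuous fun r : ℝ => r ^ (n - 1) *
      ∫ θ : sphere (0 : Eucl n) 1, inner ℝ (θ : Eucl n) (T (r • (θ : Eucl n))) ∂sphereArea n := by
  obtain ⟨C, hC⟩ := hT.bounded_above_of_compact_support hTc
  refine (continuous_pow _).mul (continuous_of_dominated (bound := fun _ => C) ?_ ?_ ?_ ?_)
  · exact fun r => Continuous.aestronglyMeasurable (by fun_prop)
  · refine fun r => .of_forall fun θ => (norm_inner_le_norm _ _).trans ?_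
    rw [show ‖(θ : Eucl n)‖ = 1 by simp, one_mul]
    exact hC _
  · exact integrable_const _
  · exact .of_forall fun θ => by fun_prop

lemma divergence_eq_sum {n : ℕ} {T : Eucl n → Eucl n} (hT : ContDiff ℝ 1 T) (x : Eucl n) :
    divergence T x = ∑ i : Fin n,
      fderiv ℝ (fun y => T y i) x (EuclideanSpace.single i 1) := by
  refine Finset.sum_congr rfl fun i _ => ?_
  have h := ((hT.differentiable (by simp)) x).hasFDerivAt
  have h2 := ((EuclideanSpace.proj (𝕜 := ℝ) i).hasFDerivAt (x := T x)).comp x h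
  rw [show (fun y => T y i) = (EuclideanSpace.proj (𝕜 := ℝ) i) ∘ T from rfl, h2.fderiv]
  rfl

lemma tendsto_average_left {h : ℝ → ℝ} (hh : Continuous h) (ρ : ℝ) :
    Tendsto (fun ε : ℝ => ∫ r in (ρ - ε)..ρ, ε⁻¹ * h r) (𝓝[>] 0) (𝓝 (h ρ)) := by
  have h1 : HasDerivAt (fun u => ∫ r in ρ..u, h r) (h ρ) ρ :=
    intervalIntegral.integral_hasDerivAt_right (hh.intervalIntegrable _ _)
      (hh.stronglyMeasurableAtFilter _ _) hh.continuousAt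
  have h2 := h1.tendsto_slope_zero_left
  have h3 : Tendsto (fun ε : ℝ => -ε) (𝓝[>] 0) (𝓝[<] 0) := by
    have := tendsto_neg_nhdsGT (a := (0 : ℝ))
    simpa using this
  refine (h2.comp h3).congr fun ε => ?_
  simp only [Function.comp_apply, intervalIntegral.integral_same, sub_zero, smul_eq_mul,
    intervalIntegral.integral_const_mul]
  rw [intervalIntegral.integral_symm, ← sub_eq_add_neg, inv_neg]
  ring

lemma continuousAt_indicator_Ioc {a b r : ℝ} {f : ℝ → ℝ} (hf : r ∈ Ioo a b → ContinuousAt f r)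
    (ha : r ≠ a) (hb : r ≠ b) : ContinuousAt (indicator (Ioc a b) f) r := by
  by_cases hr : r ∈ Ioo a b
  · refine (hf hr).congr ?_
    filter_upwards [isOpen_Ioo.mem_nhds hr] with s hs
    rw [indicator_of_mem (Ioo_subset_Ioc_self hs)]
  · have : r ∈ (Icc a b)ᶜ := fun h => hr ⟨lt_of_le_of_ne h.1 ha.symm, lt_of_le_of_ne h.2 hb⟩
    refine (continuousAt_const (y := (0 : ℝ))).congr ?_
    filter_upwards [isClosed_Icc.isOpen_compl.mem_nhds this] with s hs
    rw [indicator_of_notMem fun h => hs (Ioc_subset_Icc_self h)]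

/-- The slope of the cutoff of the ball of radius `ρ`. -/
noncomputable def cutoffSlope (ρ ε : ℝ) : ℝ → ℝ := indicator (Ioc (ρ - ε) ρ) fun _ => ε⁻¹

lemma measurable_cutoffSlope (ρ ε : ℝ) : Measurable (cutoffSlope ρ ε) :=
  measurable_const.indicator measurableSet_Ioc

lemma abs_cutoffSlope_le {ρ ε : ℝ} (hε : 0 < ε) (r : ℝ) :
    |cutoffSlope ρ ε r| ≤ (⟨ε⁻¹, by positivity⟩ : NNReal) := by
  rw [← Real.norm_eq_abs, cutoffSlope]
  refine (norm_indicator_le_norm_self _ _).trans ?_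
  simp [abs_of_pos hε]

lemma continuousAt_cutoffSlope {ρ ε r : ℝ} (hr : r ∉ ({ρ - ε, ρ} : Set ℝ)) :
    ContinuousAt (cutoffSlope ρ ε) r := by
  simp only [mem_insert_iff, mem_singleton_iff, not_or] at hr
  exact continuousAt_indicator_Ioc (fun _ => continuousAt_const) hr.1 hr.2

lemma radialPrimitive_cutoffSlope_mem {n : ℕ} {ρ ε : ℝ} (hε : 0 < ε) (x : Eucl n) :
    radialPrimitive (cutoffSlope ρ ε) ρ x ∈ Icc 0 1 ∧
    (‖x‖ ≤ ρ - ε → radialPrimitive (cutoffSlope ρ ε) ρ x = 1) ∧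
    (ρ ≤ ‖x‖ → radialPrimitive (cutoffSlope ρ ε) ρ x = 0) := by
  have h0 : ρ ≤ ‖x‖ → radialPrimitive (cutoffSlope ρ ε) ρ x = 0 := fun h => by
    rw [radialPrimitive, intervalIntegral.integral_of_ge h, neg_eq_zero]
    refine setIntegral_eq_zero_of_forall_eq_zero fun r hr => indicator_of_notMem ?_ _
    exact fun h' => absurd h'.2 (not_le.2 hr.1)
  have h1 : ‖x‖ ≤ ρ → radialPrimitive (cutoffSlope ρ ε) ρ x = min ε (ρ - ‖x‖) * ε⁻¹ := fun h => by
    rw [radialPrimitive, intervalIntegral.integral_of_le h, cutoffSlope,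
      setIntegral_indicator measurableSet_Ioc, setIntegral_const, Ioc_inter_Ioc, min_self,
      Real.volume_real_Ioc_of_le (by simp [h, hε.le]), smul_eq_mul]
    congr 1
    rcases le_total ‖x‖ (ρ - ε) with h' | h'
    · rw [max_eq_right h', min_eq_left (by linarith)]; ring
    · rw [max_eq_left h', min_eq_right (by linarith)]
  refine ⟨?_, fun h => ?_, h0⟩
  · rcases le_total ‖x‖ ρ with h | h
    · rw [h1 h]
      have : 0 ≤ min ε (ρ - ‖x‖) := le_min hε.le (by linarith)
      refine ⟨by positivity, ?_⟩
      rw [← div_eq_mul_inv]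
      exact div_le_one_of_le₀ (min_le_left _ _) hε.le
    · rw [h0 h]; simp
  · rw [h1 (by linarith), min_eq_left (by linarith), mul_inv_cancel₀ hε.ne']

/-- The indicator of the ball is approximated by the radial cutoff falling from `1` to `0` between
the radii `ρ - ε` and `ρ`. Integration by parts turns the divergence integral into the mean over
these radii of the flux `h r`, which is continuous in `r`, so the mean tends to `h ρ`; the
divergence side converges by dominated convergence. -/
theorem isGaussGreen_ball (n : ℕ) [NeZero n] {ρ : ℝ} (hρ : 0 < ρ) :
    IsGaussGreen (ball (0 : Eucl n) ρ) (sphereSurface n ρ) fun x => ‖x‖⁻¹ • x where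
  locallyFinite := inferInstance
  measurable_normal := measurable_norm.inv.smul measurable_id
  norm_normal := by
    refine Measure.ae_smul_measure ?_ _
    have hm : Measurable fun θ : sphere (0 : Eucl n) 1 => ρ • (θ : Eucl n) := by fun_prop
    rw [ae_map_iff hm.aemeasurable (measurableSet_eq_fun (by fun_prop) (by fun_prop))]
    refine .of_forall fun θ => ?_
    simp [norm_smul, abs_of_pos hρ, hρ.ne']
  gauss_green := fun T hT hTc => by
    have hTi : ∀ i, ContDiff ℝ 1 fun y => T y i := fun i =>
      (EuclideanSpace.proj (𝕜 := ℝ) i).contDiff.comp hT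
    have hTci : ∀ i, HasCompactSupport fun y => T y i := fun i =>
      hTc.comp_left (g := fun z : Eucl n => z i) rfl
    have hdiv : ∀ x, divergence T x = _ := divergence_eq_sum hT
    have hdc : ∀ i : Fin n, Continuous fun x =>
        fderiv ℝ (fun y => T y i) x (EuclideanSpace.single i 1) := fun i =>
      ((hTi i).continuous_fderiv (by simp)).clm_apply continuous_const
    have hds : ∀ i : Fin n, HasCompactSupport fun x =>
        fderiv ℝ (fun y => T y i) x (EuclideanSpace.single i 1) := fun i =>
      (hTci i).fderiv_apply ℝ _
    have hdi := fun i => (hdc i).integrable_of_hasCompactSupport (μ := volume) (hds i)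
    have hint : Integrable (divergence T) := by
      rw [show divergence T = _ from funext hdiv]
      exact integrable_finsetSum _ fun i _ => hdi i
    set h : ℝ → ℝ := fun r => r ^ (n - 1) *
      ∫ θ : sphere (0 : Eucl n) 1, inner ℝ (θ : Eucl n) (T (r • (θ : Eucl n))) ∂sphereArea n with hh
    have hcont : Continuous h := continuous_sphere_integral hT.continuous hTc
    have hright : ∫ x, inner ℝ (T x) (‖x‖⁻¹ • x) ∂sphereSurface n ρ = h ρ := by
      rw [sphereSurface, integral_smul_measure, ENNReal.toReal_ofReal (by positivity), smul_eq_mul,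
        integral_map (by fun_prop)]
      · congr 1
        refine integral_congr_ae (.of_forall fun θ => ?_)
        simp [norm_smul, abs_of_pos hρ, hρ.ne', smul_smul, real_inner_comm]
      · exact (Measurable.inner hT.continuous.measurable
          (measurable_norm.inv.smul measurable_id)).aestronglyMeasurable
    have key : ∀ ε : ℝ, 0 < ε → ε < ρ →
        ∫ x, radialPrimitive (cutoffSlope ρ ε) ρ x * divergence T x =
          ∫ r in (ρ - ε)..ρ, ε⁻¹ * h r := fun ε hε hερ => by
      have hφc := (lipschitzWith_radialPrimitive (n := n) (measurable_cutoffSlope ρ ε)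
        (abs_cutoffSlope_le hε) ρ).continuous
      have hqb : ∀ x : Eucl n, ‖cutoffSlope ρ ε ‖x‖‖ ≤ ε⁻¹ := fun x => abs_cutoffSlope_le hε ‖x‖
      have hqi : ∀ i : Fin n, Integrable fun x : Eucl n => cutoffSlope ρ ε ‖x‖ *
          (‖x‖⁻¹ * inner ℝ x (EuclideanSpace.single i 1)) * T x i := fun i => by
        refine (((hTi i).continuous.integrable_of_hasCompactSupport (hTci i))).bdd_mul (c := ε⁻¹)
          ?_ (.of_forall fun x => ?_)
        · exact (((measurable_cutoffSlope ρ ε).comp measurable_norm).mul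
            (measurable_norm.inv.mul (by fun_prop))).aestronglyMeasurable
        · rw [norm_mul]
          refine (mul_le_mul (hqb x) (d := 1) ?_ (norm_nonneg _) (by positivity)).trans
            (mul_one _).le
          rw [norm_mul, norm_inv, norm_norm]
          refine (mul_le_mul_of_nonneg_left (norm_inner_le_norm _ _) (by positivity)).trans ?_
          rw [PiLp.norm_single, norm_one, mul_one]
          exact inv_mul_le_one
      have hsum : ∀ x : Eucl n, ∑ i, cutoffSlope ρ ε ‖x‖ *
          (‖x‖⁻¹ * inner ℝ x (EuclideanSpace.single i 1)) * T x i =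
          cutoffSlope ρ ε ‖x‖ * inner ℝ (‖x‖⁻¹ • x) (T x) := fun x => by
        simp only [inner_smul_left, PiLp.inner_apply,
          Finset.mul_sum]
        refine Finset.sum_congr rfl fun i _ => ?_
        simp
        ring
      have hint2 : Integrable fun x : Eucl n =>
          cutoffSlope ρ ε ‖x‖ * inner ℝ (‖x‖⁻¹ • x) (T x) := by
        simp_rw [← hsum]
        exact integrable_finsetSum _ fun i _ => hqi i
      calc ∫ x, radialPrimitive (cutoffSlope ρ ε) ρ x * divergence T x
          = ∑ i : Fin n, ∫ x, radialPrimitive (cutoffSlope ρ ε) ρ x *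
              fderiv ℝ (fun y => T y i) x (EuclideanSpace.single i 1) := by
            rw [← integral_finsetSum]
            · simp_rw [hdiv, Finset.mul_sum]
            · exact fun i _ => (hφc.mul (hdc i)).integrable_of_hasCompactSupport (hds i).mul_left
        _ = ∑ i : Fin n, ∫ x, cutoffSlope ρ ε ‖x‖ *
              (‖x‖⁻¹ * inner ℝ x (EuclideanSpace.single i 1)) * T x i := by
            refine Finset.sum_congr rfl fun i _ => ?_
            exact integral_radialPrimitive_mul_fderiv (measurable_cutoffSlope ρ ε)
              (abs_cutoffSlope_le hε) (S := {ρ - ε, ρ}) (by simp)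
              (fun r hr => continuousAt_cutoffSlope hr) ρ (hTi i) (hTci i) _
        _ = ∫ x, cutoffSlope ρ ε ‖x‖ * inner ℝ (‖x‖⁻¹ • x) (T x) := by
            rw [← integral_finsetSum _ fun i _ => hqi i]
            simp_rw [hsum]
        _ = ∫ r in Ioi (0 : ℝ), indicator (Ioc (ρ - ε) ρ) (fun r => ε⁻¹ * h r) r := by
            rw [integral_polar_symm hint2]
            refine setIntegral_congr_fun measurableSet_Ioi fun r hr => ?_
            have hr0 : 0 < r := hr
            have : ∀ θ : sphere (0 : Eucl n) 1, cutoffSlope ρ ε ‖r • (θ : Eucl n)‖ *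
                inner ℝ (‖r • (θ : Eucl n)‖⁻¹ • r • (θ : Eucl n)) (T (r • (θ : Eucl n))) =
                cutoffSlope ρ ε r * inner ℝ (θ : Eucl n) (T (r • (θ : Eucl n))) := fun θ => by
              simp [norm_smul, abs_of_pos hr0, smul_smul, hr0.ne']
            simp_rw [this, integral_const_mul, cutoffSlope, indicator, hh]
            split_ifs
            · ring
            · simp
        _ = _ := by
            rw [setIntegral_indicator measurableSet_Ioc, intervalIntegral.integral_of_le
              (by linarith), inter_eq_self_of_subset_right fun r hr => mem_Ioi.2
              (by linarith [hr.1])]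
    have hev : ∀ᶠ ε : ℝ in 𝓝[>] 0, 0 < ε ∧ ε < ρ := Ioo_mem_nhdsGT hρ
    have hlim1 : Tendsto (fun ε : ℝ => ∫ x, radialPrimitive (cutoffSlope ρ ε) ρ x * divergence T x)
        (𝓝[>] 0) (𝓝 (h ρ)) :=
      (tendsto_average_left hcont ρ).congr' (hev.mono fun ε hε => (key ε hε.1 hε.2).symm)
    have hlim2 : Tendsto (fun ε : ℝ => ∫ x, radialPrimitive (cutoffSlope ρ ε) ρ x * divergence T x)
        (𝓝[>] 0) (𝓝 (∫ x, indicator (ball (0 : Eucl n) ρ) (divergence T) x)) := by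
      refine tendsto_integral_filter_of_dominated_convergence (fun x => ‖divergence T x‖) ?_ ?_
        hint.norm ?_
      · filter_upwards [hev] with ε hε
        exact (lipschitzWith_radialPrimitive (n := n) (measurable_cutoffSlope ρ ε)
          (abs_cutoffSlope_le hε.1) ρ).continuous.aestronglyMeasurable.mul hint.1
      · filter_upwards [hev] with ε hε
        refine .of_forall fun x => ?_
        have := (radialPrimitive_cutoffSlope_mem (ρ := ρ) hε.1 x).1
        rw [norm_mul, Real.norm_eq_abs, abs_of_nonneg this.1]
        exact mul_le_of_le_one_left (norm_nonneg _) this.2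
      · refine .of_forall fun x => ?_
        by_cases hx : ‖x‖ < ρ
        · rw [indicator_of_mem (by simpa using hx)]
          refine tendsto_const_nhds.congr' ?_
          have : ∀ᶠ ε : ℝ in 𝓝[>] 0, 0 < ε ∧ ε < ρ - ‖x‖ := Ioo_mem_nhdsGT (by linarith)
          filter_upwards [this] with ε hε
          rw [(radialPrimitive_cutoffSlope_mem hε.1 x).2.1 (by linarith [hε.2]), one_mul]
        · rw [indicator_of_notMem (by simpa using hx)]
          refine tendsto_const_nhds.congr' ?_
          filter_upwards [hev] with ε hε
          rw [(radialPrimitive_cutoffSlope_mem hε.1 x).2.2 (not_lt.1 hx), zero_mul]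
    rw [hright, ← integral_indicator measurableSet_ball]
    exact tendsto_nhds_unique hlim2 hlim1

/-- Testing with the fields `g • v` forces `ν = 0` almost everywhere in `U`, while `‖ν‖ = 1` almost
everywhere. The argument applies to any pair `(μ, ν)`, so the existential in `reducedBoundary` can
be handled without uniqueness of the perimeter measure. -/
lemma IsGaussGreen.measure_eq_zero {n : ℕ} {E : Set (Eucl n)} {μ : Measure (Eucl n)}
    {ν : Eucl n → Eucl n} (h : IsGaussGreen E μ ν) {U : Set (Eucl n)} (hU : IsOpen U)
    (hE : ∀ T : Eucl n → Eucl n, ContDiff ℝ 1 T → HasCompactSupport T → tsupport T ⊆ U →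
      ∫ x in E, divergence T x = 0) : μ U = 0 := by
  have := h.locallyFinite
  have hloc : LocallyIntegrable ν μ := by
    refine (locallyIntegrable_const (1 : ℝ)).mono h.measurable_normal.aestronglyMeasurable ?_
    filter_upwards [h.norm_normal] with x hx
    simp [hx]
  have hzero : ∀ᵐ x ∂μ, x ∈ U → ν x = 0 := by
    refine hU.ae_eq_zero_of_integral_contDiff_smul_eq_zero (hloc.locallyIntegrableOn U)
      fun g hg hgc hgU => ?_
    have hgi : Integrable (fun x => g x • ν x) μ :=
      hloc.integrable_smul_left_of_hasCompactSupport hg.continuous hgc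
    refine ext_inner_left ℝ fun v => ?_
    rw [inner_zero_right, ← integral_inner hgi v]
    have hTs : ContDiff ℝ 1 fun x => g x • v :=
      (hg.of_le (by exact_mod_cast le_top)).smul contDiff_const
    have hTc : HasCompactSupport fun x => g x • v := hgc.smul_right
    have hT := h.gauss_green _ hTs hTc
    rw [hE _ hTs hTc ((tsupport_smul_subset_left g _).trans hgU)] at hT
    simpa [inner_smul_left, inner_smul_right] using hT.symm
  rw [measure_eq_zero_iff_ae_notMem]
  filter_upwards [hzero, h.norm_normal] with x hx hx1 hxU
  simp [hx hxU] at hx1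

lemma integral_divergence_eq_zero {n : ℕ} {T : Eucl n → Eucl n} (hT : ContDiff ℝ 1 T)
    (hTc : HasCompactSupport T) : ∫ x, divergence T x = 0 := by
  have hTi : ∀ i, ContDiff ℝ 1 fun y => T y i := fun i =>
    (EuclideanSpace.proj (𝕜 := ℝ) i).contDiff.comp hT
  have hTci : ∀ i, HasCompactSupport fun y => T y i := fun i =>
    hTc.comp_left (g := fun z : Eucl n => z i) rfl
  have hi : ∀ i : Fin n, Integrable fun x =>
      fderiv ℝ (fun y => T y i) x (EuclideanSpace.single i 1) := fun i =>
    (((hTi i).continuous_fderiv (by simp)).clm_apply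
      continuous_const).integrable_of_hasCompactSupport ((hTci i).fderiv_apply ℝ _)
  simp_rw [divergence_eq_sum hT]
  rw [integral_finsetSum _ fun i _ => hi i]
  refine Finset.sum_eq_zero fun i _ => ?_
  have := integral_mul_fderiv_eq_neg_fderiv_mul_of_integrable (μ := volume)
    (f := fun _ : Eucl n => (1 : ℝ)) (g := fun y => T y i) (v := EuclideanSpace.single i 1)
    (by simp) (by simpa using hi i)
    (by simpa using (hTi i).continuous.integrable_of_hasCompactSupport (hTci i))
    (fun x _ => differentiableAt_const _) fun x _ => (hTi i).differentiable (by simp) x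
  simpa using this

lemma divergence_eq_zero_of_notMem_tsupport {n : ℕ} {T : Eucl n → Eucl n} {x : Eucl n}
    (hx : x ∉ tsupport T) : divergence T x = 0 := by
  have : fderiv ℝ T x = 0 := by
    by_contra h
    exact hx (support_fderiv_subset ℝ h)
  simp [divergence, this]

/-- Near a point off the sphere the set is full or empty, so test fields supported there have zero
flux and the perimeter measure vanishes. At a point of the sphere the explicit pair of
`isGaussGreen_ball` serves: its normal is continuous there, hence its averages converge to the value
at the point. -/
theorem reducedBoundary_ball (n : ℕ) [NeZero n] {ρ : ℝ} (hρ : 0 < ρ) :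
    reducedBoundary (ball (0 : Eucl n) ρ) = sphere 0 ρ := by
  refine Subset.antisymm ?_ ?_
  · rintro x ⟨μ, ν, h, hpos, -⟩
    by_contra hx
    obtain ⟨r, hr, hrx⟩ : ∃ r > 0, ball x r ⊆ (sphere (0 : Eucl n) ρ)ᶜ :=
      Metric.isOpen_iff.1 isClosed_sphere.isOpen_compl x hx
    refine (hpos r hr).ne' (h.measure_eq_zero isOpen_ball fun T hT hTc hTU => ?_)
    -- The small ball misses the sphere and is connected, so the intermediate value theorem for the
    -- norm keeps it on one side.
    have hconv : IsPreconnected (ball x r) := (convex_ball x r).isPreconnected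
    by_cases hxρ : ‖x‖ < ρ
    · have hsub : tsupport T ⊆ ball 0 ρ := fun y hy => by
        by_contra hyρ
        obtain ⟨z, hz, hzρ⟩ := hconv.intermediate_value (mem_ball_self hr) (hTU hy)
          continuous_norm.continuousOn ⟨hxρ.le, not_lt.1 (by simpa using hyρ)⟩
        exact hrx hz (by simpa using hzρ)
      rw [← integral_indicator measurableSet_ball, ← integral_divergence_eq_zero hT hTc]
      congr 1
      refine indicator_eq_self.2 fun y hy => hsub ?_
      by_contra h'
      exact hy (divergence_eq_zero_of_notMem_tsupport h')
    · refine setIntegral_eq_zero_of_forall_eq_zero fun y hy => ?_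
      refine divergence_eq_zero_of_notMem_tsupport fun hyT => ?_
      obtain ⟨z, hz, hzρ⟩ := hconv.intermediate_value (hTU hyT) (mem_ball_self hr)
        continuous_norm.continuousOn ⟨(by simpa using hy : ‖y‖ < ρ).le, not_lt.1 hxρ⟩
      exact hrx hz (by simpa using hzρ)
  · intro x hx
    have hxρ : ‖x‖ = ρ := by simpa using hx
    have hx0 : x ≠ 0 := by rw [← norm_pos_iff, hxρ]; exact hρ
    have hm : Measurable fun θ : sphere (0 : Eucl n) 1 => ρ • (θ : Eucl n) := by fun_prop
    have hpos : ∀ r : ℝ, 0 < r → 0 < sphereSurface n ρ (ball x r) := fun r hr => by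
      rw [sphereSurface, Measure.smul_apply, smul_eq_mul, Measure.map_apply hm measurableSet_ball]
      refine ENNReal.mul_pos (by simpa using by positivity) (IsOpen.measure_ne_zero _ ?_ ?_)
      · exact isOpen_ball.preimage (by fun_prop)
      · refine ⟨⟨ρ⁻¹ • x, by simp [norm_smul, hxρ, abs_of_pos hρ, hρ.ne']⟩, ?_⟩
        simp [smul_smul, hρ.ne', hr]
    refine ⟨_, _, isGaussGreen_ball n hρ, hpos, ‖x‖⁻¹ • x, ?_, ?_⟩
    · rw [norm_smul, norm_inv, norm_norm, inv_mul_cancel₀ (by simpa using hx0)]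
    · have hcont : ContinuousAt (fun y : Eucl n => ‖y‖⁻¹ • y) x :=
        (continuous_norm.continuousAt.inv₀ (by simpa using hx0)).smul continuousAt_id
      have hmeas : Measurable (fun y : Eucl n => ‖y‖⁻¹ • y) :=
        measurable_norm.inv.smul measurable_id
      have hbd : ∀ y : Eucl n, ‖‖y‖⁻¹ • y‖ ≤ 1 := fun y => by
        rw [norm_smul, norm_inv, norm_norm]; exact inv_mul_le_one
      have hint : ∀ s, IntegrableOn (fun y : Eucl n => ‖y‖⁻¹ • y) s (sphereSurface n ρ) := fun s =>
        (Integrable.of_bound hmeas.aestronglyMeasurable 1 (.of_forall hbd)).integrableOn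
      rw [Metric.tendsto_nhds]
      intro ε hε
      obtain ⟨r₀, hr₀, hr₀x⟩ := Metric.continuousAt_iff.1 hcont (ε / 2) (half_pos hε)
      filter_upwards [Ioo_mem_nhdsGT hr₀] with r hr
      have hmem := (convex_closedBall (‖x‖⁻¹ • x) (ε / 2)).set_average_mem isClosed_closedBall
        (hpos r hr.1).ne' (measure_ne_top (sphereSurface n ρ) _)
        ((ae_restrict_mem measurableSet_ball).mono fun y hy =>
          (hr₀x ((mem_ball.1 hy).trans hr.2)).le) (hint (ball x r))
      exact (mem_closedBall.1 hmem).trans_lt (by linarith)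

/-! ### Averages over balls -/

lemma setAverage_ball_eq {n : ℕ} {E : Type*} [NormedAddCommGroup E] [NormedSpace ℝ E]
    (f : Eucl n → E) (x : Eucl n) (r : ℝ) :
    ⨍ y in ball x r, f y = (volume.real (ball (0 : Eucl n) r))⁻¹ • ∫ y in ball x r, f y := by
  rw [setAverage_eq, measureReal_def, Measure.addHaar_ball_center, ← measureReal_def]

lemma _root_.MeasureTheory.LocallyIntegrable.integrableOn_ball {n : ℕ} {E : Type*}
    [NormedAddCommGroup E] {f : Eucl n → E}
    (hf : LocallyIntegrable f) (x : Eucl n) (r : ℝ) : IntegrableOn f (ball x r) :=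
  (hf.integrableOn_isCompact (isCompact_closedBall x r)).mono_set ball_subset_closedBall

lemma ae_norm_sub_ne {n : ℕ} [NeZero n] (x : Eucl n) (r : ℝ) : ∀ᵐ y : Eucl n, dist y x ≠ r := by
  have := Measure.addHaar_sphere (volume : Measure (Eucl n)) x r
  rwa [measure_eq_zero_iff_ae_notMem] at this

lemma tendsto_setAverage_ball {n : ℕ} {E : Type*} [NormedAddCommGroup E] [NormedSpace ℝ E]
    [CompleteSpace E] {f : Eucl n → E} (hf : LocallyIntegrable f) {x : Eucl n}
    (hx : ContinuousAt f x) : Tendsto (fun r : ℝ => ⨍ y in ball x r, f y) (𝓝[>] 0) (𝓝 (f x)) := by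
  rw [Metric.tendsto_nhds]
  intro ε hε
  obtain ⟨r₀, hr₀, hr₀x⟩ := Metric.continuousAt_iff.1 hx (ε / 2) (half_pos hε)
  filter_upwards [Ioo_mem_nhdsGT hr₀] with r hr
  have hmem := (convex_closedBall (f x) (ε / 2)).set_average_mem (μ := volume) (t := ball x r)
    isClosed_closedBall (measure_ball_pos _ _ hr.1).ne' measure_ball_lt_top.ne
    ((ae_restrict_mem measurableSet_ball).mono fun y hy => (hr₀x ((mem_ball.1 hy).trans hr.2)).le)
    (hf.integrableOn_ball x r)
  exact (mem_closedBall.1 hmem).trans_lt (by linarith)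

/-- Spheres are null, so the indicators of moving balls converge almost everywhere. -/
lemma continuous_integral_ball {n : ℕ} [NeZero n] {E : Type*} [NormedAddCommGroup E]
    [NormedSpace ℝ E] {f : Eucl n → E} (hf : LocallyIntegrable f) (r : ℝ) :
    Continuous fun x => ∫ y in ball x r, f y := by
  simp_rw [← integral_indicator measurableSet_ball]
  refine continuous_iff_continuousAt.2 fun x₀ => ?_
  refine tendsto_integral_filter_of_dominated_convergence
    (fun y => ‖indicator (ball x₀ (r + 1)) f y‖) ?_ ?_ ?_ ?_
  · exact .of_forall fun x => hf.aestronglyMeasurable.indicator measurableSet_ball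
  · filter_upwards [ball_mem_nhds x₀ one_pos] with x hx
    refine .of_forall fun y => ?_
    refine norm_indicator_le_of_subset (fun z hz => ?_) f y
    have := dist_triangle z x x₀
    rw [mem_ball] at *
    linarith
  · exact ((integrable_indicator_iff measurableSet_ball).2 (hf.integrableOn_ball _ _)).norm
  · filter_upwards [ae_norm_sub_ne x₀ r] with y hy
    refine tendsto_const_nhds.congr' ?_
    rcases lt_or_gt_of_ne hy with h | h
    · have : ∀ᶠ x in 𝓝 x₀, dist y x < r :=
        (continuous_const.dist continuous_id).continuousAt.eventually_lt_const h
      filter_upwards [this] with x hx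
      rw [indicator_of_mem (mem_ball.2 h), indicator_of_mem (mem_ball.2 hx)]
    · have : ∀ᶠ x in 𝓝 x₀, r < dist y x :=
        (continuous_const.dist continuous_id).continuousAt.eventually_const_lt h
      filter_upwards [this] with x hx
      rw [indicator_of_notMem (fun h' => absurd (mem_ball.1 h') (not_lt.2 h.le)),
        indicator_of_notMem (fun h' => absurd (mem_ball.1 h') (not_lt.2 hx.le))]

lemma continuous_setAverage_ball {n : ℕ} [NeZero n] {E : Type*} [NormedAddCommGroup E]
    [NormedSpace ℝ E] {f : Eucl n → E} (hf : LocallyIntegrable f) (r : ℝ) :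
    Continuous fun x => ⨍ y in ball x r, f y := by
  simp_rw [setAverage_ball_eq]
  exact (continuous_integral_ball hf r).const_smul _

/-- Averaging over balls is self-adjoint because its kernel `dist y x < ε` is symmetric; boundedness
and bounded support of `w` justify Fubini. -/
lemma integral_inner_setAverage_ball {n : ℕ} {E : Type*} [NormedAddCommGroup E]
    [InnerProductSpace ℝ E] [CompleteSpace E] {f w : Eucl n → E}
    (hf : LocallyIntegrable f)
    (hw : AEStronglyMeasurable w) {C ρ : ℝ} (hwC : ∀ x, ‖w x‖ ≤ C) (hwρ : ∀ x, ρ ≤ ‖x‖ → w x = 0)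
    (ε : ℝ) :
    ∫ x, inner ℝ (⨍ y in ball x ε, f y) (w x) = ∫ y, inner ℝ (f y) (⨍ x in ball y ε, w x) := by
  have hC : 0 ≤ C := (norm_nonneg _).trans (hwC 0)
  have hwi : Integrable w := by
    have : w = indicator (ball 0 ρ) w := by
      refine (indicator_eq_self.2 fun x hx => ?_).symm
      by_contra h
      exact hx (hwρ x (by simpa using h))
    rw [this, integrable_indicator_iff measurableSet_ball]
    exact Measure.integrableOn_of_bounded measure_ball_lt_top.ne hw (M := C)
      (.of_forall fun x => hwC x)
  set F : Eucl n × Eucl n → ℝ := indicator {p : Eucl n × Eucl n | dist p.2 p.1 < ε}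
    (fun p => inner ℝ (f p.2) (w p.1)) with hF
  have hF1 : ∀ p, dist p.2 p.1 < ε → F p = inner ℝ (f p.2) (w p.1) := fun p hp =>
    indicator_of_mem (s := {p : Eucl n × Eucl n | dist p.2 p.1 < ε}) hp _
  have hF0 : ∀ p, ¬ dist p.2 p.1 < ε → F p = 0 := fun p hp =>
    indicator_of_notMem (s := {p : Eucl n × Eucl n | dist p.2 p.1 < ε}) hp _
  have hmeas : MeasurableSet {p : Eucl n × Eucl n | dist p.2 p.1 < ε} :=
    (isOpen_lt (by fun_prop) continuous_const).measurableSet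
  have hFi : Integrable F (volume.prod volume) := by
    have h1 : Integrable (fun p : Eucl n × Eucl n => ‖w p.1‖ *
        ‖indicator (ball 0 (ρ + ε)) f p.2‖) (volume.prod volume) :=
      hwi.norm.mul_prod ((integrable_indicator_iff measurableSet_ball).2
        (hf.integrableOn_ball 0 (ρ + ε))).norm
    refine h1.mono (AEStronglyMeasurable.indicator ?_ hmeas) (.of_forall fun p => ?_)
    · exact (hf.aestronglyMeasurable.comp_snd).inner hw.comp_fst
    · rw [norm_mul, norm_norm, norm_norm]
      by_cases hp : dist p.2 p.1 < ε
      · rw [hF1 p hp]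
        by_cases hp1 : ρ ≤ ‖p.1‖
        · simp [hwρ _ hp1]
        · rw [indicator_of_mem, mul_comm]
          · exact norm_inner_le_norm _ _
          · have := dist_triangle p.2 p.1 0
            rw [mem_ball]
            rw [dist_zero_right p.1] at this
            linarith
      · rw [hF0 p hp, norm_zero]
        positivity
  have h1 : ∀ x, inner ℝ (⨍ y in ball x ε, f y) (w x) =
      (volume.real (ball (0 : Eucl n) ε))⁻¹ * ∫ y, F (x, y) := fun x => by
    rw [setAverage_ball_eq, inner_smul_left, real_inner_comm,
      ← integral_inner (hf.integrableOn_ball x ε), ← integral_indicator measurableSet_ball]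
    congr 2
    ext y
    simp only [hF, indicator, mem_ball, mem_ofPred_eq, real_inner_comm]
  have h2 : ∀ y, inner ℝ (f y) (⨍ x in ball y ε, w x) =
      (volume.real (ball (0 : Eucl n) ε))⁻¹ * ∫ x, F (x, y) := fun y => by
    rw [setAverage_ball_eq, inner_smul_right,
      ← integral_inner hwi.integrableOn, ← integral_indicator measurableSet_ball]
    congr 2
    ext x
    simp only [hF, indicator, mem_ball, mem_ofPred_eq, dist_comm x y]
  simp_rw [h1, h2, integral_const_mul]
  rw [integral_integral_swap (f := fun x y => F (x, y)) hFi]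

/-- By self-adjointness the average is moved from `f` to `w`, whose averages are uniformly bounded
and converge at its continuity points; `f` need only be locally integrable. The weights used later
are the indicator of a ball and `shellField`, both discontinuous only on null sets. -/
theorem tendsto_integral_inner_setAverage_ball {n : ℕ} [NeZero n] {E : Type*}
    [NormedAddCommGroup E] [InnerProductSpace ℝ E] [CompleteSpace E] {f w : Eucl n → E} (hf : LocallyIntegrable f)
    (hw : AEStronglyMeasurable w) {C ρ : ℝ} (hwC : ∀ x, ‖w x‖ ≤ C) (hwρ : ∀ x, ρ ≤ ‖x‖ → w x = 0)
    (hwc : ∀ᵐ x, ContinuousAt w x) :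
    Tendsto (fun ε : ℝ => ∫ x, inner ℝ (⨍ y in ball x ε, f y) (w x)) (𝓝[>] 0)
      (𝓝 (∫ x, inner ℝ (f x) (w x))) := by
  simp_rw [integral_inner_setAverage_ball hf hw hwC hwρ]
  have hC : 0 ≤ C := (norm_nonneg _).trans (hwC 0)
  have hwl : LocallyIntegrable w :=
    (locallyIntegrable_const C).mono hw (.of_forall fun x => (hwC x).trans (le_abs_self C))
  have hz : ∀ ε : ℝ, 0 < ε → ε < 1 → ∀ y, ‖⨍ x in ball y ε, w x‖ ≤
      indicator (ball 0 (ρ + 1)) (fun _ => C) y := fun ε hε hε1 y => by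
    by_cases hy : y ∈ ball 0 (ρ + 1)
    · rw [indicator_of_mem hy]
      have hmem := (convex_closedBall (0 : E) C).set_average_mem (μ := volume) (t := ball y ε)
        isClosed_closedBall (measure_ball_pos _ _ hε).ne' measure_ball_lt_top.ne
        (.of_forall fun y => by simpa using hwC y) (hwl.integrableOn_ball y ε)
      simpa using hmem
    · rw [indicator_of_notMem hy, setAverage_ball_eq,
        setIntegral_eq_zero_of_forall_eq_zero fun x hx => hwρ x ?_]
      · simp
      · have h1 := dist_triangle y x 0
        rw [dist_zero_right, dist_zero_right, dist_comm] at h1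
        rw [mem_ball] at hx
        rw [mem_ball, dist_zero_right, not_lt] at hy
        linarith
  refine tendsto_integral_filter_of_dominated_convergence
    (fun y => ‖indicator (ball 0 (ρ + 1)) f y‖ * C) ?_ ?_ ?_ ?_
  · exact .of_forall fun ε => hf.aestronglyMeasurable.inner
      (continuous_setAverage_ball hwl ε).aestronglyMeasurable
  · filter_upwards [Ioo_mem_nhdsGT one_pos] with ε hε
    refine .of_forall fun y => (norm_inner_le_norm _ _).trans ?_
    have := hz ε hε.1 hε.2 y
    by_cases hy : y ∈ ball 0 (ρ + 1)
    · rw [indicator_of_mem hy] at this ⊢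
      gcongr
    · rw [indicator_of_notMem hy] at this ⊢
      have h0 : ‖⨍ x in ball y ε, w x‖ = 0 := le_antisymm this (norm_nonneg _)
      rw [h0]; simp
  · exact ((integrable_indicator_iff measurableSet_ball).2
      (hf.integrableOn_ball 0 (ρ + 1))).norm.mul_const C
  · filter_upwards [hwc] with y hy
    exact tendsto_const_nhds.inner (tendsto_setAverage_ball hwl hy)

/-! ### The radial competitor -/

lemma lintegral_norm_polar {n : ℕ} [NeZero n] {f : ℝ → ℝ≥0∞} (hf : Measurable f) :
    ∫⁻ x : Eucl n, f ‖x‖ =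
      sphereArea n univ * ∫⁻ r in Ioi (0 : ℝ), ENNReal.ofReal (r ^ (n - 1)) * f r := by
  rw [lintegral_polar (f := fun x : Eucl n => f ‖x‖) (by fun_prop),
    ← lintegral_const_mul _ (by fun_prop)]
  refine setLIntegral_congr_fun measurableSet_Ioi fun r hr => ?_
  have hr0 : 0 < r := hr
  simp [norm_smul, abs_of_pos hr0]
  ring

lemma preciseRep_eq_of_tendsto {n : ℕ} {φ : Eucl n → ℝ} {x : Eucl n} {l : ℝ}
    (h : Tendsto (fun r : ℝ => ⨍ y in ball x r, φ y) (𝓝[>] 0) (𝓝 l)) : preciseRep φ x = l := by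
  have hex : ∃ l : ℝ, Tendsto (fun r : ℝ => ⨍ y in ball x r, φ y) (𝓝[>] 0) (𝓝 l) := ⟨l, h⟩
  rw [preciseRep, dif_pos hex]
  exact tendsto_nhds_unique hex.choose_spec h

lemma preciseRep_eq_of_continuous {n : ℕ} {φ : Eucl n → ℝ} (hφ : Continuous φ) (x : Eucl n) :
    preciseRep φ x = φ x :=
  preciseRep_eq_of_tendsto (tendsto_setAverage_ball hφ.locallyIntegrable hφ.continuousAt)

lemma capacity_empty {n : ℕ} : capacity (∅ : Set (Eucl n)) = 0 := by
  refine le_antisymm (sInf_le ⟨0, 0, ∅, ⟨MemLp.zero, MemLp.zero, ?_⟩, isOpen_empty, subset_rfl, ?_,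
    ?_⟩) bot_le
  · simp
  · simp
  · simp

/-- The thermal resistance, per unit of solid angle, of the layer `R < |x| < ρ`. -/
noncomputable def resistance (n : ℕ) (β R ρ : ℝ) : ℝ :=
  (∫ s in R..ρ, (s ^ (n - 1))⁻¹) + (β * ρ ^ (n - 1))⁻¹

lemma intervalIntegrable_inv_pow {R ρ : ℝ} (hR : 0 < R) (hρ : 0 < ρ) (d : ℕ) :
    IntervalIntegrable (fun s : ℝ => (s ^ d)⁻¹) volume R ρ := by
  refine ContinuousOn.intervalIntegrable fun s hs => ?_
  have : 0 < s := (lt_min hR hρ).trans_le hs.1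
  exact (ContinuousAt.inv₀ (by fun_prop) (by positivity)).continuousWithinAt

lemma integral_inv_pow_nonneg {R ρ : ℝ} (hR : 0 < R) (hRρ : R ≤ ρ) (d : ℕ) :
    0 ≤ ∫ s in R..ρ, (s ^ d)⁻¹ := by
  refine intervalIntegral.integral_nonneg hRρ fun s hs => ?_
  have : 0 < s := hR.trans_le hs.1
  positivity

lemma resistance_pos {n : ℕ} {β R ρ : ℝ} (hβ : 0 < β) (hR : 0 < R) (hRρ : R ≤ ρ) :
    0 < resistance n β R ρ := by
  have := integral_inv_pow_nonneg hR hRρ (n - 1)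
  have : 0 < ρ := hR.trans_le hRρ
  unfold resistance
  positivity

/-- The radial slope of the competitor: it is `κ r¹⁻ⁿ` in the layer `R < r ≤ ρ`, and `t` in the
unit layer outside, so that the competitor decreases from `t` to `0` there. -/
noncomputable def layerSlope (n : ℕ) (R ρ κ t : ℝ) (r : ℝ) : ℝ :=
  indicator (Ioc R ρ) (fun s => κ * (s ^ (n - 1))⁻¹) r + indicator (Ioc ρ (ρ + 1)) (fun _ => t) r

section LayerSlope

variable {n : ℕ} {R ρ κ t : ℝ}

lemma measurable_layerSlope : Measurable (layerSlope n R ρ κ t) :=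
  (Measurable.indicator (by fun_prop) measurableSet_Ioc).add
    (measurable_const.indicator measurableSet_Ioc)

lemma layerSlope_nonneg (hR : 0 < R) (hκ : 0 ≤ κ) (ht : 0 ≤ t) (r : ℝ) :
    0 ≤ layerSlope n R ρ κ t r := by
  refine add_nonneg (indicator_nonneg (fun s hs => ?_) _) (indicator_nonneg (fun _ _ => ht) _)
  have : 0 < s := hR.trans hs.1
  positivity

lemma layerSlope_le (hR : 0 < R) (hκ : 0 ≤ κ) (ht : 0 ≤ t) (r : ℝ) :
    layerSlope n R ρ κ t r ≤ κ * (R ^ (n - 1))⁻¹ + t := by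
  refine add_le_add (indicator_apply_le' (fun hr => ?_) fun _ => by positivity)
    (indicator_apply_le' (fun _ => le_rfl) fun _ => ht)
  have : R ≤ r := hr.1.le
  gcongr

lemma abs_layerSlope_le (hR : 0 < R) (hκ : 0 ≤ κ) (ht : 0 ≤ t) (r : ℝ) :
    |layerSlope n R ρ κ t r| ≤ (⟨κ * (R ^ (n - 1))⁻¹ + t, by positivity⟩ : NNReal) := by
  rw [abs_of_nonneg (layerSlope_nonneg hR hκ ht r)]
  exact layerSlope_le hR hκ ht r

lemma layerSlope_eq_zero (hRρ : R ≤ ρ) {r : ℝ} (hr : r ≤ R ∨ ρ + 1 < r) :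
    layerSlope n R ρ κ t r = 0 := by
  rw [layerSlope, indicator_of_notMem, indicator_of_notMem, add_zero]
  · rintro ⟨h1, h2⟩; rcases hr with h | h <;> linarith
  · rintro ⟨h1, h2⟩; rcases hr with h | h <;> linarith

lemma layerSlope_eq_layer {r : ℝ} (hr : R < r) (hr' : r ≤ ρ) :
    layerSlope n R ρ κ t r = κ * (r ^ (n - 1))⁻¹ := by
  rw [layerSlope, indicator_of_mem (mem_Ioc.2 ⟨hr, hr'⟩),
    indicator_of_notMem (fun h => absurd h.1 (not_lt.2 hr')),
    add_zero]

lemma layerSlope_eq_outer {r : ℝ} (hr : ρ < r) (hr' : r ≤ ρ + 1) :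
    layerSlope n R ρ κ t r = t := by
  rw [layerSlope, indicator_of_mem (s := Ioc ρ _) (mem_Ioc.2 ⟨hr, hr'⟩),
    indicator_of_notMem (fun h => absurd h.2 (not_le.2 hr)), zero_add]

lemma continuousAt_layerSlope (hR : 0 < R) {r : ℝ} (hr : r ∉ ({R, ρ, ρ + 1} : Set ℝ)) :
    ContinuousAt (layerSlope n R ρ κ t) r := by
  simp only [mem_insert_iff, mem_singleton_iff, not_or] at hr
  refine ContinuousAt.add (continuousAt_indicator_Ioc (fun h => ?_) hr.1 hr.2.1)
    (continuousAt_indicator_Ioc (fun _ => continuousAt_const) hr.2.1 hr.2.2)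
  have : 0 < r := hR.trans h.1
  exact continuousAt_const.mul (ContinuousAt.inv₀ (by fun_prop) (by positivity))

lemma radialPrimitive_layerSlope_of_ge (hRρ : R ≤ ρ) {x : Eucl n} (hx : ρ + 1 ≤ ‖x‖) :
    radialPrimitive (layerSlope n R ρ κ t) (ρ + 1) x = 0 := by
  rw [radialPrimitive, intervalIntegral.integral_of_ge hx, neg_eq_zero]
  exact setIntegral_eq_zero_of_forall_eq_zero fun r hr => layerSlope_eq_zero hRρ (.inr hr.1)

lemma radialPrimitive_layerSlope_sphere {x : Eucl n} (hx : ‖x‖ = ρ) :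
    radialPrimitive (layerSlope n R ρ κ t) (ρ + 1) x = t := by
  rw [radialPrimitive, hx, intervalIntegral.integral_of_le (by linarith),
    setIntegral_congr_fun measurableSet_Ioc fun r hr => layerSlope_eq_outer hr.1 hr.2]
  simp

lemma radialPrimitive_layerSlope_core (hR : 0 < R) (hRρ : R ≤ ρ) (hκ : 0 ≤ κ) (ht : 0 ≤ t)
    {x : Eucl n} (hx : ‖x‖ ≤ R) :
    radialPrimitive (layerSlope n R ρ κ t) (ρ + 1) x = κ * (∫ s in R..ρ, (s ^ (n - 1))⁻¹) + t := by
  have hi := intervalIntegrable_of_bounded (measurable_layerSlope (n := n) (R := R) (ρ := ρ)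
    (κ := κ) (t := t)) (abs_layerSlope_le hR hκ ht)
  rw [radialPrimitive, ← intervalIntegral.integral_add_adjacent_intervals (hi ‖x‖ R) (hi R (ρ + 1)),
    ← intervalIntegral.integral_add_adjacent_intervals (hi R ρ) (hi ρ (ρ + 1)),
    intervalIntegral.integral_of_le hx, intervalIntegral.integral_of_le hRρ,
    intervalIntegral.integral_of_le (a := ρ) (by linarith),
    setIntegral_eq_zero_of_forall_eq_zero fun r hr => layerSlope_eq_zero hRρ (.inl hr.2),
    setIntegral_congr_fun measurableSet_Ioc fun r hr => layerSlope_eq_layer hr.1 hr.2,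
    setIntegral_congr_fun measurableSet_Ioc fun r hr => layerSlope_eq_outer hr.1 hr.2,
    intervalIntegral.integral_of_le hRρ, integral_const_mul]
  simp

/-- The unit layer beyond `ρ` only brings the function down to zero, so that it has compact support
and lies in `H¹` of the whole space; it is outside `Ω` and contributes no energy. -/
lemma isH1WithGradient_layer [NeZero n] (hR : 0 < R) (hRρ : R ≤ ρ) (hκ : 0 ≤ κ) (ht : 0 ≤ t) :
    IsH1WithGradient (radialPrimitive (n := n) (layerSlope n R ρ κ t) (ρ + 1))
      fun x => -(layerSlope n R ρ κ t ‖x‖ * ‖x‖⁻¹) • x where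
  memLp := by
    refine ((lipschitzWith_radialPrimitive measurable_layerSlope (abs_layerSlope_le hR hκ ht)
      _).continuous).memLp_of_hasCompactSupport ?_
    refine HasCompactSupport.intro (isCompact_closedBall 0 (ρ + 1)) fun x hx => ?_
    exact radialPrimitive_layerSlope_of_ge hRρ (le_of_lt (by simpa using hx))
  memLp_grad := by
    have hm : Measurable fun x : Eucl n => -(layerSlope n R ρ κ t ‖x‖ * ‖x‖⁻¹) • x :=
      ((measurable_layerSlope.comp measurable_norm).mul measurable_norm.inv).neg.smul measurable_id
    have hb : ∀ x : Eucl n, ‖-(layerSlope n R ρ κ t ‖x‖ * ‖x‖⁻¹) • x‖ ≤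
        κ * (R ^ (n - 1))⁻¹ + t := fun x => by
      rw [norm_smul, norm_neg, norm_mul, norm_inv, norm_norm, mul_assoc]
      refine (mul_le_mul (abs_layerSlope_le hR hκ ht ‖x‖) (d := 1) inv_mul_le_one (by positivity)
        (by positivity)).trans (mul_one _).le
    have hs : (fun x : Eucl n => -(layerSlope n R ρ κ t ‖x‖ * ‖x‖⁻¹) • x) =
        indicator (closedBall 0 (ρ + 1)) fun x => -(layerSlope n R ρ κ t ‖x‖ * ‖x‖⁻¹) • x := by
      refine (indicator_eq_self.2 fun x hx => ?_).symm
      by_contra h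
      refine hx ?_
      simp only [layerSlope_eq_zero hRρ (.inr (by simpa using h)), zero_mul, neg_zero, zero_smul]
    rw [hs, memLp_indicator_iff_restrict measurableSet_closedBall]
    have : IsFiniteMeasure (volume.restrict (closedBall (0 : Eucl n) (ρ + 1))) :=
      ⟨by simpa using measure_closedBall_lt_top⟩
    exact MemLp.of_bound hm.aestronglyMeasurable _ (.of_forall hb)
  integral_by_parts := fun ψ hψ hψc v => by
    rw [integral_radialPrimitive_mul_fderiv measurable_layerSlope (abs_layerSlope_le hR hκ ht)
      (S := {R, ρ, ρ + 1}) (by simp) (fun r hr => continuousAt_layerSlope hR hr) _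
      (hψ.of_le (by exact_mod_cast le_top)) hψc, ← integral_neg]
    congr 1
    ext x
    simp only [inner_smul_left, conj_trivial]
    ring

end LayerSlope

lemma dispersion_le {n : ℕ} {β : ℝ} {K Ω : Set (Eucl n)} {φ : Eucl n → ℝ} {G : Eucl n → Eucl n}
    (h : IsH1WithGradient φ G) (hK : GeOneOn φ K) : dispersion β K Ω ≤ energy β Ω φ G :=
  sInf_le ⟨φ, G, h, hK, rfl⟩

/-- The slope `κ r^(1-n)` carries the same flux through every sphere. The boundary value `t` solves
the Robin condition `κ ρ^(1-n) = β t`, and `κ = 1/Λ` makes the value on the core equal to `1`. The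
energy is then `c κ² Λ = c κ`. -/
theorem dispersion_ball_le {n : ℕ} [NeZero n] {β R ρ : ℝ} (hβ : 0 < β) (hR : 0 < R) (hRρ : R < ρ) :
    dispersion β (closedBall (0 : Eucl n) R) (ball 0 ρ) ≤
      ENNReal.ofReal ((sphereArea n).real univ / resistance n β R ρ) := by
  have hρ : 0 < ρ := hR.trans hRρ
  have hΛ := resistance_pos (n := n) hβ hR hRρ.le
  set κ := (resistance n β R ρ)⁻¹ with hκ
  set t := κ * (β * ρ ^ (n - 1))⁻¹ with ht
  have hκ0 : 0 ≤ κ := by positivity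
  have ht0 : 0 ≤ t := by positivity
  have hcont : Continuous (radialPrimitive (n := n) (layerSlope n R ρ κ t) (ρ + 1)) :=
    (lipschitzWith_radialPrimitive measurable_layerSlope (abs_layerSlope_le hR hκ0 ht0)
      _).continuous
  set c := (sphereArea n).real univ
  set J := ∫ s in R..ρ, (s ^ (n - 1))⁻¹ with hJ
  have hJ0 : 0 ≤ J := integral_inv_pow_nonneg hR hRρ.le _
  have hc0 : 0 ≤ c := measureReal_nonneg
  have hc : sphereArea n univ = ENNReal.ofReal c := (ofReal_measureReal (by finiteness)).symm
  refine (dispersion_le (isH1WithGradient_layer hR hRρ.le hκ0 ht0) ?_).trans ?_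
  -- The competitor is continuous and equals `1` on the core, so the exceptional set is empty.
  · rw [GeOneOn, ← capacity_empty]
    congr 1
    ext x
    simp only [mem_ofPred_eq, mem_empty_iff_false, iff_false, not_and, not_lt]
    intro hx
    rw [preciseRep_eq_of_continuous hcont,
      radialPrimitive_layerSlope_core hR hRρ.le hκ0 ht0 (by simpa using hx), ht, ← mul_add, hκ]
    exact (inv_mul_cancel₀ hΛ.ne').ge
  · have h1 : ∫⁻ x in ball (0 : Eucl n) ρ, ‖-(layerSlope n R ρ κ t ‖x‖ * ‖x‖⁻¹) • x‖ₑ ^ 2 ≤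
        ENNReal.ofReal (c * (κ ^ 2 * J)) := by
      have hpt : ∀ x : Eucl n, indicator (ball (0 : Eucl n) ρ)
          (fun x => ‖-(layerSlope n R ρ κ t ‖x‖ * ‖x‖⁻¹) • x‖ₑ ^ 2) x ≤
          indicator (Ioc R ρ) (fun r => ENNReal.ofReal ((κ * (r ^ (n - 1))⁻¹) ^ 2)) ‖x‖ := by
        intro x
        by_cases hx : ‖x‖ < ρ
        · rw [indicator_of_mem (by simpa using hx)]
          by_cases hxR : R < ‖x‖
          · have hx0 : 0 < ‖x‖ := hR.trans hxR
            rw [indicator_of_mem (mem_Ioc.2 ⟨hxR, hx.le⟩), layerSlope_eq_layer hxR hx.le,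
              ← ofReal_norm, ← ENNReal.ofReal_pow (norm_nonneg _)]
            refine ENNReal.ofReal_le_ofReal (le_of_eq ?_)
            rw [norm_smul, norm_neg, norm_mul, norm_inv, norm_norm, mul_assoc,
              inv_mul_cancel₀ hx0.ne', mul_one, Real.norm_eq_abs, sq_abs]
          · simp [layerSlope_eq_zero hRρ.le (.inl (not_lt.1 hxR))]
        · rw [indicator_of_notMem (by simpa using hx)]
          exact bot_le
      rw [← lintegral_indicator measurableSet_ball]
      refine (lintegral_mono hpt).trans ?_
      rw [lintegral_norm_polar (Measurable.indicator (by fun_prop) measurableSet_Ioc), hc,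
        ENNReal.ofReal_mul hc0]
      gcongr
      have : ∀ r : ℝ, ENNReal.ofReal (r ^ (n - 1)) *
          indicator (Ioc R ρ) (fun r => ENNReal.ofReal ((κ * (r ^ (n - 1))⁻¹) ^ 2)) r =
          indicator (Ioc R ρ) (fun r => ENNReal.ofReal (κ ^ 2 * (r ^ (n - 1))⁻¹)) r := fun r => by
        by_cases hr : r ∈ Ioc R ρ
        · have hr0 : 0 < r := hR.trans hr.1
          rw [indicator_of_mem hr, indicator_of_mem hr, ← ENNReal.ofReal_mul (by positivity)]
          congr 1
          field_simp
        · simp [hr]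
      simp_rw [this]
      rw [setLIntegral_indicator measurableSet_Ioc,
        inter_eq_self_of_subset_left fun r hr => mem_Ioi.2 (hR.trans hr.1), hJ,
        intervalIntegral.integral_of_le hRρ.le, ← integral_const_mul,
        ofReal_integral_eq_lintegral_ofReal]
      · exact ((intervalIntegrable_inv_pow hR hρ _).1).const_mul _
      · filter_upwards [ae_restrict_mem measurableSet_Ioc] with r hr
        have hr0 : 0 < r := hR.trans hr.1
        positivity
    have h2 : ENNReal.ofReal β * ∫⁻ x in reducedBoundary (ball (0 : Eucl n) ρ),
        ‖preciseRep (radialPrimitive (layerSlope n R ρ κ t) (ρ + 1)) x‖ₑ ^ 2 ∂μHE[n - 1] =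
        ENNReal.ofReal (β * (t ^ 2 * (ρ ^ (n - 1) * c))) := by
      rw [reducedBoundary_ball n hρ, setLIntegral_congr_fun (g := fun _ => ENNReal.ofReal (t ^ 2))
        isClosed_sphere.measurableSet fun x hx => ?_]
      · rw [euclideanHausdorffMeasure_restrict_sphere n hρ, lintegral_const, sphereSurface,
          Measure.smul_apply, Measure.map_apply (by fun_prop) .univ, preimage_univ, hc, smul_eq_mul,
          ← ENNReal.ofReal_mul (by positivity), ← ENNReal.ofReal_mul (by positivity),
          ← ENNReal.ofReal_mul (by positivity)]
      · simp only [preciseRep_eq_of_continuous hcont]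
        rw [radialPrimitive_layerSlope_sphere (by simpa using hx), Real.enorm_eq_ofReal ht0,
          ENNReal.ofReal_pow ht0]
    rw [energy, h2]
    refine (add_le_add_left h1 _).trans ?_
    rw [← ENNReal.ofReal_add (by positivity) (by positivity)]
    refine ENNReal.ofReal_le_ofReal (le_of_eq ?_)
    have hκΛ : κ * (J + (β * ρ ^ (n - 1))⁻¹) = 1 := inv_mul_cancel₀ hΛ.ne'
    calc c * (κ ^ 2 * J) + β * (t ^ 2 * (ρ ^ (n - 1) * c))
        = c * κ * (κ * (J + (β * ρ ^ (n - 1))⁻¹)) := by rw [ht]; field_simp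
      _ = _ := by rw [hκΛ, mul_one, hκ, div_eq_mul_inv]

/-! ### Averages of Sobolev functions -/

/-- Smooth bumps increasing to the indicator of the ball of radius `r`. -/
noncomputable def ballBump (n : ℕ) {r : ℝ} (hr : 0 < r) (j : ℕ) : ContDiffBump (0 : Eucl n) where
  -- The shift by `2` keeps the inner radius positive at `j = 0`.
  rIn := r * (1 - 1 / ((j : ℝ) + 2))
  rOut := r
  rIn_pos := mul_pos hr <| by
    rw [sub_pos, div_lt_one (by positivity)]; linarith [j.cast_nonneg (α := ℝ)]
  rIn_lt_rOut := by
    have : 0 < 1 / ((j : ℝ) + 2) := by positivity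
    nlinarith

lemma tendsto_ballBump {n : ℕ} {r : ℝ} (hr : 0 < r) (z : Eucl n) :
    Tendsto (fun j => ballBump n hr j z) atTop (𝓝 (indicator (ball 0 r) (fun _ => (1 : ℝ)) z)) := by
  by_cases hz : z ∈ ball 0 r
  · rw [indicator_of_mem hz]
    refine tendsto_const_nhds.congr' ?_
    have h1 : Tendsto (fun j : ℕ => r * (1 - 1 / ((j : ℝ) + 2))) atTop (𝓝 (r * (1 - 0))) := by
      refine (tendsto_const_nhds.sub ?_).const_mul r
      have := (tendsto_one_div_add_atTop_nhds_zero_nat (𝕜 := ℝ)).comp (tendsto_add_atTop_nat 1)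
      refine this.congr fun j => ?_
      simp [add_assoc]
      norm_num
    have h2 : dist z 0 < r * (1 - 0) := by simpa using hz
    filter_upwards [h1.eventually_const_lt h2] with j hj
    exact ((ballBump n hr j).one_of_mem_closedBall (mem_closedBall.2 hj.le)).symm
  · rw [indicator_of_notMem hz]
    refine tendsto_const_nhds.congr fun j => ?_
    exact ((ballBump n hr j).zero_of_le_dist (not_lt.1 hz)).symm

lemma norm_mul_ballBump_le {n : ℕ} {r : ℝ} (hr : 0 < r) (j : ℕ) (f : Eucl n → ℝ) (x y : Eucl n) :
    ‖f y * ballBump n hr j (x - y)‖ ≤ indicator (ball x r) (fun y => ‖f y‖) y := by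
  rw [norm_mul, Real.norm_of_nonneg (ballBump n hr j).nonneg]
  by_cases hy : y ∈ ball x r
  · rw [indicator_of_mem hy]
    exact mul_le_of_le_one_right (norm_nonneg _) (ballBump n hr j).le_one
  · rw [indicator_of_notMem hy, (ballBump n hr j).zero_of_le_dist, mul_zero]
    rw [mem_ball, dist_comm, dist_eq_norm, not_lt] at hy
    rwa [dist_zero_right]

lemma norm_integral_mul_ballBump_le {n : ℕ} {f : Eucl n → ℝ} (hf : LocallyIntegrable f) {r : ℝ}
    (hr : 0 < r) (j : ℕ) (x : Eucl n) :
    ‖∫ y, f y * ballBump n hr j (x - y)‖ ≤ ∫ y in ball x r, ‖f y‖ := by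
  rw [← integral_indicator measurableSet_ball]
  refine norm_integral_le_of_norm_le ?_ (.of_forall fun y => norm_mul_ballBump_le hr j f x y)
  exact (integrable_indicator_iff measurableSet_ball).2 (hf.integrableOn_ball x r).norm

lemma tendsto_integral_mul_ballBump {n : ℕ} {f : Eucl n → ℝ} (hf : LocallyIntegrable f) {r : ℝ}
    (hr : 0 < r) (x : Eucl n) :
    Tendsto (fun j => ∫ y, f y * ballBump n hr j (x - y)) atTop (𝓝 (∫ y in ball x r, f y)) := by
  rw [← integral_indicator measurableSet_ball]
  refine tendsto_integral_of_dominated_convergence (indicator (ball x r) fun y => ‖f y‖) ?_ ?_ ?_ ?_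
  · refine fun j => hf.aestronglyMeasurable.mul (Continuous.aestronglyMeasurable ?_)
    exact (ballBump n hr j).continuous.comp (by fun_prop)
  · exact (integrable_indicator_iff measurableSet_ball).2 (hf.integrableOn_ball x r).norm
  · exact fun j => .of_forall fun y => norm_mul_ballBump_le hr j f x y
  · refine .of_forall fun y => ?_
    have h := (tendsto_ballBump hr (x - y)).const_mul (f y)
    convert! h using 2
    by_cases hy : y ∈ ball x r
    · have : x - y ∈ ball 0 r := by
        rw [mem_ball, dist_comm, dist_eq_norm] at hy
        rwa [mem_ball, dist_zero_right]
      rw [indicator_of_mem hy, indicator_of_mem this, mul_one]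
    · have : x - y ∉ ball 0 r := fun h => hy (by
        rw [mem_ball, dist_comm, dist_eq_norm]; simpa using h)
      rw [indicator_of_notMem hy, indicator_of_notMem this, mul_zero]

namespace IsH1WithGradient

variable {n : ℕ} {φ : Eucl n → ℝ} {G : Eucl n → Eucl n}

lemma locallyIntegrable (h : IsH1WithGradient φ G) : LocallyIntegrable φ :=
  h.memLp.locallyIntegrable (by norm_num)

lemma locallyIntegrable_grad (h : IsH1WithGradient φ G) : LocallyIntegrable G :=
  h.memLp_grad.locallyIntegrable (by norm_num)

lemma locallyIntegrable_inner (h : IsH1WithGradient φ G) (v : Eucl n) :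
    LocallyIntegrable fun y => inner ℝ (G y) v := by
  have := (h.memLp_grad.inner_const (𝕜 := ℝ) v)
  exact this.locallyIntegrable (by norm_num)

/-- The convolution of `φ` with `η` is differentiated along a line; the derivative falls on `η`, and
the definition of the weak gradient, tested with `y ↦ η (x + t • z - y)`, moves it to `φ`. -/
lemma integral_mul_smooth_sub (h : IsH1WithGradient φ G) {η : Eucl n → ℝ} (hη : ContDiff ℝ ∞ η)
    (hηc : HasCompactSupport η) (x z : Eucl n) (a b : ℝ) :
    (∫ y, φ y * η (x + b • z - y)) - ∫ y, φ y * η (x + a • z - y) =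
      ∫ t in a..b, ∫ y, inner ℝ (G y) z * η (x + t • z - y) := by
  have h1 : ContDiff ℝ 1 η := hη.of_le (by exact_mod_cast le_top)
  have hd : ∀ w : Eucl n, HasFDerivAt (fun w => ∫ y, φ y * η (w - y)) _ w := fun w =>
    hηc.hasFDerivAt_convolution_right (ContinuousLinearMap.mul ℝ ℝ) h.locallyIntegrable h1 w
  have hd' : ∀ t : ℝ, HasDerivAt (fun t : ℝ => ∫ y, φ y * η (x + t • z - y))
      (∫ y, inner ℝ (G y) z * η (x + t • z - y)) t := fun t => by
    have hl : HasDerivAt (fun t : ℝ => x + t • z) z t := by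
      simpa using ((hasDerivAt_id t).smul_const z).const_add x
    have := (hd (x + t • z)).comp_hasDerivAt t hl
    refine this.congr_deriv ?_
    rw [convolution_precompR_apply _ h.locallyIntegrable (hηc.fderiv ℝ)
      (h1.continuous_fderiv (by simp))]
    have hibp := h.integral_by_parts (fun y => η (x + t • z - y))
      (hη.comp (contDiff_const.sub contDiff_id))
      (hηc.comp_homeomorph (Homeomorph.subLeft (x + t • z))) z
    have hfd : ∀ y, fderiv ℝ (fun y => η (x + t • z - y)) y z =
        -fderiv ℝ η (x + t • z - y) z := fun y => by
      have h2 : HasFDerivAt (fun y : Eucl n => x + t • z - y)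
          (-ContinuousLinearMap.id ℝ (Eucl n)) y :=
        (hasFDerivAt_id y).const_sub _
      have h3 := ((h1.differentiable (by simp) (x + t • z - y)).hasFDerivAt).comp y h2
      change HasFDerivAt (fun y => η (x + t • z - y)) _ y at h3
      rw [h3.fderiv]
      simp
    simp_rw [hfd, mul_neg, integral_neg] at hibp
    exact neg_injective hibp
  have hc : Continuous fun t : ℝ => ∫ y, inner ℝ (G y) z * η (x + t • z - y) := by
    have := hηc.continuous_convolution_right (μ := volume) (ContinuousLinearMap.mul ℝ ℝ)
      (h.locallyIntegrable_inner z) hη.continuous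
    exact this.comp (f := fun t : ℝ => x + t • z) (by fun_prop)
  exact (intervalIntegral.integral_eq_sub_of_hasDerivAt (fun t _ => hd' t)
    (hc.intervalIntegrable _ _)).symm

/-- The smooth kernels converge to the indicator of the ball. The resulting fundamental theorem of
calculus for averages holds on every segment, with no exceptional set. -/
theorem integral_ball_sub [NeZero n] (h : IsH1WithGradient φ G) {r : ℝ} (hr : 0 < r)
    (x z : Eucl n) (a b : ℝ) :
    (∫ y in ball (x + b • z) r, φ y) - ∫ y in ball (x + a • z) r, φ y =
      ∫ t in a..b, inner ℝ (∫ y in ball (x + t • z) r, G y) z := by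
  have hL : Tendsto (fun j => (∫ y, φ y * ballBump n hr j (x + b • z - y)) -
      ∫ y, φ y * ballBump n hr j (x + a • z - y)) atTop
      (𝓝 ((∫ y in ball (x + b • z) r, φ y) - ∫ y in ball (x + a • z) r, φ y)) :=
    (tendsto_integral_mul_ballBump h.locallyIntegrable hr _).sub
      (tendsto_integral_mul_ballBump h.locallyIntegrable hr _)
  have hinner : ∀ t : ℝ, inner ℝ (∫ y in ball (x + t • z) r, G y) z =
      ∫ y in ball (x + t • z) r, inner ℝ (G y) z := fun t => by
    rw [real_inner_comm, ← integral_inner (h.locallyIntegrable_grad.integrableOn_ball _ _)]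
    simp_rw [real_inner_comm]
  have hR : Tendsto (fun j => ∫ t in a..b, ∫ y, inner ℝ (G y) z *
      ballBump n hr j (x + t • z - y)) atTop
      (𝓝 (∫ t in a..b, inner ℝ (∫ y in ball (x + t • z) r, G y) z)) := by
    simp_rw [hinner]
    have hcn : Continuous fun t : ℝ => ∫ y in ball (x + t • z) r, ‖inner ℝ (G y) z‖ :=
      (continuous_integral_ball (((h.memLp_grad.inner_const (𝕜 := ℝ) z).norm).locallyIntegrable
        (by norm_num)) r).comp
        (f := fun t : ℝ => x + t • z) (by fun_prop)
    refine intervalIntegral.tendsto_integral_filter_of_dominated_convergence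
      (fun t => ∫ y in ball (x + t • z) r, ‖inner ℝ (G y) z‖) ?_ ?_ ?_ ?_
    · refine .of_forall fun j => Continuous.aestronglyMeasurable ?_
      have := (ballBump n hr j).hasCompactSupport.continuous_convolution_right (μ := volume)
        (ContinuousLinearMap.mul ℝ ℝ) (h.locallyIntegrable_inner z) (ballBump n hr j).continuous
      exact this.comp (f := fun t : ℝ => x + t • z) (by fun_prop)
    · exact .of_forall fun j => .of_forall fun t _ =>
        norm_integral_mul_ballBump_le (h.locallyIntegrable_inner z) hr j _
    · exact hcn.intervalIntegrable _ _
    · exact .of_forall fun t _ => tendsto_integral_mul_ballBump (h.locallyIntegrable_inner z) hr _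
  refine tendsto_nhds_unique hL (hR.congr fun j => ?_)
  exact (h.integral_mul_smooth_sub (ballBump n hr j).contDiff
    (ballBump n hr j).hasCompactSupport x z a b).symm

theorem setAverage_ball_sub [NeZero n] (h : IsH1WithGradient φ G) {r : ℝ} (hr : 0 < r)
    (x z : Eucl n) (a b : ℝ) :
    (⨍ y in ball (x + b • z) r, φ y) - ⨍ y in ball (x + a • z) r, φ y =
      ∫ t in a..b, inner ℝ (⨍ y in ball (x + t • z) r, G y) z := by
  simp_rw [setAverage_ball_eq, inner_smul_left]
  rw [intervalIntegral.integral_const_mul, ← h.integral_ball_sub hr, smul_eq_mul, smul_eq_mul,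
    mul_sub]
  rfl

end IsH1WithGradient

/-! ### Oscillation of ball averages between two scales -/

lemma map_add_smul_restrict_ball {n : ℕ} (x : Eucl n) {t : ℝ} (ht : 0 < t) :
    Measure.map (fun z => x + t • z) (volume.restrict (ball (0 : Eucl n) 1)) =
      ENNReal.ofReal ((t ^ n)⁻¹) • volume.restrict (ball x t) := by
  have hm : Measurable fun z : Eucl n => x + t • z := by fun_prop
  ext S hS
  rw [Measure.map_apply hm hS, Measure.restrict_apply (hm hS), Measure.smul_apply,
    Measure.restrict_apply hS, smul_eq_mul]
  have : (fun z : Eucl n => x + t • z) ⁻¹' S ∩ ball 0 1 =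
      (t • ·) ⁻¹' ((x + ·) ⁻¹' (S ∩ ball x t)) := by
    ext z
    simp [norm_smul, abs_of_pos ht, ht, mul_lt_iff_lt_one_right]
  rw [this, Measure.addHaar_preimage_smul _ ht.ne', measure_preimage_add,
    finrank_euclideanSpace_fin,
    abs_of_pos (by positivity)]

lemma setAverage_ball_eq_unit {n : ℕ} {f : Eucl n → ℝ} (hf : Continuous f) (x : Eucl n)
    {t : ℝ} (ht : 0 < t) :
    ⨍ y in ball x t, f y =
      (volume.real (ball (0 : Eucl n) 1))⁻¹ * ∫ z in ball (0 : Eucl n) 1, f (x + t • z) := by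
  have h1 : ∫ z in ball (0 : Eucl n) 1, f (x + t • z) = (t ^ n)⁻¹ * ∫ y in ball x t, f y := by
    rw [← integral_map (φ := fun z => x + t • z) (by fun_prop) hf.aestronglyMeasurable,
      map_add_smul_restrict_ball x ht, integral_smul_measure, ENNReal.toReal_ofReal (by positivity),
      smul_eq_mul]
  rw [h1, setAverage_ball_eq, measureReal_def, Measure.addHaar_ball_of_pos _ _ ht,
    ENNReal.toReal_mul, ENNReal.toReal_ofReal (by positivity), finrank_euclideanSpace_fin,
    measureReal_def, mul_inv, smul_eq_mul]
  ring

/-- Up to a dimensional constant, the mean of `|G|` over the ball of radius `2t` around `x`. -/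
noncomputable def gradMean {n : ℕ} (G : Eucl n → Eucl n) (x : Eucl n) (t : ℝ) : ℝ≥0∞ :=
  ENNReal.ofReal ((t ^ n)⁻¹) * ∫⁻ y in ball x (2 * t), ‖G y‖ₑ

lemma measurable_lintegral_ball {n : ℕ} {g : Eucl n → ℝ≥0∞} (hg : Measurable g) (c : ℝ) :
    Measurable fun p : Eucl n × ℝ => ∫⁻ y in ball p.1 (c * p.2), g y := by
  simp_rw [← lintegral_indicator measurableSet_ball]
  refine Measurable.lintegral_prod_right' (f := fun q : (Eucl n × ℝ) × Eucl n =>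
    indicator (ball q.1.1 (c * q.1.2)) g q.2) ?_
  have : (fun q : (Eucl n × ℝ) × Eucl n => indicator (ball q.1.1 (c * q.1.2)) g q.2) =
      indicator {q : (Eucl n × ℝ) × Eucl n | dist q.2 q.1.1 < c * q.1.2} fun q => g q.2 := by
    ext q
    simp only [indicator, mem_ball, mem_ofPred_eq]
  rw [this]
  exact (hg.comp measurable_snd).indicator
    (isOpen_lt (by fun_prop) (by fun_prop)).measurableSet

lemma measurable_gradMean {n : ℕ} {G : Eucl n → Eucl n} (hG : Measurable G) :
    Measurable fun p : Eucl n × ℝ => gradMean G p.1 p.2 :=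
  Measurable.mul (by fun_prop) (measurable_lintegral_ball hG.enorm 2)

lemma enorm_setAverage_ball_le {n : ℕ} {G : Eucl n → Eucl n} (x : Eucl n) (r : ℝ) :
    ‖⨍ y in ball x r, G y‖ₑ ≤ (volume (ball (0 : Eucl n) r))⁻¹ * ∫⁻ y in ball x r, ‖G y‖ₑ := by
  rcases le_or_gt r 0 with hr | hr
  · simp [ball_eq_empty.2 hr]
  rw [setAverage_ball_eq, enorm_smul]
  gcongr
  · rw [measureReal_def, ← ENNReal.toReal_inv, Real.enorm_eq_ofReal ENNReal.toReal_nonneg]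
    exact ENNReal.ofReal_toReal_le
  · exact enorm_integral_le_lintegral_enorm _

/-- By Tonelli each `y` is counted with total weight at most one, and only if it lies within `ε + t
≤ 2t` of `x`. -/
lemma lintegral_ball_average_le {n : ℕ} {g : Eucl n → ℝ≥0∞} (hg : Measurable g) (x : Eucl n)
    {ε t : ℝ} (hε : 0 < ε) (hεt : ε ≤ t) :
    ∫⁻ w in ball x t, (volume (ball (0 : Eucl n) ε))⁻¹ * ∫⁻ y in ball w ε, g y ≤
      ∫⁻ y in ball x (2 * t), g y := by
  have hV0 : volume (ball (0 : Eucl n) ε) ≠ 0 := (measure_ball_pos _ _ hε).ne'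
  have hVt : volume (ball (0 : Eucl n) ε) ≠ ⊤ := measure_ball_lt_top.ne
  have hmb : Measurable fun w : Eucl n => ∫⁻ y in ball w ε, g y := by
    simpa [Function.comp_def] using (measurable_lintegral_ball hg 1).comp
      (measurable_id.prodMk (measurable_const (a := ε)))
  rw [lintegral_const_mul _ hmb, ENNReal.inv_mul_le_iff hV0 hVt]
  set S : Set (Eucl n × Eucl n) := {p | dist p.1 x < t} ∩ {p | dist p.2 p.1 < ε}
  have hS : MeasurableSet S :=
    ((isOpen_lt (by fun_prop) (by fun_prop)).inter
      (isOpen_lt (by fun_prop) (by fun_prop))).measurableSet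
  have hF : Measurable (indicator S fun p => g p.2) := (hg.comp measurable_snd).indicator hS
  calc ∫⁻ w in ball x t, ∫⁻ y in ball w ε, g y
      = ∫⁻ w, ∫⁻ y, indicator S (fun p => g p.2) (w, y) := by
        rw [← lintegral_indicator measurableSet_ball]
        refine lintegral_congr fun w => ?_
        by_cases hw : dist w x < t
        · rw [indicator_of_mem (mem_ball.2 hw), ← lintegral_indicator measurableSet_ball]
          refine lintegral_congr fun y => ?_
          simp [indicator, S, hw]
        · rw [indicator_of_notMem (by simpa using hw)]
          simp [indicator, S, hw]
    _ = ∫⁻ y, ∫⁻ w, indicator S (fun p => g p.2) (w, y) := lintegral_lintegral_swap hF.aemeasurable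
    _ ≤ ∫⁻ y, indicator (ball x (2 * t)) (fun y => volume (ball (0 : Eucl n) ε) * g y) y := by
        refine lintegral_mono fun y => ?_
        by_cases hy : y ∈ ball x (2 * t)
        · rw [indicator_of_mem hy, mul_comm, ← Measure.addHaar_ball_center volume y,
            ← setLIntegral_const, ← lintegral_indicator measurableSet_ball]
          refine lintegral_mono fun w => ?_
          by_cases hw : (w, y) ∈ S
          · rw [indicator_of_mem hw, indicator_of_mem (mem_ball'.2 hw.2)]
          · rw [indicator_of_notMem hw]; exact bot_le
        · have : ∀ w, indicator S (fun p => g p.2) (w, y) = 0 := fun w => by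
            refine indicator_of_notMem (fun hw => hy ?_) _
            have h1 : dist w x < t := hw.1
            have h2 : dist y w < ε := hw.2
            have := dist_triangle y w x
            rw [mem_ball]
            linarith
          simp [this]
    _ = _ := by
        rw [lintegral_indicator measurableSet_ball, lintegral_const_mul _ hg]

namespace IsH1WithGradient

variable {n : ℕ} [NeZero n] {φ : Eucl n → ℝ} {G : Eucl n → Eucl n}

/-- The average over `ball x t` is the mean over unit vectors and shorter `z` of the value at `x + t
• z`, so its increment in `t` is controlled by the averaged gradient times `‖z‖ ≤ 1`. The inner
averaging at scale `ε` makes this increment formula exact, and the final bound does not involve `ε`,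
which can then be sent to `0`. -/
lemma enorm_setAverage_setAverage_sub_le (h : IsH1WithGradient φ G) (hG : Measurable G)
    (x : Eucl n) {ε s r : ℝ} (hε : 0 < ε) (hεs : ε ≤ s) (hsr : s ≤ r) :
    ‖(⨍ w in ball x r, ⨍ y in ball w ε, φ y) - ⨍ w in ball x s, ⨍ y in ball w ε, φ y‖ₑ ≤
      (volume (ball (0 : Eucl n) 1))⁻¹ * ∫⁻ t in Ioc s r, gradMean G x t := by
  have hs : 0 < s := hε.trans_le hεs
  have hcφ := continuous_setAverage_ball h.locallyIntegrable ε
  have hcG := continuous_setAverage_ball h.locallyIntegrable_grad ε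
  have hV0 : volume (ball (0 : Eucl n) 1) ≠ 0 := (measure_ball_pos _ _ one_pos).ne'
  have hi : ∀ t : ℝ, IntegrableOn (fun z => ⨍ y in ball (x + t • z) ε, φ y)
      (ball (0 : Eucl n) 1) := fun t =>
    (hcφ.comp (f := fun z => x + t • z) (by fun_prop)).locallyIntegrable.integrableOn_ball _ _
  rw [setAverage_ball_eq_unit hcφ x (hs.trans_le hsr), setAverage_ball_eq_unit hcφ x hs, ← mul_sub,
    ← integral_sub (hi r) (hi s), enorm_mul]
  simp_rw [h.setAverage_ball_sub hε]
  gcongr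
  · rw [measureReal_def, ← ENNReal.toReal_inv, Real.enorm_eq_ofReal ENNReal.toReal_nonneg]
    exact ENNReal.ofReal_toReal_le
  calc ‖∫ z in ball (0 : Eucl n) 1, ∫ t in s..r, inner ℝ (⨍ y in ball (x + t • z) ε, G y) z‖ₑ
      ≤ ∫⁻ z in ball (0 : Eucl n) 1, ∫⁻ t in Ioc s r, ‖⨍ y in ball (x + t • z) ε, G y‖ₑ := by
        refine (enorm_integral_le_lintegral_enorm _).trans ?_
        refine setLIntegral_mono' measurableSet_ball fun z hz => ?_
        rw [intervalIntegral.integral_of_le hsr]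
        refine (enorm_integral_le_lintegral_enorm _).trans (lintegral_mono fun t => ?_)
        rw [← ofReal_norm, ← ofReal_norm]
        refine ENNReal.ofReal_le_ofReal ((norm_inner_le_norm _ _).trans ?_)
        exact mul_le_of_le_one_right (norm_nonneg _) (by simpa using (mem_ball.1 hz).le)
    _ = ∫⁻ t in Ioc s r, ∫⁻ z in ball (0 : Eucl n) 1, ‖⨍ y in ball (x + t • z) ε, G y‖ₑ := by
        refine lintegral_lintegral_swap (Continuous.aemeasurable ?_)
        exact (hcG.comp (f := fun p : Eucl n × ℝ => x + p.2 • p.1) (by fun_prop)).enorm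
    _ ≤ ∫⁻ t in Ioc s r, gradMean G x t := by
        refine setLIntegral_mono' measurableSet_Ioc fun t ht => ?_
        have ht0 : 0 < t := hs.trans ht.1
        rw [← lintegral_map (f := fun w => ‖⨍ y in ball w ε, G y‖ₑ) hcG.enorm.measurable
          (by fun_prop : Measurable fun z : Eucl n => x + t • z), map_add_smul_restrict_ball x ht0,
          lintegral_smul_measure, gradMean, smul_eq_mul]
        refine mul_le_mul' le_rfl ?_
        exact (lintegral_mono fun w => enorm_setAverage_ball_le w ε).trans
          (lintegral_ball_average_le hG.enorm x hε (hεs.trans ht.1.le))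

lemma tendsto_setAverage_setAverage (h : IsH1WithGradient φ G) (x : Eucl n) (r : ℝ) :
    Tendsto (fun ε : ℝ => ⨍ w in ball x r, ⨍ y in ball w ε, φ y) (𝓝[>] 0)
      (𝓝 (⨍ y in ball x r, φ y)) := by
  have := tendsto_integral_inner_setAverage_ball h.locallyIntegrable
    (w := indicator (ball x r) fun _ => (1 : ℝ)) (C := 1) (ρ := ‖x‖ + r)
    (measurable_const.indicator measurableSet_ball).aestronglyMeasurable
    (fun y => (norm_indicator_le_norm_self _ _).trans (by simp))
    (fun y hy => indicator_of_notMem (fun hyx => by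
      have := norm_sub_norm_le y x
      rw [mem_ball, dist_eq_norm] at hyx
      linarith) _) ?_
  · have hi : ∀ (f : Eucl n → ℝ) y, inner ℝ (f y) (indicator (ball x r) (fun _ => (1 : ℝ)) y) =
        indicator (ball x r) f y := fun f y => by
      by_cases hy : y ∈ ball x r <;> simp [hy]
    have hi' : ∀ f : Eucl n → ℝ, ∫ y, inner ℝ (f y) (indicator (ball x r) (fun _ => (1 : ℝ)) y) =
        ∫ y in ball x r, f y := fun f => by
      rw [← integral_indicator measurableSet_ball]
      exact integral_congr_ae (.of_forall (hi f))
    rw [hi' φ] at this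
    simp_rw [setAverage_ball_eq _ x r]
    exact (this.congr fun ε => hi' _).const_smul _
  · filter_upwards [ae_norm_sub_ne x r] with y hy
    rcases lt_or_gt_of_ne hy with h | h
    · refine (continuousAt_const (y := (1 : ℝ))).congr ?_
      filter_upwards [isOpen_ball.mem_nhds (mem_ball.2 h)] with w hw
      rw [indicator_of_mem hw]
    · refine (continuousAt_const (y := (0 : ℝ))).congr ?_
      have : y ∈ (closedBall x r)ᶜ := by simpa using h
      filter_upwards [isClosed_closedBall.isOpen_compl.mem_nhds this] with w hw
      rw [indicator_of_notMem fun h' => hw (ball_subset_closedBall h')]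

theorem enorm_setAverage_sub_le (h : IsH1WithGradient φ G) (hG : Measurable G)
    (x : Eucl n) {s r : ℝ} (hs : 0 < s) (hsr : s ≤ r) :
    ‖(⨍ y in ball x r, φ y) - ⨍ y in ball x s, φ y‖ₑ ≤
      (volume (ball (0 : Eucl n) 1))⁻¹ * ∫⁻ t in Ioc s r, gradMean G x t := by
  refine le_of_tendsto ((h.tendsto_setAverage_setAverage x r).sub
    (h.tendsto_setAverage_setAverage x s)).enorm ?_
  filter_upwards [Ioc_mem_nhdsGT hs] with ε hε
  exact h.enorm_setAverage_setAverage_sub_le hG x hε.1 hε.2 hsr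

end IsH1WithGradient

/-! ### Traces on spheres -/

/-- A weighted Young inequality: either `a ≤ c'`, or `a = c a c' ≤ c a²`. With `c = √t` it turns
square integrability into a bound for integrals over thin shells. -/
lemma le_weighted_sq_add {c c' : ℝ≥0∞} (h : c * c' = 1) (a : ℝ≥0∞) : a ≤ c * a ^ 2 + c' := by
  rcases le_total a c' with ha | ha
  · exact ha.trans le_add_self
  · calc a = c * a * c' := by rw [mul_right_comm, h, one_mul]
      _ ≤ c * a * a := by gcongr
      _ = c * a ^ 2 := by ring
      _ ≤ _ := le_self_add

lemma ofReal_sqrt_mul_inv {t : ℝ} (ht : 0 < t) :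
    ENNReal.ofReal √t * ENNReal.ofReal (√t)⁻¹ = 1 := by
  rw [← ENNReal.ofReal_mul (Real.sqrt_nonneg t), mul_inv_cancel₀ (Real.sqrt_pos.2 ht).ne',
    ENNReal.ofReal_one]

lemma volume_shell_le {n : ℕ} [NeZero n] {s t : ℝ} (hs : 0 < s) (ht1 : t ≤ 1) :
    volume {x : Eucl n | ‖x‖ ∈ Ioo s (s + t)} ≤
      sphereArea n univ * ENNReal.ofReal ((s + 1) ^ (n - 1)) * ENNReal.ofReal t := by
  have hm : MeasurableSet {x : Eucl n | ‖x‖ ∈ Ioo s (s + t)} := measurable_norm measurableSet_Ioo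
  have h1 : ∀ x : Eucl n, indicator {x : Eucl n | ‖x‖ ∈ Ioo s (s + t)} (1 : Eucl n → ℝ≥0∞) x =
      indicator (Ioo s (s + t)) (fun _ => 1) ‖x‖ := fun x => by
    simp [indicator]
  rw [← lintegral_indicator_one hm, lintegral_congr h1,
    lintegral_norm_polar (measurable_const.indicator measurableSet_Ioo), mul_assoc]
  gcongr
  calc ∫⁻ r in Ioi (0 : ℝ), ENNReal.ofReal (r ^ (n - 1)) * indicator (Ioo s (s + t)) (fun _ => 1) r
      ≤ ∫⁻ r, indicator (Ioo s (s + t)) (fun _ => ENNReal.ofReal ((s + 1) ^ (n - 1))) r := by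
        refine (setLIntegral_le_lintegral _ _).trans (lintegral_mono fun r => ?_)
        by_cases hr : r ∈ Ioo s (s + t)
        · rw [indicator_of_mem hr, indicator_of_mem hr, mul_one]
          refine ENNReal.ofReal_le_ofReal (pow_le_pow_left₀ (hs.trans hr.1).le ?_ _)
          linarith [hr.2]
        · simp [hr]
    _ = _ := by
        rw [lintegral_indicator measurableSet_Ioo, setLIntegral_const, Real.volume_Ioo]
        ring_nf

/-- For each fixed translation `z` the function is integrated over a shell of volume `O(t)`. The
weights `√t` and `1/√t` balance the `L²` norm against this volume, and both terms are `O(√t)`. -/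
lemma lintegral_shell_ball_le {n : ℕ} [NeZero n] {g : Eucl n → ℝ≥0∞} (hg : Measurable g) {s t : ℝ}
    (hs : 0 < s) (ht : 0 < t) (ht1 : t ≤ 1) :
    ∫⁻ x in {x : Eucl n | ‖x‖ ∈ Ioo s (s + t)}, ∫⁻ y in ball x (3 * t), g y ≤
      volume (ball (0 : Eucl n) (3 * t)) * (ENNReal.ofReal √t *
        ((∫⁻ y, g y ^ 2) + sphereArea n univ * ENNReal.ofReal ((s + 1) ^ (n - 1)))) := by
  set S := {x : Eucl n | ‖x‖ ∈ Ioo s (s + t)}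
  have h1 : ∀ x, ∫⁻ y in ball x (3 * t), g y = ∫⁻ z in ball (0 : Eucl n) (3 * t), g (x + z) :=
    fun x => by
      rw [← lintegral_indicator measurableSet_ball, ← lintegral_add_left_eq_self _ x,
        ← lintegral_indicator measurableSet_ball]
      refine lintegral_congr fun z => ?_
      simp [indicator]
  simp_rw [h1]
  rw [lintegral_lintegral_swap (by fun_prop)]
  have h2 : ∀ z, ∫⁻ x in S, g (x + z) ≤ ENNReal.ofReal √t *
      ((∫⁻ y, g y ^ 2) + sphereArea n univ * ENNReal.ofReal ((s + 1) ^ (n - 1))) := fun z => by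
    calc ∫⁻ x in S, g (x + z)
        ≤ ∫⁻ x in S, (ENNReal.ofReal √t * g (x + z) ^ 2 + ENNReal.ofReal (√t)⁻¹) :=
          lintegral_mono fun x => le_weighted_sq_add (ofReal_sqrt_mul_inv ht) _
      _ = ENNReal.ofReal √t * (∫⁻ x in S, g (x + z) ^ 2) + ENNReal.ofReal (√t)⁻¹ * volume S := by
          rw [lintegral_add_right _ measurable_const, lintegral_const_mul _ (by fun_prop),
            setLIntegral_const]
      _ ≤ ENNReal.ofReal √t * (∫⁻ y, g y ^ 2) + ENNReal.ofReal (√t)⁻¹ *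
            (sphereArea n univ * ENNReal.ofReal ((s + 1) ^ (n - 1)) * ENNReal.ofReal t) := by
          refine add_le_add (mul_le_mul' le_rfl ?_) (mul_le_mul' le_rfl ?_)
          · rw [← lintegral_add_right_eq_self (fun y => g y ^ 2) z]
            exact setLIntegral_le_lintegral _ _
          · exact volume_shell_le hs ht1
      _ = _ := by
          have : ENNReal.ofReal t = ENNReal.ofReal √t * ENNReal.ofReal √t := by
            rw [← ENNReal.ofReal_mul (Real.sqrt_nonneg t), Real.mul_self_sqrt ht.le]
          rw [mul_add, this]
          congr 1
          calc _ = ENNReal.ofReal √t * ENNReal.ofReal (√t)⁻¹ * (ENNReal.ofReal √t *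
                (sphereArea n univ * ENNReal.ofReal ((s + 1) ^ (n - 1)))) := by ring
            _ = _ := by rw [ofReal_sqrt_mul_inv ht, one_mul]
  refine (lintegral_mono h2).trans ?_
  rw [setLIntegral_const, mul_comm]

/-- For `s < r < s + t` the point `rθ` is within `t` of `sθ`, so the ball of radius `3t` about the
former contains that of radius `2t` about the latter; integrating over `r` replaces the sphere by a
shell. -/
lemma sphere_lintegral_ball_le {n : ℕ} [NeZero n] {g : Eucl n → ℝ≥0∞} (hg : Measurable g) {s t : ℝ}
    (hs : 0 < s) :
    ENNReal.ofReal (s ^ (n - 1)) * ENNReal.ofReal t *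
        ∫⁻ θ : sphere (0 : Eucl n) 1, (∫⁻ y in ball (s • (θ : Eucl n)) (2 * t), g y) ∂sphereArea n ≤
      ∫⁻ x in {x : Eucl n | ‖x‖ ∈ Ioo s (s + t)}, ∫⁻ y in ball x (3 * t), g y := by
  have hm : MeasurableSet {x : Eucl n | ‖x‖ ∈ Ioo s (s + t)} := measurable_norm measurableSet_Ioo
  have hU : Measurable fun x : Eucl n => ∫⁻ y in ball x (3 * t), g y :=
    (measurable_lintegral_ball hg 3).comp (f := fun x : Eucl n => (x, t)) (by fun_prop)
  have hvol : ENNReal.ofReal t = volume (Ioo s (s + t)) := by rw [Real.volume_Ioo]; ring_nf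
  set I := ∫⁻ θ : sphere (0 : Eucl n) 1, (∫⁻ y in ball (s • (θ : Eucl n)) (2 * t), g y)
    ∂sphereArea n with hI
  calc ENNReal.ofReal (s ^ (n - 1)) * ENNReal.ofReal t * I
      = ∫⁻ r in Ioi (0 : ℝ), indicator (Ioo s (s + t))
          (fun _ => ENNReal.ofReal (s ^ (n - 1)) * I) r := by
        rw [setLIntegral_indicator measurableSet_Ioo,
          inter_eq_self_of_subset_left fun r hr => mem_Ioi.2 (hs.trans hr.1), setLIntegral_const,
          hvol]
        ring
    _ ≤ ∫⁻ r in Ioi (0 : ℝ), ENNReal.ofReal (r ^ (n - 1)) * ∫⁻ θ,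
          indicator {x : Eucl n | ‖x‖ ∈ Ioo s (s + t)} (fun x => ∫⁻ y in ball x (3 * t), g y)
            (r • (θ : Eucl n)) ∂sphereArea n := by
        refine lintegral_mono fun r => ?_
        by_cases hr : r ∈ Ioo s (s + t)
        · have hr0 : 0 < r := hs.trans hr.1
          rw [indicator_of_mem hr, hI]
          refine mul_le_mul' (ENNReal.ofReal_le_ofReal (pow_le_pow_left₀ hs.le hr.1.le _))
            (lintegral_mono fun θ => ?_)
          have hθ : ‖(θ : Eucl n)‖ = 1 := by simp
          have hmem : r • (θ : Eucl n) ∈ {x : Eucl n | ‖x‖ ∈ Ioo s (s + t)} := by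
            rw [mem_ofPred_eq, norm_smul, hθ, Real.norm_of_nonneg hr0.le, mul_one]; exact hr
          rw [indicator_of_mem hmem]
          refine lintegral_mono_set (ball_subset_ball' ?_)
          rw [dist_eq_norm, ← sub_smul, norm_smul, hθ, Real.norm_eq_abs, mul_one,
            abs_of_neg (by linarith [hr.1])]
          linarith [hr.2]
        · rw [indicator_of_notMem hr]; exact bot_le
    _ = _ := by rw [← lintegral_indicator hm, lintegral_polar (hU.indicator hm)]

/-- The constant in the estimate of the mean gradient on a sphere. -/
noncomputable def traceConst {n : ℕ} (G : Eucl n → Eucl n) (s : ℝ) : ℝ≥0∞ :=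
  ENNReal.ofReal ((s ^ (n - 1))⁻¹) * (ENNReal.ofReal (3 ^ n) * volume (ball (0 : Eucl n) 1) *
    ((∫⁻ y, ‖G y‖ₑ ^ 2) + sphereArea n univ * ENNReal.ofReal ((s + 1) ^ (n - 1))))

/-- The powers of `t` are `t^(-n)` from the mean, `t^(-1)` from the passage to a shell, `t^n` from
the volume of the ball and `√t` from the shell estimate. The outcome `t^(-1/2)` is integrable at
`0`, which is why traces exist. -/
lemma lintegral_sphere_gradMean_le {n : ℕ} [NeZero n] {G : Eucl n → Eucl n} (hG : Measurable G)
    {s t : ℝ} (hs : 0 < s) (ht : 0 < t) (ht1 : t ≤ 1) :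
    ∫⁻ θ : sphere (0 : Eucl n) 1, gradMean G (s • (θ : Eucl n)) t ∂sphereArea n ≤
      traceConst G s * ENNReal.ofReal (√t)⁻¹ := by
  have hmu : Measurable fun θ : sphere (0 : Eucl n) 1 =>
      ∫⁻ y in ball (s • (θ : Eucl n)) (2 * t), ‖G y‖ₑ :=
    (measurable_lintegral_ball hG.enorm 2).comp
      (f := fun θ : sphere (0 : Eucl n) 1 => (s • (θ : Eucl n), t)) (by fun_prop)
  simp_rw [gradMean]
  rw [lintegral_const_mul _ hmu]
  set I := ∫⁻ θ : sphere (0 : Eucl n) 1, (∫⁻ y in ball (s • (θ : Eucl n)) (2 * t), ‖G y‖ₑ)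
    ∂sphereArea n
  set K := (∫⁻ y, ‖G y‖ₑ ^ 2) + sphereArea n univ * ENNReal.ofReal ((s + 1) ^ (n - 1)) with hK
  have h := (sphere_lintegral_ball_le hG.enorm hs).trans
    (lintegral_shell_ball_le hG.enorm hs ht ht1)
  rw [Measure.addHaar_ball_of_pos _ _ (by positivity), finrank_euclideanSpace_fin, mul_pow,
    ENNReal.ofReal_mul (by positivity)] at h
  have inv : ∀ a : ℝ, 0 < a → ENNReal.ofReal a⁻¹ * ENNReal.ofReal a = 1 := fun a ha => by
    rw [← ENNReal.ofReal_mul (by positivity), inv_mul_cancel₀ ha.ne', ENNReal.ofReal_one]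
  have hsq : ENNReal.ofReal t⁻¹ * ENNReal.ofReal √t = ENNReal.ofReal (√t)⁻¹ := by
    rw [← ENNReal.ofReal_mul (by positivity)]
    congr 1
    nth_rewrite 1 [← Real.mul_self_sqrt ht.le]
    have := (Real.sqrt_pos.2 ht).ne'
    field_simp
  calc ENNReal.ofReal (t ^ n)⁻¹ * I
      = ENNReal.ofReal (t ^ n)⁻¹ * (ENNReal.ofReal (s ^ (n - 1))⁻¹ * ENNReal.ofReal t⁻¹) *
          (ENNReal.ofReal (s ^ (n - 1)) * ENNReal.ofReal t * I) := by
        have e : ∀ a b b' c c' i : ℝ≥0∞, a * (b' * c') * (b * c * i) =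
          a * i * (b' * b) * (c' * c) := fun a b b' c c' i => by ring
        rw [e, inv _ (by positivity), inv _ ht, mul_one, mul_one]
    _ ≤ ENNReal.ofReal (t ^ n)⁻¹ * (ENNReal.ofReal (s ^ (n - 1))⁻¹ * ENNReal.ofReal t⁻¹) * _ :=
        mul_le_mul' le_rfl h
    _ = _ := by
        have e : ∀ a a' b c d v q k : ℝ≥0∞, a * (b * c) * (d * a' * v * (q * k)) =
          (a * a') * (b * (d * v * k) * (c * q)) := fun a a' b c d v q k => by ring
        rw [e, inv _ (by positivity), one_mul, hsq, traceConst]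

lemma traceConst_ne_top {n : ℕ} {G : Eucl n → Eucl n} (hG : MemLp G 2 volume) (s : ℝ) :
    traceConst G s ≠ ⊤ := by
  have h1 : ∫⁻ y, ‖G y‖ₑ ^ 2 ≠ ⊤ := by
    have := (eLpNorm_lt_top_iff_lintegral_rpow_enorm_lt_top (by norm_num) (by norm_num)).1 hG.2
    simpa using this.ne
  have h2 : volume (ball (0 : Eucl n) 1) ≠ ⊤ := measure_ball_lt_top.ne
  unfold traceConst
  finiteness

/-- The integral over the unit directions of the total mean gradient up to the scale `r`. -/
lemma lintegral_sphere_lintegral_gradMean_le {n : ℕ} [NeZero n] {G : Eucl n → Eucl n}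
    (hG : Measurable G) {s r : ℝ} (hs : 0 < s) (hr : r ≤ 1) :
    ∫⁻ θ : sphere (0 : Eucl n) 1, (∫⁻ t in Ioc 0 r, gradMean G (s • (θ : Eucl n)) t) ∂sphereArea n ≤
      traceConst G s * ∫⁻ t in Ioc 0 r, ENNReal.ofReal (√t)⁻¹ := by
  have hm : Measurable fun p : sphere (0 : Eucl n) 1 × ℝ => gradMean G (s • (p.1 : Eucl n)) p.2 :=
    (measurable_gradMean hG).comp
      (f := fun p : sphere (0 : Eucl n) 1 × ℝ => (s • (p.1 : Eucl n), p.2)) (by fun_prop)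
  rw [lintegral_lintegral_swap hm.aemeasurable, ← lintegral_const_mul _ (by fun_prop)]
  exact setLIntegral_mono' measurableSet_Ioc fun t ht =>
    lintegral_sphere_gradMean_le hG hs ht.1 (ht.2.trans hr)

lemma lintegral_inv_sqrt_ne_top : ∫⁻ t in Ioc (0 : ℝ) 1, ENNReal.ofReal (√t)⁻¹ ≠ ⊤ := by
  have h : IntegrableOn (fun t : ℝ => t ^ (-(1 / 2) : ℝ)) (Ioc 0 1) :=
    (intervalIntegral.intervalIntegrable_rpow' (by norm_num) (a := 0) (b := 1)).1
  have h2 := h.2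
  rw [hasFiniteIntegral_iff_enorm] at h2
  refine ne_of_lt (lt_of_le_of_lt (setLIntegral_mono' measurableSet_Ioc fun t ht => ?_) h2)
  rw [Real.rpow_neg ht.1.le, ← Real.sqrt_eq_rpow, Real.enorm_eq_ofReal (by positivity)]

lemma tendsto_lintegral_Ioc_zero {f : ℝ → ℝ≥0∞} (hf : ∫⁻ t in Ioc (0 : ℝ) 1, f t ≠ ⊤) :
    Tendsto (fun r : ℝ => ∫⁻ t in Ioc 0 r, f t) (𝓝[>] 0) (𝓝 0) := by
  have hv : Tendsto (fun r : ℝ => (volume.restrict (Ioc (0 : ℝ) 1)) (Ioc 0 r)) (𝓝[>] 0) (𝓝 0) := by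
    have h1 : Tendsto (fun r : ℝ => ENNReal.ofReal r) (𝓝[>] 0) (𝓝 0) := by
      have := (ENNReal.continuous_ofReal.tendsto 0).mono_left (nhdsWithin_le_nhds (s := Ioi 0))
      simpa using this
    refine tendsto_of_tendsto_of_tendsto_of_le_of_le tendsto_const_nhds h1 (fun _ => bot_le)
      fun r => ?_
    refine (Measure.restrict_apply_le _ _).trans ?_
    simp
  refine (tendsto_setLIntegral_zero hf hv).congr' ?_
  filter_upwards [Ioc_mem_nhdsGT one_pos] with r hr
  rw [Measure.restrict_restrict measurableSet_Ioc, inter_eq_self_of_subset_left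
    (Ioc_subset_Ioc_right hr.2)]

namespace IsH1WithGradient

variable {n : ℕ} [NeZero n] {φ : Eucl n → ℝ} {G : Eucl n → Eucl n}

/-- The averages at scales below `r₀` differ by at most a multiple of the integral over `(0, r₀]`,
the tail of a convergent integral, so they are Cauchy. -/
lemma tendsto_preciseRep (h : IsH1WithGradient φ G) (hG : Measurable G) {x : Eucl n}
    (hx : ∫⁻ t in Ioc (0 : ℝ) 1, gradMean G x t ≠ ⊤) :
    Tendsto (fun r : ℝ => ⨍ y in ball x r, φ y) (𝓝[>] 0) (𝓝 (preciseRep φ x)) := by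
  have hV : (volume (ball (0 : Eucl n) 1))⁻¹ ≠ ⊤ :=
    ENNReal.inv_ne_top.2 (measure_ball_pos _ _ one_pos).ne'
  have h0 : Tendsto (fun r : ℝ => (volume (ball (0 : Eucl n) 1))⁻¹ *
      ∫⁻ t in Ioc 0 r, gradMean G x t) (𝓝[>] 0) (𝓝 0) := by
    simpa using ENNReal.Tendsto.const_mul (tendsto_lintegral_Ioc_zero hx) (Or.inr hV)
  have hle : ∀ {r₀ r s : ℝ}, 0 < s → s ≤ r → r < r₀ →
      edist (⨍ y in ball x r, φ y) (⨍ y in ball x s, φ y) ≤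
        (volume (ball (0 : Eucl n) 1))⁻¹ * ∫⁻ t in Ioc 0 r₀, gradMean G x t := by
    intro r₀ r s hs hsr hr
    rw [edist_eq_enorm_sub]
    refine (h.enorm_setAverage_sub_le hG x hs hsr).trans (mul_le_mul' le_rfl ?_)
    exact lintegral_mono_set (Ioc_subset_Ioc hs.le hr.le)
  have hc : Cauchy (map (fun r : ℝ => ⨍ y in ball x r, φ y) (𝓝[>] 0)) := by
    refine EMetric.cauchy_iff.2 ⟨NeBot.ne inferInstance, fun ε hε => ?_⟩
    obtain ⟨r₀, hr₀, hr₀0⟩ := ((h0.eventually_lt_const hε).and self_mem_nhdsWithin).exists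
    refine ⟨_, image_mem_map (Ioo_mem_nhdsGT (show (0 : ℝ) < r₀ from hr₀0)), ?_⟩
    rintro _ ⟨r, hr, rfl⟩ _ ⟨s, hs, rfl⟩
    rcases le_total s r with hsr | hrs
    · exact (hle hs.1 hsr hr.2).trans_lt hr₀
    · rw [edist_comm]
      exact (hle hr.1 hrs hs.2).trans_lt hr₀
  obtain ⟨l, hl⟩ := cauchy_map_iff_exists_tendsto.1 hc
  rwa [preciseRep_eq_of_tendsto hl]

theorem ae_tendsto_preciseRep_sphere (h : IsH1WithGradient φ G) (hG : Measurable G) {s : ℝ}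
    (hs : 0 < s) : ∀ᵐ θ : sphere (0 : Eucl n) 1 ∂sphereArea n,
      Tendsto (fun r : ℝ => ⨍ y in ball (s • (θ : Eucl n)) r, φ y) (𝓝[>] 0)
        (𝓝 (preciseRep φ (s • (θ : Eucl n)))) := by
  have hm : Measurable fun p : sphere (0 : Eucl n) 1 × ℝ => gradMean G (s • (p.1 : Eucl n)) p.2 :=
    (measurable_gradMean hG).comp
      (f := fun p : sphere (0 : Eucl n) 1 × ℝ => (s • (p.1 : Eucl n), p.2)) (by fun_prop)
  have hfin : ∫⁻ θ : sphere (0 : Eucl n) 1,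
      (∫⁻ t in Ioc (0 : ℝ) 1, gradMean G (s • (θ : Eucl n)) t) ∂sphereArea n ≠ ⊤ :=
    ne_top_of_le_ne_top (ENNReal.mul_ne_top (traceConst_ne_top h.memLp_grad s)
      lintegral_inv_sqrt_ne_top) (lintegral_sphere_lintegral_gradMean_le hG hs le_rfl)
  filter_upwards [ae_lt_top hm.lintegral_prod_right' hfin] with θ hθ
  exact h.tendsto_preciseRep hG hθ.ne

lemma enorm_setAverage_sub_preciseRep_le (h : IsH1WithGradient φ G) (hG : Measurable G)
    {x : Eucl n} {r : ℝ} (hr : 0 < r)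
    (hx : Tendsto (fun r : ℝ => ⨍ y in ball x r, φ y) (𝓝[>] 0) (𝓝 (preciseRep φ x))) :
    ‖(⨍ y in ball x r, φ y) - preciseRep φ x‖ₑ ≤
      (volume (ball (0 : Eucl n) 1))⁻¹ * ∫⁻ t in Ioc 0 r, gradMean G x t := by
  refine le_of_tendsto (tendsto_const_nhds.sub hx).enorm ?_
  filter_upwards [Ioc_mem_nhdsGT hr] with s hs
  refine (h.enorm_setAverage_sub_le hG x hs.1 hs.2).trans (mul_le_mul' le_rfl ?_)
  exact lintegral_mono_set (Ioc_subset_Ioc hs.1.le le_rfl)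

/-- The averages converge to the trace in `L¹` of the sphere, the error at scale `r` being at most a
constant times `∫_0^r t^(-1/2) dt`. No radius is exceptional, so the result applies on the outer
sphere. -/
theorem tendsto_integral_sphere (h : IsH1WithGradient φ G) (hG : Measurable G) {s : ℝ}
    (hs : 0 < s) :
    Integrable (fun θ : sphere (0 : Eucl n) 1 => preciseRep φ (s • (θ : Eucl n))) (sphereArea n) ∧
    Tendsto (fun r : ℝ => ∫ θ : sphere (0 : Eucl n) 1,
        (⨍ y in ball (s • (θ : Eucl n)) r, φ y) ∂sphereArea n) (𝓝[>] 0)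
      (𝓝 (∫ θ : sphere (0 : Eucl n) 1, preciseRep φ (s • (θ : Eucl n)) ∂sphereArea n)) := by
  have hae := h.ae_tendsto_preciseRep_sphere hG hs
  have hcont : ∀ r : ℝ, Continuous fun θ : sphere (0 : Eucl n) 1 =>
      ⨍ y in ball (s • (θ : Eucl n)) r, φ y := fun r =>
    (continuous_setAverage_ball h.locallyIntegrable r).comp
      (f := fun θ : sphere (0 : Eucl n) 1 => s • (θ : Eucl n)) (by fun_prop)
  have hint : ∀ r : ℝ, Integrable (fun θ : sphere (0 : Eucl n) 1 =>
      ⨍ y in ball (s • (θ : Eucl n)) r, φ y) (sphereArea n) := fun r => by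
    have := (hcont r).continuousOn.integrableOn_compact (μ := sphereArea n) isCompact_univ
    rwa [integrableOn_univ] at this
  have hmeas : AEStronglyMeasurable (fun θ : sphere (0 : Eucl n) 1 =>
      preciseRep φ (s • (θ : Eucl n))) (sphereArea n) :=
    aestronglyMeasurable_of_tendsto_ae (𝓝[>] (0 : ℝ)) (fun r => (hcont r).aestronglyMeasurable) hae
  have hVt : (volume (ball (0 : Eucl n) 1))⁻¹ ≠ ⊤ :=
    ENNReal.inv_ne_top.2 (measure_ball_pos _ _ one_pos).ne'
  have hm : Measurable fun p : sphere (0 : Eucl n) 1 × ℝ => gradMean G (s • (p.1 : Eucl n)) p.2 :=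
    (measurable_gradMean hG).comp
      (f := fun p : sphere (0 : Eucl n) 1 × ℝ => (s • (p.1 : Eucl n), p.2)) (by fun_prop)
  have hbound : ∀ r : ℝ, 0 < r → r ≤ 1 →
      ∫⁻ θ : sphere (0 : Eucl n) 1,
        ‖(⨍ y in ball (s • (θ : Eucl n)) r, φ y) - preciseRep φ (s • (θ : Eucl n))‖ₑ
        ∂sphereArea n ≤ (volume (ball (0 : Eucl n) 1))⁻¹ * traceConst G s *
          ∫⁻ t in Ioc 0 r, ENNReal.ofReal (√t)⁻¹ := fun r hr hr1 => by
    refine (lintegral_mono_ae (hae.mono fun θ hθ =>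
      h.enorm_setAverage_sub_preciseRep_le hG hr hθ)).trans ?_
    rw [lintegral_const_mul _ hm.lintegral_prod_right', mul_assoc]
    exact mul_le_mul' le_rfl (lintegral_sphere_lintegral_gradMean_le hG hs hr1)
  have hKt : (volume (ball (0 : Eucl n) 1))⁻¹ * traceConst G s ≠ ⊤ :=
    ENNReal.mul_ne_top hVt (traceConst_ne_top h.memLp_grad s)
  have hfi : Integrable (fun θ : sphere (0 : Eucl n) 1 => preciseRep φ (s • (θ : Eucl n)))
      (sphereArea n) := by
    have h1 : Integrable (fun θ : sphere (0 : Eucl n) 1 =>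
        (⨍ y in ball (s • (θ : Eucl n)) 1, φ y) - preciseRep φ (s • (θ : Eucl n)))
        (sphereArea n) := by
      refine ⟨(hcont 1).aestronglyMeasurable.sub hmeas, ?_⟩
      rw [hasFiniteIntegral_iff_enorm]
      exact (hbound 1 one_pos le_rfl).trans_lt
        (ENNReal.mul_lt_top hKt.lt_top lintegral_inv_sqrt_ne_top.lt_top)
    refine ((hint 1).sub h1).congr (.of_forall fun θ => ?_)
    simp
  refine ⟨hfi, tendsto_integral_of_L1 _ hfi.aestronglyMeasurable (.of_forall hint) ?_⟩
  have h0 : Tendsto (fun r : ℝ => (volume (ball (0 : Eucl n) 1))⁻¹ * traceConst G s *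
      ∫⁻ t in Ioc 0 r, ENNReal.ofReal (√t)⁻¹) (𝓝[>] 0) (𝓝 0) := by
    simpa using ENNReal.Tendsto.const_mul (tendsto_lintegral_Ioc_zero lintegral_inv_sqrt_ne_top)
      (Or.inr hKt)
  refine tendsto_of_tendsto_of_tendsto_of_le_of_le' tendsto_const_nhds h0
    (.of_forall fun _ => bot_le) ?_
  filter_upwards [Ioc_mem_nhdsGT one_pos] with r hr
  exact hbound r hr.1 hr.2

end IsH1WithGradient

/-! ### The flux field and the lower bound -/

/-- The harmonic radial field `x / |x|ⁿ` restricted to the shell `s < |x| < ρ`. -/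
noncomputable def shellField {n : ℕ} (s ρ : ℝ) : Eucl n → Eucl n :=
  indicator {x | ‖x‖ ∈ Ioo s ρ} fun x => (‖x‖ ^ n)⁻¹ • x

section ShellField

variable {n : ℕ} {s ρ : ℝ}

lemma measurable_shellField : Measurable (shellField (n := n) s ρ) :=
  Measurable.indicator (by fun_prop) (measurable_norm measurableSet_Ioo)

lemma shellField_of_mem {x : Eucl n} (hx : ‖x‖ ∈ Ioo s ρ) :
    shellField s ρ x = (‖x‖ ^ n)⁻¹ • x :=
  indicator_of_mem (s := {x : Eucl n | ‖x‖ ∈ Ioo s ρ}) hx _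

lemma shellField_of_notMem {x : Eucl n} (hx : ‖x‖ ∉ Ioo s ρ) : shellField s ρ x = 0 :=
  indicator_of_notMem (s := {x : Eucl n | ‖x‖ ∈ Ioo s ρ}) hx _

lemma norm_shellField [NeZero n] (hs : 0 ≤ s) (x : Eucl n) :
    ‖shellField s ρ x‖ = indicator (Ioo s ρ) (fun r => (r ^ (n - 1))⁻¹) ‖x‖ := by
  by_cases hx : ‖x‖ ∈ Ioo s ρ
  · have hx0 : 0 < ‖x‖ := hs.trans_lt hx.1
    rw [shellField_of_mem hx, indicator_of_mem hx, norm_smul, norm_inv, norm_pow, norm_norm]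
    rw [← pow_sub_one_mul (NeZero.ne n) ‖x‖]
    field_simp
  · rw [shellField_of_notMem hx, indicator_of_notMem hx, norm_zero]

lemma norm_shellField_le [NeZero n] (hs : 0 < s) (x : Eucl n) :
    ‖shellField s ρ x‖ ≤ (s ^ (n - 1))⁻¹ := by
  rw [norm_shellField hs.le]
  refine indicator_apply_le' (fun hx => ?_) fun _ => by positivity
  have := hx.1.le
  gcongr

lemma shellField_eq_zero {x : Eucl n} (hx : ρ ≤ ‖x‖) : shellField s ρ x = 0 :=
  shellField_of_notMem fun h => absurd h.2 (not_lt.2 hx)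

lemma ae_continuousAt_shellField [NeZero n] : ∀ᵐ x, ContinuousAt (shellField (n := n) s ρ) x := by
  filter_upwards [ae_norm_notMem (n := n) (S := {s, ρ}) (by simp)] with x hx
  obtain ⟨hx0, hx⟩ := hx
  simp only [mem_insert_iff, mem_singleton_iff, not_or] at hx
  by_cases h : ‖x‖ ∈ Ioo s ρ
  · have hc : ContinuousAt (fun x : Eucl n => (‖x‖ ^ n)⁻¹ • x) x :=
      ((continuous_norm.pow n).continuousAt.inv₀ (by simpa using fun h => absurd h hx0)).smul
        continuousAt_id
    refine hc.congr ?_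
    filter_upwards [(isOpen_Ioo.preimage continuous_norm).mem_nhds h] with y hy
    exact (shellField_of_mem hy).symm
  · have h' : x ∈ (norm ⁻¹' Icc s ρ : Set (Eucl n))ᶜ := fun h' => h
      ⟨lt_of_le_of_ne h'.1 (Ne.symm hx.1), lt_of_le_of_ne h'.2 hx.2⟩
    refine (continuousAt_const (y := (0 : Eucl n))).congr ?_
    filter_upwards [(isClosed_Icc.preimage continuous_norm).isOpen_compl.mem_nhds h'] with y hy
    exact (shellField_of_notMem fun h => hy (Ioo_subset_Icc_self h)).symm

lemma integrable_norm_shellField_sq [NeZero n] (hs : 0 < s) :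
    Integrable fun x : Eucl n => ‖shellField s ρ x‖ ^ 2 := by
  have h : (fun x : Eucl n => ‖shellField s ρ x‖ ^ 2) =
      indicator (ball 0 ρ) fun x => ‖shellField s ρ x‖ ^ 2 := by
    refine (indicator_eq_self.2 fun x hx => ?_).symm
    by_contra h
    exact hx (by simp [shellField_eq_zero (by simpa using h : ρ ≤ ‖x‖)])
  rw [h, integrable_indicator_iff measurableSet_ball]
  refine Measure.integrableOn_of_bounded measure_ball_lt_top.ne
    (measurable_shellField.norm.pow_const 2).aestronglyMeasurable (M := ((s ^ (n - 1))⁻¹) ^ 2)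
    (.of_forall fun x => ?_)
  rw [norm_pow, norm_norm]
  exact pow_le_pow_left₀ (norm_nonneg _) (norm_shellField_le hs x) 2

lemma integral_norm_shellField_sq [NeZero n] (hs : 0 < s) (hsρ : s ≤ ρ) :
    ∫ x : Eucl n, ‖shellField s ρ x‖ ^ 2 =
      (sphereArea n).real univ * ∫ r in s..ρ, (r ^ (n - 1))⁻¹ := by
  rw [integral_polar_symm (integrable_norm_shellField_sq hs), intervalIntegral.integral_of_le hsρ,
    integral_Ioc_eq_integral_Ioo, ← integral_const_mul, ← inter_eq_self_of_subset_right
      (fun r hr => mem_Ioi.2 (hs.trans hr.1) : Ioo s ρ ⊆ Ioi 0),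
    ← setIntegral_indicator measurableSet_Ioo]
  refine setIntegral_congr_fun measurableSet_Ioi fun r hr => ?_
  have hr0 : 0 < r := hr
  simp only [norm_shellField hs.le, norm_smul, Real.norm_of_nonneg hr0.le,
    norm_eq_of_mem_sphere, mul_one, integral_const, smul_eq_mul]
  by_cases hr' : r ∈ Ioo s ρ
  · rw [indicator_of_mem hr', indicator_of_mem hr']
    field_simp
  · rw [indicator_of_notMem hr', indicator_of_notMem hr']
    simp

end ShellField

namespace IsH1WithGradient

variable {n : ℕ} [NeZero n] {φ : Eucl n → ℝ} {G : Eucl n → Eucl n}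

/-- The increment along each ray is the integral of the radial component of the averaged gradient.
On the ray `x/|x|^n` has length `r^(1-n)`, cancelling the Jacobian `r^(n-1)`, so the integral over
all rays is a volume integral. -/
lemma integral_sphere_setAverage_sub (h : IsH1WithGradient φ G) {s ρ r : ℝ} (hs : 0 < s)
    (hsρ : s ≤ ρ) (hr : 0 < r) :
    (∫ θ : sphere (0 : Eucl n) 1, (⨍ y in ball (ρ • (θ : Eucl n)) r, φ y) ∂sphereArea n) -
      ∫ θ : sphere (0 : Eucl n) 1, (⨍ y in ball (s • (θ : Eucl n)) r, φ y) ∂sphereArea n =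
    ∫ x, inner ℝ (⨍ y in ball x r, G y) (shellField s ρ x) := by
  have hcG := continuous_setAverage_ball h.locallyIntegrable_grad r
  have hint : ∀ t : ℝ, Integrable (fun θ : sphere (0 : Eucl n) 1 =>
      ⨍ y in ball (t • (θ : Eucl n)) r, φ y) (sphereArea n) := fun t => by
    have hc : Continuous fun θ : sphere (0 : Eucl n) 1 => ⨍ y in ball (t • (θ : Eucl n)) r, φ y :=
      (continuous_setAverage_ball h.locallyIntegrable r).comp
        (f := fun θ : sphere (0 : Eucl n) 1 => t • (θ : Eucl n)) (by fun_prop)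
    have := hc.continuousOn.integrableOn_compact (μ := sphereArea n) isCompact_univ
    rwa [integrableOn_univ] at this
  have hfi : Integrable fun x => inner ℝ (⨍ y in ball x r, G y) (shellField s ρ x) := by
    have h1 : Integrable (indicator (ball (0 : Eucl n) ρ) fun x => ‖⨍ y in ball x r, G y‖ *
        (s ^ (n - 1))⁻¹) := by
      rw [integrable_indicator_iff measurableSet_ball]
      exact (hcG.norm.mul continuous_const).locallyIntegrable.integrableOn_ball _ _
    refine h1.mono (hcG.aestronglyMeasurable.inner
      measurable_shellField.aestronglyMeasurable) (.of_forall fun x => ?_)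
    by_cases hx : x ∈ ball 0 ρ
    · rw [indicator_of_mem hx, norm_mul, norm_norm]
      refine (norm_inner_le_norm _ _).trans ?_
      gcongr
      exact (norm_shellField_le hs x).trans (le_abs_self _)
    · rw [indicator_of_notMem hx, shellField_eq_zero (by simpa using hx)]
      simp
  rw [← integral_sub (hint ρ) (hint s), integral_polar hfi]
  refine integral_congr_ae (.of_forall fun θ => ?_)
  have hθ : ‖(θ : Eucl n)‖ = 1 := by simp
  have := h.setAverage_ball_sub hr 0 (θ : Eucl n) s ρ
  simp only [zero_add] at this
  simp only [this]
  rw [intervalIntegral.integral_of_le hsρ, integral_Ioc_eq_integral_Ioo,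
    ← inter_eq_self_of_subset_right (fun r hr => mem_Ioi.2 (hs.trans hr.1) : Ioo s ρ ⊆ Ioi 0),
    ← setIntegral_indicator measurableSet_Ioo]
  refine setIntegral_congr_fun measurableSet_Ioi fun t ht => ?_
  have ht0 : 0 < t := ht
  have hn : ‖t • (θ : Eucl n)‖ = t := by
    rw [norm_smul, hθ, Real.norm_of_nonneg ht0.le, mul_one]
  by_cases ht' : t ∈ Ioo s ρ
  · rw [indicator_of_mem ht']
    rw [shellField_of_mem (by rwa [hn]), hn, inner_smul_right, inner_smul_right]
    have e : t ^ (n - 1) * ((t ^ n)⁻¹ * t) = 1 := by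
      rw [← pow_sub_one_mul (NeZero.ne n) t]
      field_simp
    rw [← mul_assoc, ← mul_assoc, mul_assoc (t ^ (n - 1)), e, one_mul]
  · rw [indicator_of_notMem ht']
    rw [shellField_of_notMem (by rwa [hn]), inner_zero_right, mul_zero]

/-- The Gauss–Green formula on a shell for the traces of a Sobolev function. -/
theorem integral_sphere_preciseRep_sub (h : IsH1WithGradient φ G) (hG : Measurable G) {s ρ : ℝ}
    (hs : 0 < s) (hsρ : s ≤ ρ) :
    (∫ θ : sphere (0 : Eucl n) 1, preciseRep φ (ρ • (θ : Eucl n)) ∂sphereArea n) -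
      ∫ θ : sphere (0 : Eucl n) 1, preciseRep φ (s • (θ : Eucl n)) ∂sphereArea n =
    ∫ x, inner ℝ (G x) (shellField s ρ x) := by
  have h1 := (h.tendsto_integral_sphere hG (hs.trans_le hsρ)).2.sub
    (h.tendsto_integral_sphere hG hs).2
  have h2 := tendsto_integral_inner_setAverage_ball h.locallyIntegrable_grad
    (w := shellField s ρ) measurable_shellField.aestronglyMeasurable (norm_shellField_le hs)
    (fun x hx => shellField_eq_zero hx) ae_continuousAt_shellField
  refine tendsto_nhds_unique (h1.congr' ?_) h2
  filter_upwards [self_mem_nhdsWithin] with r hr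
  exact h.integral_sphere_setAverage_sub hs hsρ hr

end IsH1WithGradient

/-! ### The obstacle condition and the calibration inequality -/

lemma volume_le_capacity {n : ℕ} (A : Set (Eucl n)) : volume A ≤ capacity A := by
  refine le_sInf ?_
  rintro c ⟨φ, G, U, -, hU, hAU, hφ, rfl⟩
  calc volume A ≤ volume U := measure_mono hAU
    _ = ∫⁻ x, indicator U 1 x := (lintegral_indicator_one hU.measurableSet).symm
    _ ≤ ∫⁻ x, ‖φ x‖ₑ ^ 2 := by
        refine lintegral_mono_ae ?_
        filter_upwards [hφ] with x hx
        by_cases hxU : x ∈ U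
        · rw [indicator_of_mem hxU, ← ofReal_norm, ← ENNReal.ofReal_pow (norm_nonneg _)]
          refine ENNReal.one_le_ofReal.2 (one_le_pow₀ ((hx hxU).trans (le_abs_self _)))
        · rw [indicator_of_notMem hxU]; exact bot_le
    _ ≤ _ := le_self_add

/-- Zero capacity is used only through zero volume, and Fubini in polar coordinates then gives
almost every radius below `R`. The sphere of radius `R` itself is reached later by a limit. -/
lemma GeOneOn.ae_sphere {n : ℕ} [NeZero n] {φ : Eucl n → ℝ} {R : ℝ}
    (h : GeOneOn φ (closedBall 0 R)) :
    ∀ᵐ s : ℝ, s ∈ Ioo 0 R → ∀ᵐ θ : sphere (0 : Eucl n) 1 ∂sphereArea n,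
      1 ≤ preciseRep φ (s • (θ : Eucl n)) := by
  have h0 : volume {x ∈ closedBall (0 : Eucl n) R | preciseRep φ x < 1} = 0 :=
    le_antisymm ((volume_le_capacity _).trans h.le) bot_le
  have h1 : ∀ᵐ x : Eucl n, x ∈ closedBall (0 : Eucl n) R → 1 ≤ preciseRep φ x := by
    rw [measure_eq_zero_iff_ae_notMem] at h0
    filter_upwards [h0] with x hx hxR
    by_contra h'
    exact hx ⟨hxR, not_le.1 h'⟩
  have h2 := Measure.ae_ae_of_ae_prod <| (Measure.measurePreserving_swap
    (μ := radialMeasure n) (ν := sphereArea n)).quasiMeasurePreserving.ae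
      ((measurePreserving_polar n).quasiMeasurePreserving.ae h1)
  rw [radialMeasure, ae_withDensity_iff (by fun_prop), ae_restrict_iff' measurableSet_Ioi] at h2
  filter_upwards [h2] with s hs hsR
  have hs0 : 0 < s := hsR.1
  filter_upwards [hs hs0 (by simpa using pow_pos hs0 _)] with θ hθ
  refine hθ ?_
  simp [norm_smul, abs_of_pos hs0, hsR.2.le]

lemma IsH1WithGradient.exists_measurable {n : ℕ} {φ : Eucl n → ℝ} {G : Eucl n → Eucl n}
    (h : IsH1WithGradient φ G) :
    ∃ G' : Eucl n → Eucl n, Measurable G' ∧ G =ᵐ[volume] G' ∧ IsH1WithGradient φ G' := by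
  refine ⟨h.memLp_grad.1.mk G, h.memLp_grad.1.stronglyMeasurable_mk.measurable,
    h.memLp_grad.1.ae_eq_mk, h.memLp, h.memLp_grad.ae_eq h.memLp_grad.1.ae_eq_mk,
    fun ψ hψ hψc v => ?_⟩
  rw [h.integral_by_parts ψ hψ hψc v]
  congr 1
  refine integral_congr_ae ?_
  filter_upwards [h.memLp_grad.1.ae_eq_mk] with x hx
  rw [← hx]

lemma ofReal_integral_le_lintegral {α : Type*} [MeasurableSpace α] {μ : Measure α} {f : α → ℝ}
    {g : α → ℝ≥0∞} (hf : Integrable f μ) (h : ∀ x, ENNReal.ofReal (f x) ≤ g x) :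
    ENNReal.ofReal (∫ x, f x ∂μ) ≤ ∫⁻ x, g x ∂μ := by
  rw [integral_eq_lintegral_pos_part_sub_lintegral_neg_part hf]
  refine (ENNReal.ofReal_le_ofReal (sub_le_self _ ENNReal.toReal_nonneg)).trans ?_
  exact ENNReal.ofReal_toReal_le.trans (lintegral_mono h)

/-- The map `θ ↦ ρ • θ` is a measurable embedding, so `f` may be arbitrary and measurability of
`preciseRep φ` is not at issue. -/
lemma setLIntegral_sphere {n : ℕ} [NeZero n] {ρ : ℝ} (hρ : 0 < ρ) (f : Eucl n → ℝ≥0∞) :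
    ∫⁻ x in sphere (0 : Eucl n) ρ, f x ∂μHE[n - 1] =
      ENNReal.ofReal (ρ ^ (n - 1)) *
        ∫⁻ θ : sphere (0 : Eucl n) 1, f (ρ • (θ : Eucl n)) ∂sphereArea n := by
  have he : MeasurableEmbedding fun θ : sphere (0 : Eucl n) 1 => ρ • (θ : Eucl n) :=
    (Homeomorph.smulOfNeZero ρ hρ.ne').measurableEmbedding.comp
      (MeasurableEmbedding.subtype_coe isClosed_sphere.measurableSet)
  rw [euclideanHausdorffMeasure_restrict_sphere n hρ, sphereSurface, lintegral_smul_measure,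
    he.lintegral_map, smul_eq_mul]

lemma energy_ball {n : ℕ} [NeZero n] {β ρ : ℝ} (hρ : 0 < ρ) (φ : Eucl n → ℝ)
    (G : Eucl n → Eucl n) :
    energy β (ball 0 ρ) φ G = (∫⁻ x in ball 0 ρ, ‖G x‖ₑ ^ 2) + ENNReal.ofReal β *
      (ENNReal.ofReal (ρ ^ (n - 1)) *
        ∫⁻ θ : sphere (0 : Eucl n) 1, ‖preciseRep φ (ρ • (θ : Eucl n))‖ₑ ^ 2 ∂sphereArea n) := by
  rw [energy, reducedBoundary_ball n hρ, setLIntegral_sphere hρ fun x => ‖preciseRep φ x‖ₑ ^ 2]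

lemma ofReal_le_enorm_sq {E : Type*} [NormedAddCommGroup E] {a : ℝ} {v : E} (h : a ≤ ‖v‖ ^ 2) :
    ENNReal.ofReal a ≤ ‖v‖ₑ ^ 2 := by
  rw [← ofReal_norm, ← ENNReal.ofReal_pow (norm_nonneg _)]
  exact ENNReal.ofReal_le_ofReal h

/-- This is `‖v + κ w‖² ≥ 0`, with equality for `v = -κ w`, the gradient of the radial solution in
the layer when `w` is the shell field. -/
lemma neg_inner_sub_le {E : Type*} [NormedAddCommGroup E] [InnerProductSpace ℝ E] (κ : ℝ)
    (v w : E) : -(2 * κ) * inner ℝ v w - κ ^ 2 * ‖w‖ ^ 2 ≤ ‖v‖ ^ 2 := by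
  have h := norm_add_sq_real v (κ • w)
  rw [inner_smul_right, norm_smul, mul_pow, Real.norm_eq_abs, sq_abs] at h
  nlinarith [sq_nonneg ‖v + κ • w‖]

namespace IsH1WithGradient

variable {n : ℕ} [NeZero n] {φ : Eucl n → ℝ} {G : Eucl n → Eucl n} {s ρ : ℝ}

lemma integrable_inner_shellField (h : IsH1WithGradient φ G) (hs : 0 < s) :
    Integrable fun x => inner ℝ (G x) (shellField s ρ x) := by
  have hG := (memLp_two_iff_integrable_sq_norm h.memLp_grad.1).1 h.memLp_grad
  refine (hG.add (integrable_norm_shellField_sq (ρ := ρ) hs)).mono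
    (h.memLp_grad.1.inner measurable_shellField.aestronglyMeasurable) (.of_forall fun x => ?_)
  refine (norm_inner_le_norm _ _).trans (le_trans ?_ (le_abs_self _))
  simp only [Pi.add_apply]
  nlinarith [sq_nonneg (‖G x‖ - ‖shellField s ρ x‖), sq_nonneg ‖G x‖,
    sq_nonneg ‖shellField s ρ x‖]

lemma ofReal_shellField_le (h : IsH1WithGradient φ G) (hs : 0 < s) (hsρ : s ≤ ρ) (κ : ℝ) :
    ENNReal.ofReal (-(2 * κ) * (∫ x, inner ℝ (G x) (shellField s ρ x)) -
      κ ^ 2 * ((sphereArea n).real univ * ∫ r in s..ρ, (r ^ (n - 1))⁻¹)) ≤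
    ∫⁻ x in ball 0 ρ, ‖G x‖ₑ ^ 2 := by
  have h1 := (h.integrable_inner_shellField (ρ := ρ) hs).const_mul (-(2 * κ))
  have h2 := (integrable_norm_shellField_sq (n := n) (ρ := ρ) hs).const_mul (κ ^ 2)
  rw [← integral_norm_shellField_sq hs hsρ, ← integral_const_mul, ← integral_const_mul,
    ← integral_sub h1 h2, ← lintegral_indicator measurableSet_ball]
  refine ofReal_integral_le_lintegral (h1.sub h2) fun x => ?_
  by_cases hx : x ∈ ball 0 ρ
  · rw [indicator_of_mem hx]
    exact ofReal_le_enorm_sq (neg_inner_sub_le κ _ _)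
  · rw [shellField_eq_zero (by simpa using hx)]
    simp

lemma ofReal_sphere_le (h : IsH1WithGradient φ G) (hG : Measurable G) (hρ : 0 < ρ) {b : ℝ}
    (hb : 0 ≤ b) (t : ℝ) :
    ENNReal.ofReal (b * (2 * t * (∫ θ : sphere (0 : Eucl n) 1,
      preciseRep φ (ρ • (θ : Eucl n)) ∂sphereArea n) - t ^ 2 * (sphereArea n).real univ)) ≤
    ENNReal.ofReal b *
      ∫⁻ θ : sphere (0 : Eucl n) 1, ‖preciseRep φ (ρ • (θ : Eucl n))‖ₑ ^ 2 ∂sphereArea n := by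
  have h1 := (h.tendsto_integral_sphere hG hρ).1.const_mul (2 * t)
  have h2 : Integrable (fun _ : sphere (0 : Eucl n) 1 => t ^ 2) (sphereArea n) :=
    integrable_const _
  have e : ∫ _ : sphere (0 : Eucl n) 1, t ^ 2 ∂sphereArea n = t ^ 2 * (sphereArea n).real univ := by
    rw [integral_const, smul_eq_mul, mul_comm]
  rw [ENNReal.ofReal_mul hb, ← integral_const_mul, ← e, ← integral_sub h1 h2]
  refine mul_le_mul' le_rfl (ofReal_integral_le_lintegral (h1.sub h2) fun θ => ?_)
  refine ofReal_le_enorm_sq ?_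
  rw [Real.norm_eq_abs, sq_abs]
  nlinarith [sq_nonneg (preciseRep φ (ρ • (θ : Eucl n)) - t)]

end IsH1WithGradient

lemma tendsto_integral_inv_pow {R ρ : ℝ} (hR : 0 < R) (hρ : 0 < ρ) (d : ℕ) :
    Tendsto (fun s : ℝ => ∫ r in s..ρ, (r ^ d)⁻¹) (𝓝[<] R) (𝓝 (∫ r in R..ρ, (r ^ d)⁻¹)) := by
  have hc : ContinuousAt (fun r : ℝ => (r ^ d)⁻¹) R :=
    ContinuousAt.inv₀ (by fun_prop) (by positivity)
  have hd := intervalIntegral.integral_hasDerivAt_left (intervalIntegrable_inv_pow hR hρ d)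
    (StronglyMeasurable.stronglyMeasurableAtFilter
      (by fun_prop : Measurable fun r : ℝ => (r ^ d)⁻¹).stronglyMeasurable) hc
  exact hd.continuousAt.tendsto.mono_left nhdsWithin_le_nhds

lemma frequently_nhdsLT_of_ae {R : ℝ} (hR : 0 < R) {p : ℝ → Prop}
    (h : ∀ᵐ s : ℝ, s ∈ Ioo 0 R → p s) : ∃ᶠ s in 𝓝[<] R, 0 < s ∧ s < R ∧ p s := by
  intro hn
  obtain ⟨a, ha, hn⟩ := (mem_nhdsLT_iff_exists_Ioo_subset).1 hn
  have hlt : max a 0 < R := max_lt ha hR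
  have h0 : volume (Ioo (max a 0) R) = 0 := by
    refine measure_mono_null (fun s hs => ?_) (ae_iff.1 h)
    have hs0 : 0 < s := (le_max_right _ _).trans_lt hs.1
    exact fun hp => hn ⟨(le_max_left _ _).trans_lt hs.1, hs.2⟩ ⟨hs0, hs.2, hp ⟨hs0, hs.2⟩⟩
  rw [Real.volume_Ioo, ENNReal.ofReal_eq_zero] at h0
  linarith

/-- Let `P` and `Q` be the integrals of the traces on the spheres of radius `ρ` and `s`. The bulk is
at least `-2κ(P - Q) - κ² c J(s)` and the surface term at least `2κP - κ² c / b`. In the sum `P`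
cancels, and `Q ≥ c` leaves `κ c (2 - κ (J(s) + 1/b))`, which tends to `κ c` as `s → R`. -/
theorem le_energy_ball {n : ℕ} [NeZero n] {β R ρ : ℝ} (hβ : 0 < β) (hR : 0 < R) (hRρ : R < ρ)
    {φ : Eucl n → ℝ} {G : Eucl n → Eucl n} (h : IsH1WithGradient φ G)
    (hφ : GeOneOn φ (closedBall 0 R)) :
    ENNReal.ofReal ((sphereArea n).real univ / resistance n β R ρ) ≤
      energy β (ball 0 ρ) φ G := by
  have hρ : 0 < ρ := hR.trans hRρ
  obtain ⟨G', hG', hGG', h'⟩ := h.exists_measurable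
  have hE : energy β (ball 0 ρ) φ G = energy β (ball 0 ρ) φ G' := by
    rw [energy, energy]
    congr 1
    refine lintegral_congr_ae (ae_restrict_of_ae ?_)
    filter_upwards [hGG'] with x hx
    rw [hx]
  have hΛ := resistance_pos (n := n) hβ hR hRρ.le
  set c := (sphereArea n).real univ with hc
  set κ := (resistance n β R ρ)⁻¹ with hκ
  have hκ0 : 0 < κ := inv_pos.2 hΛ
  set b := β * ρ ^ (n - 1) with hb
  have hb0 : 0 < b := by positivity
  set J : ℝ → ℝ := fun s => ∫ r in s..ρ, (r ^ (n - 1))⁻¹ with hJ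
  have key : ∀ s, 0 < s → s < R →
      (∀ᵐ θ : sphere (0 : Eucl n) 1 ∂sphereArea n, 1 ≤ preciseRep φ (s • (θ : Eucl n))) →
      ENNReal.ofReal (κ * c * (2 - κ * (J s + b⁻¹))) ≤ energy β (ball 0 ρ) φ G := by
    intro s hs hsR hge
    have hsρ : s ≤ ρ := (hsR.trans hRρ).le
    have h1 : c ≤ ∫ θ : sphere (0 : Eucl n) 1, preciseRep φ (s • (θ : Eucl n)) ∂sphereArea n := by
      have := integral_mono_ae (integrable_const (1 : ℝ)) (h'.tendsto_integral_sphere hG' hs).1 hge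
      rwa [integral_const, smul_eq_mul, mul_one] at this
    have h2 := h'.integral_sphere_preciseRep_sub hG' hs hsρ
    have h3 := h'.ofReal_shellField_le hs hsρ κ
    -- The tangent point `κ / b` is the boundary value of the radial solution; it is the choice for
    -- which the terms in `P` cancel.
    have h4 := h'.ofReal_sphere_le hG' hρ hb0.le (κ * b⁻¹)
    rw [hE, energy_ball hρ, ← mul_assoc, ← ENNReal.ofReal_mul hβ.le]
    refine le_trans ?_ (add_le_add h3 h4)
    -- Subadditivity of `ENNReal.ofReal` needs no signs, and one of the two lower bounds may be
    -- negative.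
    refine le_trans (ENNReal.ofReal_le_ofReal ?_) ENNReal.ofReal_add_le
    set P := ∫ θ : sphere (0 : Eucl n) 1, preciseRep φ (ρ • (θ : Eucl n)) ∂sphereArea n
    set Q := ∫ θ : sphere (0 : Eucl n) 1, preciseRep φ (s • (θ : Eucl n)) ∂sphereArea n
    rw [← h2]
    have e : b * (2 * (κ * b⁻¹) * P - (κ * b⁻¹) ^ 2 * c) = 2 * κ * P - κ ^ 2 * b⁻¹ * c := by
      field_simp
    rw [e]
    nlinarith [mul_le_mul_of_nonneg_left h1 hκ0.le]
  have hlim : Tendsto (fun s => ENNReal.ofReal (κ * c * (2 - κ * (J s + b⁻¹)))) (𝓝[<] R)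
      (𝓝 (ENNReal.ofReal (κ * c * (2 - κ * (J R + b⁻¹))))) :=
    ENNReal.tendsto_ofReal ((((tendsto_integral_inv_pow hR hρ (n - 1)).add_const _).const_mul
      _).const_sub _ |>.const_mul _)
  have hfin : κ * c * (2 - κ * (J R + b⁻¹)) = c / resistance n β R ρ := by
    have : κ * (J R + b⁻¹) = 1 := inv_mul_cancel₀ hΛ.ne'
    rw [this, hκ, div_eq_mul_inv]
    ring
  rw [← hfin]
  -- The estimate is available only for almost every `s`, but such radii accumulate at `R`, and this
  -- suffices for the limit.
  exact le_of_tendsto_of_frequently hlim ((frequently_nhdsLT_of_ae hR hφ.ae_sphere).mono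
    fun s hs => key s hs.1 hs.2.1 hs.2.2)

theorem dispersion_ball {n : ℕ} [NeZero n] {β R ρ : ℝ} (hβ : 0 < β) (hR : 0 < R) (hRρ : R < ρ) :
    dispersion β (closedBall (0 : Eucl n) R) (ball 0 ρ) =
      ENNReal.ofReal ((sphereArea n).real univ / resistance n β R ρ) := by
  refine (dispersion_ball_le hβ hR hRρ).antisymm (le_sInf ?_)
  rintro e ⟨φ, G, h, hφ, rfl⟩
  exact le_energy_ball hβ hR hRρ h hφ

/-! ### Monotonicity of the resistance -/

/-- A thicker layer adds conductive resistance at the rate `ρ^(1-n)`, while the larger surface loses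
exchange resistance at the rate `(n-1) / (β ρ^n)`; the two balance at the critical radius `(n-1)/β`.
-/
lemma hasDerivAt_resistance {n : ℕ} (hn : 1 ≤ n) {β R ρ : ℝ} (hβ : 0 < β) (hR : 0 < R)
    (hρ : 0 < ρ) :
    HasDerivAt (resistance n β R) ((ρ ^ n)⁻¹ * (ρ - ((n : ℝ) - 1) / β)) ρ := by
  obtain ⟨d, rfl⟩ := Nat.exists_eq_add_of_le' hn
  have hc : ContinuousAt (fun r : ℝ => (r ^ d)⁻¹) ρ :=
    ContinuousAt.inv₀ (by fun_prop) (by positivity)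
  have h1 := intervalIntegral.integral_hasDerivAt_right (intervalIntegrable_inv_pow hR hρ d)
    (StronglyMeasurable.stronglyMeasurableAtFilter
      (by fun_prop : Measurable fun r : ℝ => (r ^ d)⁻¹).stronglyMeasurable) hc
  have h2 := ((hasDerivAt_pow d ρ).const_mul β).inv (by positivity)
  refine (h1.add h2).congr_deriv ?_
  -- For `d = 0` the truncated exponent `d - 1` is harmless, since the factor `d` vanishes.
  have e : (d : ℝ) * ρ ^ (d - 1) * ρ = d * ρ ^ d := by
    rcases d.eq_zero_or_pos with rfl | hd
    · simp
    · rw [mul_assoc, pow_sub_one_mul hd.ne']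
  have e' : (d : ℝ) * ρ ^ (d - 1) = d * ρ ^ d / ρ := by rw [← e]; field_simp
  rw [e']
  push_cast
  field_simp
  ring

lemma continuousOn_resistance {n : ℕ} (hn : 1 ≤ n) {β R : ℝ} (hβ : 0 < β) (hR : 0 < R) :
    ContinuousOn (resistance n β R) (Ioi 0) := fun _ hρ =>
  (hasDerivAt_resistance hn hβ hR hρ).continuousAt.continuousWithinAt

/-- A positive derivative in the interior suffices, so `a` may be the critical radius itself, where
the derivative vanishes. This is what allows the closed endpoint in part (b). -/
lemma strictMonoOn_resistance {n : ℕ} (hn : 1 ≤ n) {β R a : ℝ} (hβ : 0 < β) (hR : 0 < R)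
    (ha : 0 < a) (h : ((n : ℝ) - 1) / β ≤ a) : StrictMonoOn (resistance n β R) (Ici a) := by
  refine strictMonoOn_of_deriv_pos (convex_Ici a)
    ((continuousOn_resistance hn hβ hR).mono fun ρ hρ => ha.trans_le hρ) fun ρ hρ => ?_
  rw [interior_Ici] at hρ
  have hρ0 : 0 < ρ := ha.trans hρ
  rw [(hasDerivAt_resistance hn hβ hR hρ0).deriv]
  have : 0 < ρ - ((n : ℝ) - 1) / β := sub_pos.2 (h.trans_lt hρ)
  positivity

lemma strictAntiOn_resistance {n : ℕ} (hn : 1 ≤ n) {β R : ℝ} (hβ : 0 < β) (hR : 0 < R) :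
    StrictAntiOn (resistance n β R) (Ioc 0 (((n : ℝ) - 1) / β)) := by
  refine strictAntiOn_of_deriv_neg (convex_Ioc _ _)
    ((continuousOn_resistance hn hβ hR).mono fun ρ hρ => hρ.1) fun ρ hρ => ?_
  rw [interior_Ioc] at hρ
  rw [(hasDerivAt_resistance hn hβ hR hρ.1).deriv]
  exact mul_neg_of_pos_of_neg (inv_pos.2 (pow_pos hρ.1 n)) (sub_neg.2 hρ.2)

/-! ### The heat dispersion of a ball with a layer -/

lemma layerDispersion_ball {n : ℕ} [NeZero n] {β R δ : ℝ} (hβ : 0 < β) (hR : 0 < R) (hδ : 0 < δ) :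
    layerDispersion β δ (ball (0 : Eucl n) R) =
      ENNReal.ofReal ((sphereArea n).real univ / resistance n β R (R + δ)) := by
  rw [layerDispersion, closure_ball _ hR.ne', smul_unitBall hδ.ne', Real.norm_of_nonneg hδ.le,
    ball_add_ball hR hδ, add_zero, dispersion_ball hβ hR (by linarith)]

lemma layerDispersion_ball_lt {n : ℕ} [NeZero n] {β R δ δ' : ℝ} (hβ : 0 < β) (hR : 0 < R)
    (hδ : 0 < δ) (hδ' : 0 < δ') (h : resistance n β R (R + δ') < resistance n β R (R + δ)) :
    layerDispersion β δ (ball (0 : Eucl n) R) < layerDispersion β δ' (ball (0 : Eucl n) R) := by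
  have hc : 0 < (sphereArea n).real univ := by
    have : NeZero (sphereArea n) := ⟨by
      simp [sphereArea]⟩
    exact measureReal_univ_pos
  have h1 : 0 < resistance n β R (R + δ') := resistance_pos hβ hR (by linarith)
  rw [layerDispersion_ball hβ hR hδ, layerDispersion_ball hβ hR hδ']
  exact (ENNReal.ofReal_lt_ofReal_iff (div_pos hc h1)).2 (div_lt_div_of_pos_left hc h1 h)

end HeatDispersion

theorem mainTheorem3 (n : ℕ) (hn : 1 ≤ n) (R β : ℝ) (hR : 0 < R) (hβ : 0 < β) :
    (((n : ℝ) - 1) / R ≤ β →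
      StrictAntiOn (fun δ : ℝ => HeatDispersion.layerDispersion β δ
        (Metric.ball (0 : EuclideanSpace ℝ (Fin n)) R)) (Set.Ioi 0)) ∧
    (β < ((n : ℝ) - 1) / R →
      StrictMonoOn (fun δ : ℝ => HeatDispersion.layerDispersion β δ
        (Metric.ball (0 : EuclideanSpace ℝ (Fin n)) R))
        (Set.Ioc 0 (((n : ℝ) - 1) / β - R)) ∧
      StrictAntiOn (fun δ : ℝ => HeatDispersion.layerDispersion β δ
        (Metric.ball (0 : EuclideanSpace ℝ (Fin n)) R))
        (Set.Ici (((n : ℝ) - 1) / β - R))) := by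
  have : NeZero n := ⟨by omega⟩
  refine ⟨fun h => ?_, fun h => ?_⟩
  · have h' : ((n : ℝ) - 1) / β ≤ R := (div_le_comm₀ hβ hR).2 h
    intro δ hδ δ' hδ' hlt
    rw [Set.mem_Ioi] at hδ hδ'
    refine HeatDispersion.layerDispersion_ball_lt hβ hR hδ' hδ ?_
    exact HeatDispersion.strictMonoOn_resistance hn hβ hR hR h' (by simpa using hδ.le)
      (by simpa using hδ'.le) (by linarith)
  · have h' : R < ((n : ℝ) - 1) / β := (lt_div_comm₀ hβ hR).1 h
    refine ⟨fun δ hδ δ' hδ' hlt => ?_, fun δ hδ δ' hδ' hlt => ?_⟩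
    · refine HeatDispersion.layerDispersion_ball_lt hβ hR hδ.1 hδ'.1 ?_
      exact HeatDispersion.strictAntiOn_resistance hn hβ hR
        ⟨by linarith [hδ.1], by linarith [hδ.2]⟩ ⟨by linarith [hδ'.1], by linarith [hδ'.2]⟩
        (by linarith)
    -- By `h'` the critical thickness is positive, so every `δ` in this half-line is an admissible
    -- thickness.
    · rw [Set.mem_Ici] at hδ hδ'
      refine HeatDispersion.layerDispersion_ball_lt hβ hR (by linarith) (by linarith) ?_
      exact HeatDispersion.strictMonoOn_resistance hn hβ hR (hR.trans h') le_rfl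
        (Set.mem_Ici.2 (by linarith)) (Set.mem_Ici.2 (by linarith)) (by linarith)
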